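/- **Definitions.** Let $\gamma\subseteq\mathbb N\setminus\{0\}$. A $\gamma$-clique cover of a finite simple graph $G=(V,E)$ is a collection $\mathcal C$ of cliques of $G$, each of size belonging to $\gamma$, with $\bigcup_{C\in\mathcal C}C=V$; it is minimum if no $\gamma$-clique cover of $G$ has fewer cliques. The set $\gamma$ is polynomial-time decidable if a Turing machine decides, for $j\in\mathbb N$ given in unary, whether $j\in\gamma$ in time polynomial in $j$. A tree decomposition of $G$ is a tree $T$ with a bag $X_x\subseteq V$ for each node $x$, such that every vertex and both endpoints of every edge lie in some bag, and such that $v\in X_x\cap X_y$ implies $v\in X_z$ for all $z$ on the path from $x$ to $y$ in $T$; its width is $\max_x|X_x|-1$. **Model of computation.** For inputs of width $k$ we use a random access machine with words of $k+1$ bits. A $b$-bit number occupies $1+\lfloor b/(k+1)\rfloor$ words, and each use of it (as an operand of an addition, subtraction, halving or comparison, as an address, or when it is read or written) is charged that many time units. A multiplication of two numbers of at most $b$ bits takes time $i_\times(b)$, where $i_\times$ (which may depend on the word size) is any nondecreasing function with $i_\times(b)\ge 1+\lfloor b/(k+1)\rfloor$. The input consists of the adjacency matrices of $G$ and of $T$,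 the $0/1$ table of bag memberships, the number $n$ of vertices of $G$, the number of nodes of $T$, and $k$. **Theorem.** Let $\gamma\subseteq\mathbb N\setminus\{0\}$ be polynomial-time decidable. There is an algorithm that, given an $n$-vertex graph $G$ and a tree decomposition of $G$ of width $k$ with $O(n)$ nodes, computes the size of a minimum $\gamma$-clique cover of $G$ (if a $\gamma$-clique cover exists) and the number of minimum $\gamma$-clique covers of $G$ (this number is $0$ exactly when no $\gamma$-clique cover exists) in time $$O\bigl(n^3\,\log(k)\,2^k\, i_\times(nk+n\log n)\bigr).$$ The algorithm depends only on $\gamma$; the constant in the $O$ depends only on $\gamma$, on the function $i_\times$ and on the constant in the bound $O(n)$ on the number of nodes. Here $\log(k)$ stands for $1+\lfloor\log_2 k\rfloor$ (equal to $1$ for $k\in\{0,1\}$), and $\log n$ for $\lceil\log_2 n\rceil$. -/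

import Mathlib

/-! ### Clique covers -/

section CliqueCovers

variable {V : Type*}

/-- A `γ`-clique cover: a collection of cliques, with sizes in `γ`, that covers all vertices. -/
def IsCliqueCover (γ : Set ℕ) (G : SimpleGraph V) (𝒞 : Finset (Finset V)) : Prop :=
  (∀ K ∈ 𝒞, G.IsClique (K : Set V) ∧ K.card ∈ γ) ∧ ∀ v : V, ∃ K ∈ 𝒞, v ∈ K

/-- A `γ`-clique cover with the smallest possible number of cliques. -/
def IsMinimumCliqueCover (γ : Set ℕ) (G : SimpleGraph V) (𝒞 : Finset (Finset V)) : Prop :=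
  IsCliqueCover γ G 𝒞 ∧ ∀ 𝒟 : Finset (Finset V), IsCliqueCover γ G 𝒟 → 𝒞.card ≤ 𝒟.card

end CliqueCovers

/-! ### Tree decompositions -/

/-- A tree decomposition of `G` whose tree has node set `ι`. -/
structure TreeDecomposition {V : Type*} (G : SimpleGraph V) (ι : Type*) where
  tree : SimpleGraph ι
  isTree : tree.IsTree
  bag : ι → Finset V
  vertex_mem : ∀ v : V, ∃ x : ι, v ∈ bag x
  edge_mem : ∀ u v : V, G.Adj u v → ∃ x : ι, u ∈ bag x ∧ v ∈ bag x
  mem_of_path : ∀ (v : V) (x y : ι) (p : tree.Walk x y), p.IsPath →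
    v ∈ bag x → v ∈ bag y → ∀ z ∈ p.support, v ∈ bag z

/-- The width is `k`: the largest bag has exactly `k + 1` elements. -/
def TreeDecomposition.HasWidth {V ι : Type*} {G : SimpleGraph V}
    (D : TreeDecomposition G ι) (k : ℕ) : Prop :=
  (∀ x : ι, (D.bag x).card ≤ k + 1) ∧ ∃ x : ι, (D.bag x).card = k + 1

/-! ### Polynomial-time decidable sets of numbers -/

open Classical in
/-- Membership of `j` in `γ` can be decided in time polynomial in `j`: some Turing machine, given
`j` in unary, outputs the bit `[j ∈ γ]` in time polynomial in the length of its input. -/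
def PolyTimeDecidable (γ : Set ℕ) : Prop :=
  Nonempty (Turing.TM2ComputableInPolyTime Computability.unaryEncodeNat Computability.encodeBool
    (fun j : ℕ => decide (j ∈ γ)))

/-! ### Random access machines

Programs of a random access machine, in structured form.  The machine has registers and finitely
many arrays (a program mentions only finitely many of them), whose cells hold natural numbers.
The words have `w` bits: a number of `b` bits occupies `b / w + 1` words, and every use of it, as
an operand, as an address, or when it is read or written, is charged that many time units.
A multiplication of `b`-bit numbers is charged `iMul w b`. -/

namespace RAM

structure State where
  reg : ℕ → ℕ
  mem : ℕ → ℕ → ℕ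

inductive Expr where
  | const (c : ℕ)
  | reg (x : ℕ)
  | load (A : ℕ) (i : Expr)
  | add (e f : Expr)
  | sub (e f : Expr)
  | mul (e f : Expr)
  | half (e : Expr)
  | lt (e f : Expr)
  | eq (e f : Expr)

inductive Cmd where
  | skip
  | assign (x : ℕ) (e : Expr)
  | store (A : ℕ) (i e : Expr)
  | seq (p q : Cmd)
  | ite (c : Expr) (p q : Cmd)
  | loop (c : Expr) (p : Cmd)

/-- The number of `w`-bit words that are charged for the number `v`. -/
def words (w v : ℕ) : ℕ := Nat.size v / w + 1

/-- The value of an expression. Subtraction is truncated, `half` rounds down. -/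
def Expr.eval (s : State) : Expr → ℕ
  | .const c => c
  | .reg x => s.reg x
  | .load A i => s.mem A (i.eval s)
  | .add e f => e.eval s + f.eval s
  | .sub e f => e.eval s - f.eval s
  | .mul e f => e.eval s * f.eval s
  | .half e => e.eval s / 2
  | .lt e f => if e.eval s < f.eval s then 1 else 0
  | .eq e f => if e.eval s = f.eval s then 1 else 0

/-- The time needed to evaluate an expression. -/
def Expr.cost (w : ℕ) (iMul : ℕ → ℕ → ℕ) (s : State) : Expr → ℕ
  | .const c => words w c
  | .reg x => words w (s.reg x)
  | .load A i => i.cost w iMul s + words w (i.eval s) + words w (s.mem A (i.eval s))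
  | .add e f => e.cost w iMul s + f.cost w iMul s + words w (e.eval s) + words w (f.eval s)
  | .sub e f => e.cost w iMul s + f.cost w iMul s + words w (e.eval s) + words w (f.eval s)
  | .mul e f => e.cost w iMul s + f.cost w iMul s +
      iMul w (max (Nat.size (e.eval s)) (Nat.size (f.eval s)))
  | .half e => e.cost w iMul s + words w (e.eval s)
  | .lt e f => e.cost w iMul s + f.cost w iMul s + words w (e.eval s) + words w (f.eval s)
  | .eq e f => e.cost w iMul s + f.cost w iMul s + words w (e.eval s) + words w (f.eval s)

def State.setReg (s : State) (x v : ℕ) : State :=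
  { s with reg := Function.update s.reg x v }

def State.setMem (s : State) (A i v : ℕ) : State :=
  { s with mem := Function.update s.mem A (Function.update (s.mem A) i v) }

/-- `Exec w iMul p s s' t`: started in state `s`, the program `p` halts in state `s'` after `t`
time units. -/
inductive Exec (w : ℕ) (iMul : ℕ → ℕ → ℕ) : Cmd → State → State → ℕ → Prop where
  | skip (s : State) : Exec w iMul .skip s s 1
  | assign (x : ℕ) (e : Expr) (s : State) :
      Exec w iMul (.assign x e) s (s.setReg x (e.eval s))
        (e.cost w iMul s + words w (e.eval s))
  | store (A : ℕ) (i e : Expr) (s : State) :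
      Exec w iMul (.store A i e) s (s.setMem A (i.eval s) (e.eval s))
        (i.cost w iMul s + e.cost w iMul s + words w (i.eval s) + words w (e.eval s))
  | seq {p q : Cmd} {s₁ s₂ s₃ : State} {t₁ t₂ : ℕ} :
      Exec w iMul p s₁ s₂ t₁ → Exec w iMul q s₂ s₃ t₂ →
        Exec w iMul (.seq p q) s₁ s₃ (t₁ + t₂)
  | ite_true {c : Expr} {p q : Cmd} {s s' : State} {t : ℕ} :
      c.eval s ≠ 0 → Exec w iMul p s s' t →
        Exec w iMul (.ite c p q) s s' (c.cost w iMul s + words w (c.eval s) + t)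
  | ite_false {c : Expr} {p q : Cmd} {s s' : State} {t : ℕ} :
      c.eval s = 0 → Exec w iMul q s s' t →
        Exec w iMul (.ite c p q) s s' (c.cost w iMul s + words w (c.eval s) + t)
  | loop_true {c : Expr} {p : Cmd} {s₁ s₂ s₃ : State} {t₁ t₂ : ℕ} :
      c.eval s₁ ≠ 0 → Exec w iMul p s₁ s₂ t₁ → Exec w iMul (.loop c p) s₂ s₃ t₂ →
        Exec w iMul (.loop c p) s₁ s₃
          (c.cost w iMul s₁ + words w (c.eval s₁) + t₁ + t₂)
  | loop_false {c : Expr} {p : Cmd} {s : State} :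
      c.eval s = 0 →
        Exec w iMul (.loop c p) s s (c.cost w iMul s + words w (c.eval s))

open Classical in
/-- The initial state for a graph on `n` vertices and a tree decomposition with `N` nodes and
width `k`: registers `0`, `1`, `2` hold `n`, `N`, `k`, and arrays `0`, `1`, `2` hold, row by row,
the adjacency matrix of the graph, the adjacency matrix of the tree, and the node-vertex incidence
matrix of the bags; all other cells are `0`. -/
noncomputable def inputState {n N : ℕ} (G : SimpleGraph (Fin n))
    (D : TreeDecomposition G (Fin N)) (k : ℕ) : State where
  reg x := if x = 0 then n else if x = 1 then N else if x = 2 then k else 0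
  mem A i :=
    if A = 0 then
      if ∃ u v : Fin n, i = u * n + v ∧ G.Adj u v then 1 else 0
    else if A = 1 then
      if ∃ x y : Fin N, i = x * N + y ∧ D.tree.Adj x y then 1 else 0
    else if A = 2 then
      if ∃ (x : Fin N) (v : Fin n), i = x * n + v ∧ v ∈ D.bag x then 1 else 0
    else 0

end RAM

/-! ### Bounded execution of random access machine programs -/

namespace RAM

/-! The count is inclusion–exclusion over the vertices, carried out one vertex at a time along an
elimination order. Order the vertices by the first bag that contains them in a traversal of the
tree. The earlier neighbours of `v` then lie in a set `nbr v` of at most `k` vertices, and if `p` is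
the last element of `nbr v` (the parent of `v`), then `nbr v ⊆ {p} ∪ nbr p`; both facts follow from
the running intersection property `NodeOrder.mem_bag_of_mem`. Every nonempty clique lies in `{v} ∪
nbr v` for its last vertex `v`. So the admissible cliques are distributed over the vertices, and
there are at most `n * 2 ^ k` of them.

Let `gen r Y` be the generating function, by cardinality, of the families of admissible cliques that
cover every vertex of rank at least `r` and use no vertex of smaller rank outside `Y`. For `r = n`
it is `(1 + X) ^ c` with `c` the number of cliques inside `Y`, a product of one factor per last
vertex. If `v` has rank `r`, then `gen r Y = gen (r + 1) (Y ∪ {v}) - gen (r + 1) Y`, which is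
`Elimination.gen_succ`. Only the factor of `v` notices whether `v ∈ Y`. Eliminating `v` therefore
replaces that factor by `F Y = T v (Y ∪ {v}) - T v (Y \ {v})`, which depends on `Y ∩ nbr v` only and
can be multiplied into the factor of the parent; this is `Elimination.Table.step`. After all
eliminations one polynomial is left at the root, whose coefficient at `X ^ d` is the number of
covers with `d` cliques. A minimum cover has at most `n` cliques, so all polynomials may be
truncated after degree `n`.

Two facts control the numbers. All tables are zeta transforms of functions with nonnegative
coefficients, a property stable under products (`IsZeta.mul`) and under the differences above
(`IsZeta.exists_diff`), so truncated subtraction of natural numbers is exact. All coefficients are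
bounded by those of `(1 + X) ^ (n * 2 ^ k)`, which up to degree `n` have essentially at most `n * k
+ n * log n` bits (`RAM.fits_numBits`).

For the memory layout the vertices are coloured greedily with `k + 1` colours so that the colours on
each `{v} ∪ nbr v` are distinct. A subset of a bag is a mask of `k + 1` bits, and the same mask
describes the same part of `nbr v` in the bags of `v` and of its parent. There are `n` eliminations,
`2 ^ (k + 1)` masks and a quadratic convolution for each, which gives the order of `n ^ 3 * 2 ^ k`
multiplications.

Running times are counted in ticks, multiples of a unit `U` that bounds one multiplication and the
handling of one number; a fixed loop-free piece of program takes a constant number of ticks.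
Membership in `γ` for the sizes up to `k + 1` is tabulated beforehand by simulating the deciding
stack machine (`RAM.exists_tabulate`), in time polynomial in `k` and hence `O(2 ^ k)`. -/

theorem words_le {w v B : ℕ} (h : v < 2 ^ B) : words w v ≤ B / w + 1 :=
  Nat.succ_le_succ (Nat.div_le_div_right (Nat.size_le.2 h))

/-- A factor by which the value of an expression may be longer than the values it is made of. -/
def Expr.growth : Expr → ℕ
  | .const c => c
  | .reg _ => 1
  | .load _ _ => 1
  | .add e f => e.growth + f.growth + 1
  | .sub e _ => e.growth
  | .mul e f => e.growth + f.growth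
  | .half e => e.growth
  | .lt _ _ => 1
  | .eq _ _ => 1

/-- The number of ticks charged for the evaluation of an expression. -/
def Expr.tick : Expr → ℕ
  | .const c => c + 1
  | .reg _ => 2
  | .load _ i => i.tick + i.growth + 3
  | .add e f => e.tick + f.tick + e.growth + f.growth + 2
  | .sub e f => e.tick + f.tick + e.growth + f.growth + 2
  | .mul e f => e.tick + f.tick + 1
  | .half e => e.tick + e.growth + 1
  | .lt e f => e.tick + f.tick + e.growth + f.growth + 2
  | .eq e f => e.tick + f.tick + e.growth + f.growth + 2

/-- All values read by the expression, and all factors in it, have at most `B` bits, and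
multiplications take time at most `U`. -/
def Expr.Within (w : ℕ) (iMul : ℕ → ℕ → ℕ) (B U : ℕ) (s : State) : Expr → Prop
  | .const _ => True
  | .reg x => s.reg x < 2 ^ B
  | .load A i => i.Within w iMul B U s ∧ s.mem A (i.eval s) < 2 ^ B
  | .add e f => e.Within w iMul B U s ∧ f.Within w iMul B U s
  | .sub e f => e.Within w iMul B U s ∧ f.Within w iMul B U s
  | .mul e f => (e.Within w iMul B U s ∧ f.Within w iMul B U s) ∧
      (e.eval s < 2 ^ B ∧ f.eval s < 2 ^ B) ∧ iMul w B ≤ U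
  | .half e => e.Within w iMul B U s
  | .lt e f => e.Within w iMul B U s ∧ f.Within w iMul B U s
  | .eq e f => e.Within w iMul B U s ∧ f.Within w iMul B U s

/-! ### Cost of evaluating one expression -/

section Within

variable {w : ℕ} {iMul : ℕ → ℕ → ℕ} {B U : ℕ} {s : State}

theorem Expr.eval_lt_of_within (hB : 1 ≤ B) :
    ∀ {e : Expr}, e.Within w iMul B U s → e.eval s < 2 ^ (e.growth * B)
  | .const c, _ => lt_of_lt_of_le c.lt_two_pow_self
      (Nat.pow_le_pow_right two_pos (Nat.le_mul_of_pos_right c hB))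
  | .reg x, h => by
      have h : s.reg x < 2 ^ B := h
      simpa [eval, growth] using h
  | .load A i, h => by simpa [eval, growth] using h.2
  | .add e f, h => by
      have he := eval_lt_of_within hB h.1
      have hf := eval_lt_of_within hB h.2
      have h1 : 2 ^ (e.growth * B) ≤ 2 ^ ((e.growth + f.growth) * B) :=
        Nat.pow_le_pow_right two_pos (Nat.mul_le_mul_right _ (by omega))
      have h2 : 2 ^ (f.growth * B) ≤ 2 ^ ((e.growth + f.growth) * B) :=
        Nat.pow_le_pow_right two_pos (Nat.mul_le_mul_right _ (by omega))
      have h3 : 2 ^ ((e.growth + f.growth) * B + 1) ≤ 2 ^ ((e.growth + f.growth + 1) * B) :=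
        Nat.pow_le_pow_right two_pos (by rw [Nat.add_mul _ 1]; omega)
      rw [pow_succ] at h3
      simp only [eval, growth]
      omega
  | .sub e f, h => lt_of_le_of_lt (Nat.sub_le _ _) (eval_lt_of_within hB h.1)
  | .mul e f, h => by
      have he := eval_lt_of_within hB h.1.1
      have hf := eval_lt_of_within hB h.1.2
      simp only [eval, growth, Nat.add_mul, pow_add]
      exact Nat.mul_lt_mul'' he hf
  | .half e, h => lt_of_le_of_lt (Nat.div_le_self _ _) (eval_lt_of_within hB h)
  | .lt e f, _ => by
      have : 2 ^ 1 ≤ 2 ^ B := Nat.pow_le_pow_right two_pos hB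
      simp only [eval, growth, one_mul]
      split_ifs <;> omega
  | .eq e f, _ => by
      have : 2 ^ 1 ≤ 2 ^ B := Nat.pow_le_pow_right two_pos hB
      simp only [eval, growth, one_mul]
      split_ifs <;> omega

/-- Since `B ≤ w * (B / w + 1)`, a number of `g * B` bits fills at most `g * (B / w + 1)` words, and
one more is charged. For `w = 0` the quotient is `0`, so every number counts as a single word. -/
theorem words_le_mul {g v : ℕ} (hU : B / w + 1 ≤ U) (h : v < 2 ^ (g * B)) :
    words w v ≤ (g + 1) * U := by
  have h1 := words_le (w := w) h
  rcases Nat.eq_zero_or_pos w with rfl | hw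
  · simp only [Nat.div_zero] at *
    nlinarith
  have h2 : g * B / w ≤ g * (B / w + 1) := by
    rw [Nat.div_le_iff_le_mul_add_pred hw]
    have h3 : B ≤ w * (B / w + 1) := by
      have h4 := Nat.div_add_mod B w
      have h5 := Nat.mod_lt B hw
      rw [Nat.mul_add]
      omega
    calc g * B ≤ g * (w * (B / w + 1)) := Nat.mul_le_mul_left _ h3
      _ = w * (g * (B / w + 1)) := by ring
      _ ≤ _ := Nat.le_add_right _ _
  have h3 : g * (B / w + 1) ≤ g * U := Nat.mul_le_mul_left _ hU
  have h4 : 1 ≤ U := (Nat.le_add_left 1 _).trans hU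
  rw [Nat.add_mul, one_mul]
  omega

theorem Expr.words_eval_le (hB : 1 ≤ B) (hU : B / w + 1 ≤ U) {e : Expr}
    (h : e.Within w iMul B U s) : words w (e.eval s) ≤ (e.growth + 1) * U :=
  words_le_mul hU (Expr.eval_lt_of_within hB h)

/-- One unit `U` pays for a multiplication of `B`-bit factors and for handling a `B`-bit number;
longer intermediate values cost a multiple of `U` determined by `growth`. The number of units
depends only on the syntax of the expression, not on the state. -/
theorem Expr.cost_le (hmono : Monotone (iMul w)) (hB : 1 ≤ B) (hU : B / w + 1 ≤ U) :
    ∀ {e : Expr}, e.Within w iMul B U s → e.cost w iMul s ≤ e.tick * U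
  | .const c, h => Expr.words_eval_le (s := s) (e := .const c) hB hU h
  | .reg x, h => Expr.words_eval_le (s := s) (e := .reg x) hB hU h
  | .load A i, h => by
      have h1 := cost_le hmono hB hU h.1
      have h2 := Expr.words_eval_le hB hU h.1
      have h3 := Expr.words_eval_le (s := s) (e := .load A i) hB hU h
      simp only [cost, tick, eval, growth] at *
      linarith
  | .add e f, h | .sub e f, h | .lt e f, h | .eq e f, h => by
      have h1 := cost_le hmono hB hU h.1
      have h2 := cost_le hmono hB hU h.2
      have h3 := Expr.words_eval_le hB hU h.1
      have h4 := Expr.words_eval_le hB hU h.2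
      simp only [cost, tick] at *
      linarith
  | .mul e f, h => by
      have h1 := cost_le hmono hB hU h.1.1
      have h2 := cost_le hmono hB hU h.1.2
      have h3 : iMul w (max (Nat.size (e.eval s)) (Nat.size (f.eval s))) ≤ U :=
        (hmono (max_le (Nat.size_le.2 h.2.1.1) (Nat.size_le.2 h.2.1.2))).trans h.2.2
      simp only [cost, tick] at *
      linarith
  | .half e, h => by
      have h1 := cost_le hmono hB hU (e := e) h
      have h3 := Expr.words_eval_le hB hU (e := e) h
      simp only [cost, tick] at *
      linarith

end Within

/-- Factors in the expression are contents of registers or memory cells. -/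
def Expr.Simple : Expr → Bool
  | .const _ => true
  | .reg _ => true
  | .load _ i => i.Simple
  | .add e f | .sub e f | .lt e f | .eq e f => e.Simple && f.Simple
  | .mul (.reg _) (.reg _) => true
  | .mul (.reg _) (.load _ i) => i.Simple
  | .mul (.load _ i) (.reg _) => i.Simple
  | .mul (.load _ i) (.load _ j) => i.Simple && j.Simple
  | .mul _ _ => false
  | .half e => e.Simple

/-- All registers and memory cells have at most `B` bits. -/
def Bdd (B : ℕ) (s : State) : Prop :=
  (∀ x, s.reg x < 2 ^ B) ∧ ∀ A i, s.mem A i < 2 ^ B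

theorem Bdd.setReg {B : ℕ} {s : State} (h : Bdd B s) {x v : ℕ} (hv : v < 2 ^ B) :
    Bdd B (s.setReg x v) := by
  refine ⟨fun y => ?_, h.2⟩
  by_cases hy : y = x
  · subst hy; simpa [State.setReg] using hv
  · simpa [State.setReg, hy] using h.1 y

theorem Bdd.setMem {B : ℕ} {s : State} (h : Bdd B s) {A i v : ℕ} (hv : v < 2 ^ B) :
    Bdd B (s.setMem A i v) := by
  refine ⟨h.1, fun C j => ?_⟩
  by_cases hC : C = A
  · subst hC
    by_cases hj : j = i
    · subst hj; simpa [State.setMem] using hv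
    · simpa [State.setMem, hj] using h.2 C j
  · simpa [State.setMem, hC] using h.2 C j

/-- Intermediate sums may exceed `B` bits, but a simple expression multiplies only contents of
registers and cells, so every factor stays within `B` bits. -/
theorem Bdd.within {w : ℕ} {iMul : ℕ → ℕ → ℕ} {B U : ℕ} {s : State} (h : Bdd B s)
    (hU : iMul w B ≤ U) (e : Expr) (he : e.Simple = true) : e.Within w iMul B U s := by
  induction e with
  | const c => trivial
  | reg x => exact h.1 x
  | load A i ih => exact ⟨ih he, h.2 _ _⟩
  | add e f ihe ihf | sub e f ihe ihf | lt e f ihe ihf | eq e f ihe ihf =>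
      simp only [Expr.Simple, Bool.and_eq_true] at he
      exact ⟨ihe he.1, ihf he.2⟩
  | half e ih => exact ih he
  | mul e f ihe ihf =>
      have key : (e.Simple = true ∧ f.Simple = true) ∧ e.eval s < 2 ^ B ∧ f.eval s < 2 ^ B := by
        cases e <;> cases f <;>
          simp_all [Expr.Simple, Expr.eval, h.1 _, h.2 _ _]
      exact ⟨⟨ihe key.1.1, ihf key.1.2⟩, key.2, hU⟩

/-! ### Loop-free programs -/

def Cmd.flat : Cmd → Bool
  | .skip => true
  | .assign _ e => e.Simple
  | .store _ i e => i.Simple && e.Simple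
  | .seq p q => p.flat && q.flat
  | .ite c p q => c.Simple && p.flat && q.flat
  | .loop _ _ => false

/-- The maximum over both branches makes the bound independent of the state. The value at a loop is
a placeholder: only loop-free programs are measured this way. -/
def Cmd.tick : Cmd → ℕ
  | .skip => 1
  | .assign _ e => e.tick + e.growth + 1
  | .store _ i e => i.tick + e.tick + i.growth + e.growth + 2
  | .seq p q => p.tick + q.tick
  | .ite c p q => c.tick + c.growth + 1 + max p.tick q.tick
  | .loop _ _ => 0

/-- The effect of a loop-free program. -/
def Cmd.den : Cmd → State → State
  | .skip, s => s
  | .assign x e, s => s.setReg x (e.eval s)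
  | .store A i e, s => s.setMem A (i.eval s) (e.eval s)
  | .seq p q, s => q.den (p.den s)
  | .ite c p q, s => if c.eval s ≠ 0 then p.den s else q.den s
  | .loop _ _, s => s

/-- The smallest number with more than `B` bits. -/
def lim (B : ℕ) : ℕ := 2 ^ B

theorem Bdd.reg_lt {B : ℕ} {s : State} (h : Bdd B s) (x : ℕ) : s.reg x < lim B := h.1 x

theorem Bdd.mem_lt {B : ℕ} {s : State} (h : Bdd B s) (A i : ℕ) : s.mem A i < lim B := h.2 A i

/-- All values written by a loop-free program have at most `B` bits. -/
def Cmd.Safe (B : ℕ) : Cmd → State → Prop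
  | .skip, _ => True
  | .assign _ e, s => e.eval s < lim B
  | .store _ _ e, s => e.eval s < lim B
  | .seq p q, s => p.Safe B s ∧ q.Safe B (p.den s)
  | .ite c p q, s => if c.eval s ≠ 0 then p.Safe B s else q.Safe B s
  | .loop _ _, _ => True

/-! ### Frames -/

/-- The registers a program may write. -/
def Cmd.wreg : Cmd → List ℕ
  | .skip => []
  | .assign x _ => [x]
  | .store _ _ _ => []
  | .seq p q => p.wreg ++ q.wreg
  | .ite _ p q => p.wreg ++ q.wreg
  | .loop _ p => p.wreg

/-- The arrays a program may write. -/
def Cmd.warr : Cmd → List ℕ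
  | .skip => []
  | .assign _ _ => []
  | .store A _ _ => [A]
  | .seq p q => p.warr ++ q.warr
  | .ite _ p q => p.warr ++ q.warr
  | .loop _ p => p.warr

/-- The sets of written registers and arrays are read off the syntax, so the survival of anything
untouched is settled by `decide`. -/
def Frame (p : Cmd) (s s' : State) : Prop :=
  (∀ x, x ∉ p.wreg → s'.reg x = s.reg x) ∧ ∀ A, A ∉ p.warr → s'.mem A = s.mem A

theorem Frame.refl (p : Cmd) (s : State) : Frame p s s := ⟨fun _ _ => rfl, fun _ _ => rfl⟩

theorem Frame.mono {p r : Cmd} {s s' : State} (h : Frame p s s') (h₁ : p.wreg ⊆ r.wreg)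
    (h₂ : p.warr ⊆ r.warr) : Frame r s s' :=
  ⟨fun x hx => h.1 x fun h' => hx (h₁ h'), fun x hx => h.2 x fun h' => hx (h₂ h')⟩

theorem Frame.trans {r : Cmd} {s₁ s₂ s₃ : State} (h₁ : Frame r s₁ s₂) (h₂ : Frame r s₂ s₃) :
    Frame r s₁ s₃ :=
  ⟨fun x hx => (h₂.1 x hx).trans (h₁.1 x hx), fun x hx => (h₂.2 x hx).trans (h₁.2 x hx)⟩

theorem frame_of_exec {w : ℕ} {iMul : ℕ → ℕ → ℕ} {p : Cmd} {s s' : State} {t : ℕ}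
    (h : Exec w iMul p s s' t) : Frame p s s' := by
  induction h with
  | skip s => exact Frame.refl _ _
  | assign x e s =>
      refine ⟨fun y hy => ?_, fun _ _ => rfl⟩
      simp only [Cmd.wreg, List.mem_singleton] at hy
      simp [State.setReg, hy]
  | store A i e s =>
      refine ⟨fun _ _ => rfl, fun y hy => ?_⟩
      simp only [Cmd.warr, List.mem_singleton] at hy
      simp [State.setMem, hy]
  | seq _ _ ih₁ ih₂ =>
      exact (ih₁.mono (by simp [Cmd.wreg]) (by simp [Cmd.warr])).trans
        (ih₂.mono (by simp [Cmd.wreg]) (by simp [Cmd.warr]))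
  | ite_true _ _ ih | ite_false _ _ ih =>
      exact ih.mono (by simp [Cmd.wreg]) (by simp [Cmd.warr])
  | loop_true _ _ _ ih₁ ih₂ =>
      exact (ih₁.mono (by simp [Cmd.wreg]) (by simp [Cmd.warr])).trans
        (ih₂.mono (by simp [Cmd.wreg]) (by simp [Cmd.warr]))
  | loop_false _ => exact Frame.refl _ _

/-! ### Reasoning about bounded runs -/

/-- The parameters of a bounded run: word size, multiplication time, a bound for the number of bits
of all values, and a bound for the time per basic operation. -/
structure Env where
  w : ℕ
  iMul : ℕ → ℕ → ℕ
  B : ℕ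
  U : ℕ
  mono : Monotone (iMul w)
  one_le : 1 ≤ B
  words_le : B / w + 1 ≤ U
  mul_le : iMul w B ≤ U

/-- From `s`, the program `p` reaches a state with property `Q` within `T` ticks. -/
def Env.Runs (E : Env) (p : Cmd) (s : State) (T : ℕ) (Q : State → Prop) : Prop :=
  ∃ s' t, Exec E.w E.iMul p s s' t ∧ t ≤ T * E.U ∧ Bdd E.B s' ∧ Q s'

namespace Env

variable {E : Env} {p q : Cmd} {s : State} {T T₁ T₂ : ℕ} {P Q R : State → Prop}

theorem Runs.weaken (h : E.Runs p s T₁ P) (hT : T₁ ≤ T₂)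
    (hPQ : ∀ s', Bdd E.B s' → Frame p s s' → P s' → Q s') : E.Runs p s T₂ Q := by
  obtain ⟨s', t, hex, ht, hb, hP⟩ := h
  exact ⟨s', t, hex, ht.trans (Nat.mul_le_mul_right _ hT), hb, hPQ s' hb (frame_of_exec hex) hP⟩

theorem Runs.seq (h : E.Runs p s T₁ P)
    (h' : ∀ s', Bdd E.B s' → Frame p s s' → P s' → E.Runs q s' T₂ Q) :
    E.Runs (.seq p q) s (T₁ + T₂) Q := by
  obtain ⟨s₁, t₁, hex₁, ht₁, hb₁, hP⟩ := h
  obtain ⟨s₂, t₂, hex₂, ht₂, hb₂, hQ⟩ := h' s₁ hb₁ (frame_of_exec hex₁) hP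
  exact ⟨s₂, t₁ + t₂, .seq hex₁ hex₂, by rw [Nat.add_mul]; omega, hb₂, hQ⟩

/-- A loop-free program needs no invariants: it is enough to compute its effect `den`, to see that
the values written on the way stay within `B` bits, and to verify the postcondition there. For a
concrete program the tick count is a numeral. -/
theorem runs_flat (hs : Bdd E.B s) (hp : p.flat = true) (hsafe : p.Safe E.B s) (hQ : Q (p.den s)) :
    E.Runs p s p.tick Q := by
  induction p generalizing s Q with
  | skip => exact ⟨s, 1, .skip s, by simpa [Cmd.tick] using (Nat.le_add_left 1 _).trans E.words_le,
      hs, hQ⟩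
  | assign x e =>
      have he := hs.within E.mul_le e hp
      refine ⟨_, _, .assign x e s, ?_, hs.setReg hsafe, hQ⟩
      have h1 := Expr.cost_le E.mono E.one_le E.words_le he
      have h2 := Expr.words_eval_le E.one_le E.words_le he
      simp only [Cmd.tick]
      linarith
  | store A i e =>
      simp only [Cmd.flat, Bool.and_eq_true] at hp
      have hi := hs.within E.mul_le i hp.1
      have he := hs.within E.mul_le e hp.2
      refine ⟨_, _, .store A i e s, ?_, hs.setMem hsafe, hQ⟩
      have h1 := Expr.cost_le E.mono E.one_le E.words_le he
      have h2 := Expr.words_eval_le E.one_le E.words_le he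
      have h3 := Expr.cost_le E.mono E.one_le E.words_le hi
      have h4 := Expr.words_eval_le E.one_le E.words_le hi
      simp only [Cmd.tick]
      linarith
  | seq p q ihp ihq =>
      simp only [Cmd.flat, Bool.and_eq_true] at hp
      refine Runs.seq (ihp hs hp.1 hsafe.1 (Q := fun s' => s' = p.den s) rfl) ?_
      rintro s' hb - rfl
      exact ihq hb hp.2 hsafe.2 hQ
  | ite c p q ihp ihq =>
      simp only [Cmd.flat, Bool.and_eq_true] at hp
      have hc := hs.within E.mul_le c hp.1.1
      have h1 := Expr.cost_le E.mono E.one_le E.words_le hc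
      have h2 := Expr.words_eval_le E.one_le E.words_le hc
      simp only [Cmd.Safe, Cmd.den] at hsafe hQ
      by_cases hz : c.eval s ≠ 0
      · rw [if_pos hz] at hsafe hQ
        obtain ⟨s', t, hex, ht, hb, hQ'⟩ := ihp hs hp.1.2 hsafe hQ
        refine ⟨s', _, .ite_true hz hex, ?_, hb, hQ'⟩
        have := Nat.mul_le_mul_right E.U (le_max_left p.tick q.tick)
        simp only [Cmd.tick]
        linarith
      · rw [if_neg hz] at hsafe hQ
        obtain ⟨s', t, hex, ht, hb, hQ'⟩ := ihq hs hp.2 hsafe hQ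
        refine ⟨s', _, .ite_false (not_not.1 hz) hex, ?_, hb, hQ'⟩
        have := Nat.mul_le_mul_right E.U (le_max_right p.tick q.tick)
        simp only [Cmd.tick]
        linarith
  | loop c p => simp [Cmd.flat] at hp

theorem runs_ite {c : Expr} (hs : Bdd E.B s) (hc : c.Simple = true)
    (h₁ : c.eval s ≠ 0 → E.Runs p s T Q) (h₂ : c.eval s = 0 → E.Runs q s T Q) :
    E.Runs (.ite c p q) s (c.tick + c.growth + 1 + T) Q := by
  have hc := hs.within E.mul_le c hc
  have h1 := Expr.cost_le E.mono E.one_le E.words_le hc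
  have h2 := Expr.words_eval_le E.one_le E.words_le hc
  by_cases hz : c.eval s ≠ 0
  · obtain ⟨s', t, hex, ht, hb, hQ'⟩ := h₁ hz
    exact ⟨s', _, .ite_true hz hex, by linarith, hb, hQ'⟩
  · obtain ⟨s', t, hex, ht, hb, hQ'⟩ := h₂ (not_not.1 hz)
    exact ⟨s', _, .ite_false (not_not.1 hz) hex, by linarith, hb, hQ'⟩

end Env

/-- `for x = 0, …, reg y - 1 do p`. -/
def Cmd.for (x y : ℕ) (p : Cmd) : Cmd :=
  .seq (.assign x (.const 0))
    (.loop (.lt (.reg x) (.reg y)) (.seq p (.assign x (.add (.reg x) (.const 1)))))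

namespace Env

variable {E : Env} {p : Cmd} {s : State} {T : ℕ} {Q : State → Prop}

/-- The body writes neither the counter nor the bound, so there are exactly `n` rounds. The
invariant for round `i + 1` is required after the counter has been advanced. Per round, 19 ticks
amply cover test and increment; the initial assignment takes 2. -/
theorem runs_for {x y n : ℕ} (hx : x ∉ p.wreg) (hy : y ∉ x :: p.wreg) (hs : Bdd E.B s)
    (hn : s.reg y = n) (I : ℕ → State → Prop) (h0 : I 0 (s.setReg x 0))
    (hstep : ∀ i < n, ∀ s', Bdd E.B s' → Frame (.for x y p) s s' → s'.reg x = i → I i s' →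
      E.Runs p s' T fun s'' => I (i + 1) (s''.setReg x (i + 1)))
    (hQ : ∀ s', Bdd E.B s' → Frame (.for x y p) s s' → I n s' → Q s') :
    E.Runs (.for x y p) s ((n + 1) * (T + 21)) Q := by
  have hyx : y ≠ x := fun h => hy (by simp [h])
  have hyp : y ∉ p.wreg := fun h => hy (by simp [h])
  have hnB : n < 2 ^ E.B := hn ▸ hs.1 y
  have hU : ∀ {v : ℕ}, v < 2 ^ E.B → words E.w v ≤ E.U :=
    fun hv => (RAM.words_le hv).trans E.words_le
  have hone : 1 < 2 ^ E.B := Nat.one_lt_two_pow (by have := E.one_le; omega)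
  -- Induction on the number `j` of rounds still to be executed.
  have key : ∀ j i s', i + j = n → Bdd E.B s' → Frame (.for x y p) s s' → s'.reg x = i → I i s' →
      E.Runs (.loop (.lt (.reg x) (.reg y)) (.seq p (.assign x (.add (.reg x) (.const 1))))) s'
        ((j + 1) * (T + 19)) fun s'' => I n s'' := by
    intro j
    induction j with
    | zero =>
        intro i s' hi hb hf hxi hI
        have hyn : s'.reg y = n := (hf.1 y (by simp [Cmd.for, Cmd.wreg, hyx, hyp])).trans hn
        obtain rfl : i = n := hi
        refine ⟨s', _, .loop_false (by simp [Expr.eval, hxi, hyn]), ?_, hb, hI⟩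
        have h1 := hU hnB
        have h2 := hU (lt_trans Nat.zero_lt_one hone)
        simp only [Expr.cost, Expr.eval, hxi, hyn, lt_irrefl, if_false]
        nlinarith
    | succ j ih =>
        intro i s' hi hb hf hxi hI
        have hyn : s'.reg y = n := (hf.1 y (by simp [Cmd.for, Cmd.wreg, hyx, hyp])).trans hn
        have hin : i < n := by omega
        obtain ⟨s₁, t₁, hex₁, ht₁, hb₁, hI₁⟩ := hstep i hin s' hb hf hxi hI
        have hf₁ := frame_of_exec hex₁
        have hxi₁ : s₁.reg x = i := (hf₁.1 x hx).trans hxi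
        have he : (Expr.add (.reg x) (.const 1)).eval s₁ = i + 1 := by simp [Expr.eval, hxi₁]
        have hex₂ := Exec.assign (w := E.w) (iMul := E.iMul) x (.add (.reg x) (.const 1)) s₁
        rw [he] at hex₂
        have hf₂ : Frame (.for x y p) s (s₁.setReg x (i + 1)) := by
          refine hf.trans ((frame_of_exec (.seq hex₁ hex₂)).mono ?_ ?_) <;>
            simp [Cmd.for, Cmd.wreg, Cmd.warr]
        have hb₂ : Bdd E.B (s₁.setReg x (i + 1)) := hb₁.setReg (by omega)
        obtain ⟨s₃, t₃, hex₃, ht₃, hb₃, hI₃⟩ := ih (i + 1) _ (by omega) hb₂ hf₂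
          (by simp [State.setReg]) hI₁
        refine ⟨s₃, _, .loop_true (by simp [Expr.eval, hxi, hyn, hin]) (.seq hex₁ hex₂) hex₃, ?_,
          hb₃, hI₃⟩
        have h1 := hU hnB
        have h2 := hU hone
        have h3 := hU (hin.trans hnB)
        have h4 : words E.w (i + 1) ≤ E.U := hU (by omega)
        simp only [Expr.cost, Expr.eval, hxi, hyn, hin, if_true, hxi₁]
        nlinarith
  have hb0 : Bdd E.B (s.setReg x 0) := hs.setReg (by omega)
  have hex0 := Exec.assign (w := E.w) (iMul := E.iMul) x (.const 0) s
  have hf0 : Frame (.for x y p) s (s.setReg x 0) := by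
    refine (frame_of_exec hex0).mono ?_ ?_ <;>
      simp [Cmd.for, Cmd.wreg, Cmd.warr]
  obtain ⟨s', t, hex, ht, hb, hI⟩ := key n 0 (s.setReg x 0) (by omega) hb0 hf0
    (by simp [State.setReg]) h0
  have hexx := Exec.seq hex0 hex
  refine ⟨s', _, hexx, ?_, hb, hQ s' hb (frame_of_exec hexx) hI⟩
  have h2 : words E.w 0 ≤ E.U := hU (by omega)
  have h3 : (n + 1) * (T + 21) * E.U = (n + 1) * (T + 19) * E.U + 2 * E.U + 2 * n * E.U := by ring
  simp only [Expr.cost, Expr.eval]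
  omega

end Env

/-! ### Reading updated states -/

section Updates

variable (s : State) (x y v A C i j : ℕ)

@[simp] theorem State.setReg_mem : (s.setReg x v).mem = s.mem := rfl
@[simp] theorem State.setMem_reg : (s.setMem A i v).reg = s.reg := rfl

theorem State.setReg_reg : (s.setReg x v).reg y = if y = x then v else s.reg y := by
  simp [State.setReg, Function.update_apply]

theorem State.setMem_mem : (s.setMem A i v).mem C j = if C = A ∧ j = i then v else s.mem C j := by
  by_cases h : C = A
  · subst h; simp [State.setMem, Function.update_apply]
  · simp [State.setMem, h]

@[simp] theorem State.setReg_reg_self : (s.setReg x v).reg x = v := by simp [State.setReg]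

theorem State.setMem_mem_ne (h : C ≠ A) : (s.setMem A i v).mem C = s.mem C := by
  simp [State.setMem, h]

end Updates

end RAM

/-! ### Zeta transforms -/

theorem Polynomial.nat_add_right_cancel {p q r : Polynomial ℕ} (h : p + r = q + r) : p = q := by
  ext d
  have := congrArg (fun x => x.coeff d) h
  simpa only [Polynomial.coeff_add, Nat.add_right_cancel_iff] using this

section Zeta

open Polynomial

variable {V : Type*} [DecidableEq V]

/-- The zeta transforms of functions with values in `ℕ[X]`. -/
def IsZeta (Φ : Finset V → ℕ[X]) : Prop :=
  ∃ φ : Finset V → ℕ[X], ∀ Y, Φ Y = ∑ A ∈ Y.powerset, φ A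

theorem isZeta_one : IsZeta (fun _ : Finset V => (1 : ℕ[X])) :=
  ⟨fun A => if A = ∅ then 1 else 0, fun Y => by simp⟩

/-- The product is the transform of the union product: both members of a pair lie in `Y` exactly
when their union does, so the pairs can be grouped by their union. -/
theorem IsZeta.mul [Fintype V] {Φ Ψ : Finset V → ℕ[X]} (hΦ : IsZeta Φ) (hΨ : IsZeta Ψ) :
    IsZeta fun Y => Φ Y * Ψ Y := by
  obtain ⟨φ, hφ⟩ := hΦ
  obtain ⟨ψ, hψ⟩ := hΨ
  refine ⟨fun C => ∑ p : Finset V × Finset V with p.1 ∪ p.2 = C, φ p.1 * ψ p.2, fun Y => ?_⟩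
  simp only [hφ, hψ, Finset.sum_mul_sum]
  rw [← Finset.sum_product',
    ← Finset.sum_fiberwise_of_maps_to (g := fun p => p.1 ∪ p.2) (t := Y.powerset)]
  · refine Finset.sum_congr rfl fun C hC => Finset.sum_congr ?_ fun _ _ => rfl
    rw [Finset.mem_powerset] at hC
    ext p
    simp only [Finset.mem_filter, Finset.mem_product, Finset.mem_powerset, Finset.mem_univ,
      true_and, and_iff_right_iff_imp]
    rintro rfl
    exact Finset.union_subset_iff.1 hC
  · intro p hp
    simp only [Finset.mem_product, Finset.mem_powerset] at hp
    exact Finset.mem_powerset.2 (Finset.union_subset hp.1 hp.2)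

/-- The factor of a single clique: it may be left out, or taken and marked by `X`, the latter only
if it lies inside `Y`. -/
theorem isZeta_one_add_X (K : Finset V) :
    IsZeta fun Y => if K ⊆ Y then (1 + X : ℕ[X]) else 1 := by
  refine ⟨fun A => (if A = ∅ then 1 else 0) + if A = K then X else 0, fun Y => ?_⟩
  rw [Finset.sum_add_distrib]
  by_cases h : K ⊆ Y <;> simp [h]

theorem isZeta_prod [Fintype V] {ι : Type*} (s : Finset ι) (Φ : ι → Finset V → ℕ[X])
    (h : ∀ i ∈ s, IsZeta (Φ i)) : IsZeta fun Y => ∏ i ∈ s, Φ i Y := by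
  classical
  induction s using Finset.induction_on with
  | empty => simpa using isZeta_one
  | insert a s ha ih =>
      simp only [Finset.prod_insert ha]
      exact (h a (by simp)).mul (ih fun i hi => h i (by simp [hi]))

theorem isZeta_one_add_X_pow [Fintype V] (𝒦 : Finset (Finset V)) :
    IsZeta fun Y => (1 + X : ℕ[X]) ^ (𝒦.filter (· ⊆ Y)).card := by
  have := isZeta_prod 𝒦 _ fun K _ => isZeta_one_add_X K
  refine (congrArg IsZeta (funext fun Y => ?_)).mp this
  rw [← Finset.prod_filter, Finset.prod_const]

/-- This keeps the subtraction of inclusion–exclusion inside `ℕ[X]`: the difference of the values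
with and without `v` is the sum of `φ` over sets containing `v`. As a function of `Y` it is again a
zeta transform, now of a function supported on sets that avoid `v`. -/
theorem IsZeta.exists_diff {Φ : Finset V → ℕ[X]} (hΦ : IsZeta Φ) (v : V) :
    ∃ F, IsZeta F ∧ ∀ Y, Φ (insert v Y) = F Y + Φ (Y.erase v) := by
  obtain ⟨φ, hφ⟩ := hΦ
  refine ⟨fun Y => ∑ A ∈ (Y.erase v).powerset, φ (insert v A),
    ⟨fun A => if v ∈ A then 0 else φ (insert v A), fun Y => ?_⟩, fun Y => ?_⟩
  · rw [Finset.sum_ite, Finset.sum_const_zero, zero_add]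
    refine Finset.sum_congr ?_ fun _ _ => rfl
    ext A
    simp only [Finset.mem_powerset, Finset.mem_filter, Finset.subset_erase]
  · have h : insert v Y = insert v (Y.erase v) := by
      ext u
      by_cases hu : u = v <;> simp [hu]
    rw [h, hφ, hφ, Finset.sum_powerset_insert (Finset.notMem_erase v Y), add_comm]

end Zeta

/-! ### Vertex elimination -/

section Elimination

open Polynomial

/-- An ordering of the vertices in which the earlier neighbours of each vertex `v` are contained in
a set `nbr v` that is covered by an element `par v` of it and the set of `par v`. -/
structure Elimination {V : Type*} [DecidableEq V] (G : SimpleGraph V) where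
  rank : V → ℕ
  nbr : V → Finset V
  par : V → Option V
  rank_injective : Function.Injective rank
  rank_lt : ∀ {u v}, u ∈ nbr v → rank u < rank v
  mem_nbr : ∀ {u v}, G.Adj u v → rank u < rank v → u ∈ nbr v
  par_none : ∀ {v}, par v = none → nbr v = ∅
  par_mem : ∀ {v p}, par v = some p → p ∈ nbr v
  nbr_subset : ∀ {v p}, par v = some p → nbr v ⊆ insert p (nbr p)

namespace Elimination

variable {V : Type*} [DecidableEq V] {G : SimpleGraph V} (D : Elimination G)
  (𝒦 : Finset (Finset V))

def bag (v : V) : Finset V := insert v (D.nbr v)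

def obag : Option V → Finset V
  | none => ∅
  | some v => D.bag v

/-- The index `none` is a root that is never eliminated; it collects the factors of the vertices
without a parent. -/
def Active (r : ℕ) : Option V → Prop
  | none => True
  | some v => D.rank v < r

instance (r : ℕ) : DecidablePred (D.Active r) := fun p => by
  cases p <;> unfold Active <;> infer_instance

/-- The members of `𝒦` whose last vertex is `v`. -/
def topped (v : V) : Finset (Finset V) := 𝒦.filter fun K => v ∈ K ∧ K ⊆ D.bag v

/-- The generating function of the subfamilies of `𝒦` that cover all vertices of rank at least `r`
and whose sets contain no vertices of smaller rank outside `Y`. -/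
noncomputable def gen (r : ℕ) (Y : Finset V) : ℕ[X] := by
  classical exact
  ∑ 𝒞 ∈ 𝒦.powerset with (∀ K ∈ 𝒞, ∀ u ∈ K, u ∈ Y ∨ r ≤ D.rank u) ∧
    ∀ u, r ≤ D.rank u → ∃ K ∈ 𝒞, u ∈ K, X ^ 𝒞.card

/-- The tables of polynomials after the elimination of all vertices of rank at least `r`. -/
structure Table [Fintype V] (r : ℕ) (T : Option V → Finset V → ℕ[X]) : Prop where
  zeta : ∀ p, D.Active r p → IsZeta (T p)
  congr : ∀ p, D.Active r p → ∀ Y Y', Y ∩ D.obag p = Y' ∩ D.obag p → T p Y = T p Y'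
  bound : ∃ E : Option V → ℕ,
    (∀ p, D.Active r p → ∀ Y d, (T p Y).coeff d ≤ (E p).choose d) ∧
      ∑ p with D.Active r p, E p ≤ 𝒦.card
  prod : ∀ Y, (∀ u ∈ Y, D.rank u < r) → ∏ p with D.Active r p, T p Y = D.gen 𝒦 r Y

/-- The tables before any vertex is eliminated. -/
noncomputable def initTable : Option V → Finset V → ℕ[X]
  | none, _ => 1
  | some v, Y => (1 + X) ^ ((D.topped 𝒦 v).filter (· ⊆ Y)).card

variable {𝒦}

/-- Take the vertex of largest rank in `K`: the others are adjacent to it and earlier, hence in its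
`nbr`. The empty clique has no such vertex. -/
theorem exists_topped (h𝒦 : ∀ K ∈ 𝒦, G.IsClique (K : Set V) ∧ K.Nonempty) {K : Finset V}
    (hK : K ∈ 𝒦) : ∃ v, K ∈ D.topped 𝒦 v := by
  obtain ⟨v, hv, hmax⟩ := K.exists_max_image D.rank (h𝒦 K hK).2
  refine ⟨v, Finset.mem_filter.2 ⟨hK, hv, fun u hu => ?_⟩⟩
  by_cases huv : u = v
  · simp [bag, huv]
  · refine Finset.mem_insert_of_mem (D.mem_nbr ((h𝒦 K hK).1 hu hv huv) ?_)
    exact lt_of_le_of_ne (hmax u hu) fun h => huv (D.rank_injective h)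

/-- Of two distinct last vertices, each would lie in `nbr` of the other and so have smaller rank
than the other. -/
theorem topped_unique {K : Finset V} {u v : V} (hu : K ∈ D.topped 𝒦 u) (hv : K ∈ D.topped 𝒦 v) :
    u = v := by
  obtain ⟨-, hu, hKu⟩ := Finset.mem_filter.1 hu
  obtain ⟨-, hv, hKv⟩ := Finset.mem_filter.1 hv
  by_contra huv
  have h1 := D.rank_lt ((Finset.mem_insert.1 (hKu hv)).resolve_left (Ne.symm huv))
  have h2 := D.rank_lt ((Finset.mem_insert.1 (hKv hu)).resolve_left huv)
  omega

theorem sum_card_topped [Fintype V] (h𝒦 : ∀ K ∈ 𝒦, G.IsClique (K : Set V) ∧ K.Nonempty)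
    (P : Finset V → Prop) [DecidablePred P] :
    ∑ v, ((D.topped 𝒦 v).filter P).card = (𝒦.filter P).card := by
  rw [← Finset.card_biUnion]
  · congr 1
    ext K
    simp only [Finset.mem_biUnion, Finset.mem_univ, true_and, Finset.mem_filter]
    constructor
    · rintro ⟨v, hK, hP⟩
      exact ⟨(Finset.mem_filter.1 hK).1, hP⟩
    · rintro ⟨hK, hP⟩
      obtain ⟨v, hv⟩ := D.exists_topped h𝒦 hK
      exact ⟨v, hv, hP⟩
  · intro u _ v _ huv
    rw [Function.onFun, Finset.disjoint_left]
    intro K hu hv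
    exact huv (D.topped_unique (Finset.mem_filter.1 hu).1 (Finset.mem_filter.1 hv).1)

/-- Removing `v` is injective on sets containing `v` and leaves subsets of `nbr v`. -/
theorem card_topped_le (v : V) : (D.topped 𝒦 v).card ≤ 2 ^ (D.nbr v).card := by
  rw [← Finset.card_powerset]
  refine Finset.card_le_card_of_injOn (fun K => K.erase v) ?_ ?_
  · intro K hK
    obtain ⟨-, -, hK⟩ := Finset.mem_filter.1 hK
    simp only [Finset.coe_powerset, Set.mem_preimage, Set.mem_powerset_iff, Finset.coe_subset]
    intro u hu
    obtain ⟨h1, h2⟩ := Finset.mem_erase.1 hu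
    exact (Finset.mem_insert.1 (hK h2)).resolve_left h1
  · intro K hK K' hK' h
    simp only [topped, Finset.coe_filter, Set.mem_ofPred_eq] at hK hK'
    rw [← Finset.insert_erase hK.2.1, ← Finset.insert_erase hK'.2.1]
    exact congrArg (insert v) h

theorem card_le [Fintype V] (h𝒦 : ∀ K ∈ 𝒦, G.IsClique (K : Set V) ∧ K.Nonempty) {k : ℕ}
    (hk : ∀ v, (D.nbr v).card ≤ k) : 𝒦.card ≤ Fintype.card V * 2 ^ k := by
  have h := D.sum_card_topped h𝒦 fun _ => True
  simp only [Finset.filter_true] at h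
  rw [← h, ← smul_eq_mul, ← Finset.card_univ, ← Finset.sum_const]
  exact Finset.sum_le_sum fun v _ => (D.card_topped_le v).trans
    (Nat.pow_le_pow_right two_pos (hk v))

/-- No vertex has rank at least `n`, so nothing has to be covered, and the generating function of
all families of cliques inside `Y` is a power of `1 + X` by the binomial theorem. It splits into one
factor per last vertex. -/
theorem table_init [Fintype V] (h𝒦 : ∀ K ∈ 𝒦, G.IsClique (K : Set V) ∧ K.Nonempty) {n : ℕ}
    (hn : ∀ v, D.rank v < n) : D.Table 𝒦 n (D.initTable 𝒦) where
  zeta p _ := by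
    cases p with
    | none => exact isZeta_one
    | some v => exact isZeta_one_add_X_pow _
  congr p _ Y Y' h := by
    cases p with
    | none => rfl
    | some v =>
        simp only [initTable]
        congr 2
        refine Finset.filter_congr fun K hK => ?_
        have hK := (Finset.mem_filter.1 hK).2.2
        have key : ∀ Z : Finset V, K ⊆ Z ↔ K ⊆ Z ∩ D.bag v := fun Z =>
          ⟨fun h => Finset.subset_inter h hK, fun h => h.trans Finset.inter_subset_left⟩
        rw [key Y, key Y']
        exact (congrArg (K ⊆ ·) h).to_iff
  bound := by
    refine ⟨fun p => p.elim 0 fun v => (D.topped 𝒦 v).card, fun p _ Y d => ?_, ?_⟩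
    · cases p with
      | none =>
          simp only [initTable, Option.elim, coeff_one]
          split_ifs with h <;> simp [h]
      | some v =>
          simp only [initTable, Option.elim, coeff_one_add_X_pow, Nat.cast_id]
          exact Nat.choose_le_choose d (Finset.card_filter_le _ _)
    · have h := D.sum_card_topped h𝒦 fun _ => True
      simp only [Finset.filter_true] at h
      rw [← h]
      refine (Finset.sum_le_univ_sum_of_nonneg fun p => Nat.zero_le _).trans ?_
      rw [Fintype.sum_option]
      simp
  prod Y _ := by
    have h1 : (Finset.univ.filter (D.Active n)) = (Finset.univ : Finset (Option V)) := by
      ext p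
      cases p <;> simp [Active, hn]
    rw [h1, Fintype.prod_option]
    simp only [initTable, one_mul]
    rw [Finset.prod_pow_eq_pow_sum, D.sum_card_topped h𝒦 (· ⊆ Y), gen, add_comm,
      ← Finset.sum_pow_mul_eq_add_pow]
    simp only [one_pow, mul_one]
    refine Finset.sum_congr ?_ fun _ _ => rfl
    ext 𝒞
    simp only [Finset.mem_powerset, Finset.mem_filter, (hn _).not_ge, or_false, false_imp_iff,
      implies_true, and_true]
    constructor
    · exact fun h => ⟨fun K hK => (Finset.mem_filter.1 (h hK)).1,
        fun K hK => (Finset.mem_filter.1 (h hK)).2⟩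
    · exact fun h K hK => Finset.mem_filter.2 ⟨h.1 hK, fun u hu => h.2 K hK u hu⟩

/-- The families on the left may use `v`. Those that cover `v` are the ones counted by `gen r Y`,
and those that avoid `v` are the ones counted by `gen (r + 1) Y`. -/
theorem gen_succ {r : ℕ} {v : V} (hv : D.rank v = r) {Y : Finset V} (hY : ∀ u ∈ Y, D.rank u < r) :
    D.gen 𝒦 (r + 1) (insert v Y) = D.gen 𝒦 r Y + D.gen 𝒦 (r + 1) Y := by
  classical
  have hr : ∀ u, r ≤ D.rank u ↔ u = v ∨ r + 1 ≤ D.rank u := by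
    intro u
    constructor
    · intro h
      rcases h.eq_or_lt with h | h
      · exact .inl (D.rank_injective (h.symm.trans hv.symm))
      · exact .inr h
    · rintro (rfl | h)
      · exact hv.ge
      · omega
  unfold gen
  rw [← Finset.sum_filter_add_sum_filter_not _ fun 𝒞 : Finset (Finset V) => ∃ K ∈ 𝒞, v ∈ K]
  congr 1
  · rw [Finset.filter_filter]
    refine Finset.sum_congr (Finset.filter_congr fun 𝒞 _ => ?_) fun _ _ => rfl
    simp only [hr, Finset.mem_insert]
    constructor
    · rintro ⟨⟨h1, h2⟩, h3⟩
      refine ⟨fun K hK u hu => ?_, ?_⟩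
      · have := h1 K hK u hu
        tauto
      · rintro u (rfl | hu)
        exacts [h3, h2 u hu]
    · rintro ⟨h1, h2⟩
      refine ⟨⟨fun K hK u hu => ?_, fun u hu => h2 u (.inr hu)⟩, h2 v (.inl rfl)⟩
      have := h1 K hK u hu
      tauto
  · rw [Finset.filter_filter]
    refine Finset.sum_congr (Finset.filter_congr fun 𝒞 _ => ?_) fun _ _ => rfl
    simp only [Finset.mem_insert]
    have hvr : ¬ r + 1 ≤ D.rank v := by omega
    have hvY : v ∉ Y := fun h => by have := hY v h; omega
    constructor
    · rintro ⟨⟨h1, h2⟩, h3⟩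
      refine ⟨fun K hK u hu => ?_, h2⟩
      rcases h1 K hK u hu with (rfl | h) | h
      · exact absurd ⟨K, hK, hu⟩ h3
      · exact .inl h
      · exact .inr h
    · rintro ⟨h1, h2⟩
      refine ⟨⟨fun K hK u hu => (h1 K hK u hu).imp .inr id, h2⟩, ?_⟩
      rintro ⟨K, hK, hu⟩
      exact (h1 K hK v hu).elim hvY hvr

/-- Vandermonde's identity: under coefficientwise domination by powers of `1 + X`, multiplication
adds the exponents. -/
theorem coeff_mul_le_choose {p q : ℕ[X]} {a b : ℕ} (hp : ∀ d, p.coeff d ≤ a.choose d)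
    (hq : ∀ d, q.coeff d ≤ b.choose d) (d : ℕ) : (p * q).coeff d ≤ (a + b).choose d := by
  rw [coeff_mul, Nat.add_choose_eq]
  exact Finset.sum_le_sum fun x _ => Nat.mul_le_mul (hp _) (hq _)

theorem active_par {v p : V} (h : D.par v = some p) {r : ℕ} (hv : D.rank v = r) :
    D.Active r (some p) := hv ▸ D.rank_lt (D.par_mem h)

/-- The elimination of the vertex of rank `r`. -/
theorem Table.step [Fintype V] {r : ℕ} {T : Option V → Finset V → ℕ[X]} (hT : D.Table 𝒦 (r + 1) T) {v : V}
    (hv : D.rank v = r) :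
    ∃ F : Finset V → ℕ[X], (∀ Y, T (some v) (insert v Y) = F Y + T (some v) (Y.erase v)) ∧
      (∀ Y Y', Y ∩ D.nbr v = Y' ∩ D.nbr v → F Y = F Y') ∧
      D.Table 𝒦 r (Function.update T (D.par v) fun Y => T (D.par v) Y * F Y) := by
  have hvact : D.Active (r + 1) (some v) := by simp [Active, hv]
  have hact : ∀ {p}, D.Active r p → D.Active (r + 1) p := by
    intro p hp
    cases p with
    | none => trivial
    | some u => exact Nat.lt_succ_of_lt hp
  have hpar : D.Active r (D.par v) := by
    cases h : D.par v with
    | none => trivial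
    | some p => exact D.active_par h hv
  have hins : (Finset.univ.filter (D.Active (r + 1))) =
      insert (some v) (Finset.univ.filter (D.Active r)) := by
    ext p
    simp only [Finset.mem_filter, Finset.mem_univ, true_and, Finset.mem_insert]
    cases p with
    | none => simp [Active]
    | some u =>
        simp only [Active, Option.some.injEq, Nat.lt_succ_iff]
        rw [le_iff_eq_or_lt, ← hv, D.rank_injective.eq_iff]
  have hnotin : some v ∉ Finset.univ.filter (D.Active r) := by simp [Active, hv]
  obtain ⟨F, hFz, hF⟩ := (hT.zeta _ hvact).exists_diff v
  -- Both terms of the difference depend only on the part of `Y` in the bag of `v`, and there the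
  -- membership of `v` itself has been fixed. Cancellation gives the claim for `F`.
  have hFloc : ∀ Y Y', Y ∩ D.nbr v = Y' ∩ D.nbr v → F Y = F Y' := by
    intro Y Y' h
    have hmem : ∀ u ∈ D.nbr v, u ∈ Y ↔ u ∈ Y' := fun u hu => by
      have := congrArg (u ∈ ·) h
      simpa [hu] using this
    have h1 : T (some v) (insert v Y) = T (some v) (insert v Y') := by
      refine hT.congr _ hvact _ _ ?_
      ext u
      simp only [obag, bag, Finset.mem_inter, Finset.mem_insert]
      have := hmem u
      tauto
    have h2 : T (some v) (Y.erase v) = T (some v) (Y'.erase v) := by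
      refine hT.congr _ hvact _ _ ?_
      ext u
      simp only [obag, bag, Finset.mem_inter, Finset.mem_insert, Finset.mem_erase]
      have := hmem u
      tauto
    rw [hF, hF, h2] at h1
    exact nat_add_right_cancel h1
  refine ⟨F, hF, hFloc, ?_, ?_, ?_, ?_⟩
  · intro p hp
    by_cases h : p = D.par v
    · subst h
      rw [Function.update_self]
      exact (hT.zeta _ (hact hp)).mul hFz
    · rw [Function.update_of_ne h]
      exact hT.zeta _ (hact hp)
  · intro p hp Y Y' hYY
    by_cases h : p = D.par v
    · subst h
      rw [Function.update_self]
      rw [hT.congr _ (hact hp) Y Y' hYY, hFloc Y Y' ?_]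
      -- The new factor depends only on `nbr v`, which the bag of the parent contains, so the
      -- product is still a function of the trace on that bag.
      have hsub : D.nbr v ⊆ D.obag (D.par v) := by
        cases h : D.par v with
        | none => rw [D.par_none h]; exact Finset.empty_subset _
        | some p => exact D.nbr_subset h
      have h3 := congrArg (· ∩ D.nbr v) hYY
      simpa only [Finset.inter_assoc, Finset.inter_eq_right.2 hsub] using h3
    · rw [Function.update_of_ne h]
      exact hT.congr _ (hact hp) Y Y' hYY
  · obtain ⟨E, hE, hsum⟩ := hT.bound
    -- The exponent of `v` is handed to its parent, so the total does not grow; `F` is dominated by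
    -- `T (some v) (insert v Y)`, of which it is a summand.
    refine ⟨Function.update E (D.par v) (E (D.par v) + E (some v)), ?_, ?_⟩
    · intro p hp Y d
      by_cases h : p = D.par v
      · subst h
        rw [Function.update_self, Function.update_self]
        refine coeff_mul_le_choose (hE _ (hact hp) Y) (fun d => ?_) d
        refine le_trans ?_ (hE _ hvact (insert v Y) d)
        rw [hF, coeff_add]
        exact Nat.le_add_right _ _
      · rw [Function.update_of_ne h, Function.update_of_ne h]
        exact hE _ (hact hp) Y d
    · rw [hins, Finset.sum_insert hnotin] at hsum
      have hpmem : D.par v ∈ Finset.univ.filter (D.Active r) := by simp [hpar]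
      rw [← Finset.add_sum_erase _ _ hpmem] at hsum ⊢
      rw [Function.update_self]
      have : ∑ p ∈ (Finset.univ.filter (D.Active r)).erase (D.par v),
          Function.update E (D.par v) (E (D.par v) + E (some v)) p =
          ∑ p ∈ (Finset.univ.filter (D.Active r)).erase (D.par v), E p :=
        Finset.sum_congr rfl fun p hp => Function.update_of_ne (Finset.ne_of_mem_erase hp) _ _
      omega
  · intro Y hY
    have hvY : v ∉ Y := fun h => by have := hY v h; omega
    have hpmem : D.par v ∈ Finset.univ.filter (D.Active r) := by simp [hpar]
    have h1 := hT.prod (insert v Y) fun u hu => by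
      rcases Finset.mem_insert.1 hu with rfl | hu
      · omega
      · exact Nat.lt_succ_of_lt (hY u hu)
    have h2 := hT.prod Y fun u hu => Nat.lt_succ_of_lt (hY u hu)
    -- The other active bags consist of vertices of rank below `r`, so none of them contains `v`.
    have h3 : ∏ p with D.Active r p, T p (insert v Y) = ∏ p with D.Active r p, T p Y := by
      refine Finset.prod_congr rfl fun p hp => ?_
      have hp := (Finset.mem_filter.1 hp).2
      refine hT.congr _ (hact hp) _ _ (Finset.insert_inter_of_notMem ?_)
      cases p with
      | none => exact Finset.notMem_empty _
      | some u =>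
          intro hu
          have hur : D.rank u < r := hp
          rcases Finset.mem_insert.1 hu with rfl | hu
          · omega
          · have := D.rank_lt hu
            omega
    -- The product formulas at `insert v Y` and at `Y` share the term `T (some v) Y` times the other
    -- factors. Cancelling it leaves `F Y` times the other factors, which is `gen r Y`.
    rw [hins, Finset.prod_insert hnotin, D.gen_succ hv hY, h3, hF, Finset.erase_eq_of_notMem hvY,
      add_mul] at h1
    rw [hins, Finset.prod_insert hnotin] at h2
    rw [h2] at h1
    rw [← nat_add_right_cancel h1, ← Finset.mul_prod_erase _ _ hpmem, ← Finset.mul_prod_erase _ _ hpmem,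
      Function.update_self]
    have : ∏ p ∈ (Finset.univ.filter (D.Active r)).erase (D.par v),
        Function.update T (D.par v) (fun Y => T (D.par v) Y * F Y) p Y =
        ∏ p ∈ (Finset.univ.filter (D.Active r)).erase (D.par v), T p Y :=
      Finset.prod_congr rfl fun p hp => by
        rw [Function.update_of_ne (Finset.ne_of_mem_erase hp)]
    rw [this]
    ring

theorem Table.coeff_le [Fintype V] {r : ℕ} {T : Option V → Finset V → ℕ[X]} (hT : D.Table 𝒦 r T)
    {p : Option V} (hp : D.Active r p) (Y : Finset V) (d : ℕ) :
    (T p Y).coeff d ≤ 𝒦.card.choose d := by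
  obtain ⟨E, hE, hsum⟩ := hT.bound
  refine (hE p hp Y d).trans (Nat.choose_le_choose d (le_trans ?_ hsum))
  exact Finset.single_le_sum (f := E) (fun _ _ => Nat.zero_le _) (by simp [hp])

-- At `r = 0` only the root is active, every vertex has to be covered, and the restriction to `Y` is
-- void; so the remaining polynomial counts the covers by cardinality.
open Classical in
theorem Table.coeff_root [Fintype V] {T : Option V → Finset V → ℕ[X]} (hT : D.Table 𝒦 0 T) (d : ℕ) :
    (T none ∅).coeff d =
      (𝒦.powerset.filter fun 𝒞 => (∀ u, ∃ K ∈ 𝒞, u ∈ K) ∧ 𝒞.card = d).card := by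
  have h := hT.prod ∅ (by simp)
  have h1 : Finset.univ.filter (D.Active 0) = {none} := by
    ext p
    cases p <;> simp [Active]
  rw [h1, Finset.prod_singleton] at h
  rw [h, gen, finsetSum_coeff]
  simp only [coeff_X_pow, Finset.sum_boole, Nat.cast_id, Finset.filter_filter, Nat.zero_le,
    or_true, implies_true, true_and, true_imp_iff]
  congr 1
  refine Finset.filter_congr fun 𝒞 _ => ?_
  rw [eq_comm (a := d)]

end Elimination

end Elimination

/-! ### Simulation of stack machines -/

namespace RAM

open Turing Turing.TM2

/-- Repeated addition and halving replace multiplication by powers of two, so the simulation never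
pays for a multiplication. -/
def Expr.dbl : ℕ → Expr → Expr
  | 0, e => e
  | b + 1, e => .add (Expr.dbl b e) (Expr.dbl b e)

def Expr.halve : ℕ → Expr → Expr
  | 0, e => e
  | b + 1, e => .half (Expr.halve b e)

@[simp] theorem Expr.eval_dbl (s : State) (e : Expr) (b : ℕ) :
    (Expr.dbl b e).eval s = 2 ^ b * e.eval s := by
  induction b with
  | zero => simp [dbl]
  | succ b ih => simp only [dbl, eval, ih]; ring

@[simp] theorem Expr.eval_halve (s : State) (e : Expr) (b : ℕ) :
    (Expr.halve b e).eval s = e.eval s / 2 ^ b := by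
  induction b with
  | zero => simp [halve]
  | succ b ih => simp only [halve, eval, ih, pow_succ, Nat.div_div_eq_div_mul]

theorem Expr.within_dbl {w : ℕ} {iMul : ℕ → ℕ → ℕ} {B U : ℕ} {s : State} {e : Expr}
    (h : e.Within w iMul B U s) (b : ℕ) : (Expr.dbl b e).Within w iMul B U s := by
  induction b with
  | zero => exact h
  | succ b ih => exact ⟨ih, ih⟩

theorem Expr.within_halve {w : ℕ} {iMul : ℕ → ℕ → ℕ} {B U : ℕ} {s : State} {e : Expr}
    (h : e.Within w iMul B U s) (b : ℕ) : (Expr.halve b e).Within w iMul B U s := by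
  induction b with
  | zero => exact h
  | succ b ih => exact ih

namespace StackSim

/-- The multiple `2 ^ b` of the content of register `x`, plus `c`. -/
def pushExpr (b x c : ℕ) : Expr := .add (.dbl b (.reg x)) (.const c)

/-- Whether the last `b` bits of register `x` are those of `c`. -/
def topExpr (b x c : ℕ) : Expr :=
  .eq (.reg x) (.add (.dbl b (.halve b (.reg x))) (.const c))

/-- Halving and then doubling `b` times clears the last `b` bits, which hold the top symbol `g`;
adding `c` restores the number exactly when `c = g`. -/
theorem eval_topExpr {b x c g r : ℕ} {s : State} (hs : s.reg x = g + 2 ^ b * r) (hg : g < 2 ^ b) :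
    (topExpr b x c).eval s = if g = c then 1 else 0 := by
  have h1 : (g + 2 ^ b * r) / 2 ^ b = r := by
    rw [Nat.add_mul_div_left _ _ (by positivity), Nat.div_eq_of_lt hg, zero_add]
  simp only [topExpr, Expr.eval, Expr.eval_dbl, Expr.eval_halve, hs, h1]
  congr 1
  rw [eq_iff_iff]
  omega

open Classical in
/-- The code of the symbol `g` with respect to a list of symbols. -/
noncomputable def enc {α : Type} (l : List α) (g : α) : ℕ := l.idxOf g + 1

theorem enc_lt {α : Type} {l : List α} {g : α} (h : g ∈ l) {b : ℕ} (hb : l.length < 2 ^ b) :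
    enc l g < 2 ^ b := by
  classical
  have : l.idxOf g < l.length := List.idxOf_lt_length_iff.2 h
  unfold enc
  convert (Nat.succ_le_of_lt this).trans_lt hb

theorem enc_inj {α : Type} {l : List α} {g g' : α} (h : g ∈ l) : enc l g = enc l g' ↔ g = g' := by
  classical
  unfold enc
  rw [Nat.add_right_cancel_iff]
  exact List.idxOf_inj h

/-- The number that represents a stack. -/
noncomputable def encStack (b : ℕ) {α : Type} (l : List α) : List α → ℕ
  | [] => 0
  | g :: S => enc l g + 2 ^ b * encStack b l S

theorem encStack_lt {b : ℕ} {α : Type} {l : List α} (hb : l.length < 2 ^ b) :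
    ∀ {S : List α}, (∀ g ∈ S, g ∈ l) → encStack b l S < 2 ^ (b * S.length)
  | [], _ => by simp [encStack]
  | g :: S, h => by
      have h1 := encStack_lt hb (S := S) fun g' hg' => h g' (by simp [hg'])
      have h2 := enc_lt (h g (by simp)) hb
      have h3 : 2 ^ b * (encStack b l S + 1) ≤ 2 ^ b * 2 ^ (b * S.length) :=
        Nat.mul_le_mul_left _ h1
      rw [encStack, List.length_cons, Nat.mul_add, Nat.mul_one, pow_add, mul_comm (2 ^ (b * _))]
      rw [Nat.mul_add] at h3
      omega

variable {K : Type} {Γ : K → Type} {Λ σ : Type}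
  (F : ∀ k, List (Γ k)) (b : ℕ) (rg : K → ℕ) (pc : Λ × σ → ℕ)

/-- Case distinction on the symbol on top of a stack, which is known to be in the list. -/
noncomputable def topChain {k : K} (p : Γ k → Cmd) : List (Γ k) → Cmd
  | [] => .skip
  | g :: l => .ite (topExpr b (rg k) (enc (F k) g)) (p g) (topChain p l)

/-- Case distinction on the top of a stack. -/
noncomputable def topCases {k : K} (p : Option (Γ k) → Cmd) : Cmd :=
  .ite (.reg (rg k)) (topChain F b rg (fun g => p (some g)) (F k)) (p none)

/-- The program that executes a statement of a stack machine in internal state `v`. -/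
noncomputable def compile : TM2.Stmt Γ Λ σ → σ → Cmd
  | .push k f q, v => .seq (.assign (rg k) (pushExpr b (rg k) (enc (F k) (f v)))) (compile q v)
  | .peek k f q, v => topCases F b rg fun o : Option (Γ k) => compile q (f v o)
  | .pop k f q, v => topCases F b rg fun o : Option (Γ k) =>
      .seq (.assign (rg k) (.halve b (.reg (rg k)))) (compile q (f v o))
  | .load a q, v => compile q (a v)
  | .branch f q₁ q₂, v => cond (f v) (compile q₁ v) (compile q₂ v)
  | .goto f, v => .assign 100 (.const (pc (f v, v)))
  | .halt, _ => .assign 100 (.const 0)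

/-- The statement pushes only symbols from the lists `F`. -/
def PushesIn : TM2.Stmt Γ Λ σ → Prop
  | .push k f q => (∀ v, f v ∈ F k) ∧ PushesIn q
  | .peek _ _ q | .pop _ _ q | .load _ q => PushesIn q
  | .branch _ q₁ q₂ => PushesIn q₁ ∧ PushesIn q₂
  | .goto _ | .halt => True

/-- A bound for the number of symbols pushed by a statement. -/
def pushes : TM2.Stmt Γ Λ σ → ℕ
  | .push _ _ q => pushes q + 1
  | .peek _ _ q | .pop _ _ q | .load _ q => pushes q
  | .branch _ q₁ q₂ => pushes q₁ + pushes q₂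
  | .goto _ | .halt => 0

/-- The stacks `S` contain only symbols from the lists `F` and are stored in the registers. -/
def Rep (S : ∀ k, List (Γ k)) (s : State) : Prop :=
  ∀ k, s.reg (rg k) = encStack b (F k) (S k) ∧ ∀ g ∈ S k, g ∈ F k

/-- The states agree outside of the registers of the simulation. -/
def Same (rg : K → ℕ) (s s' : State) : Prop :=
  s'.mem = s.mem ∧ ∀ x, x ≠ 100 → (∀ k, x ≠ rg k) → s'.reg x = s.reg x

/-- The content of the program counter. -/
def pcVal (pc : Λ × σ → ℕ) (c : TM2.Cfg Γ Λ σ) : ℕ :=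
  c.l.elim 0 fun l => pc (l, c.var)

theorem Same.refl (s : State) : Same rg s s := ⟨rfl, fun _ _ _ => rfl⟩

variable {F b rg pc}

theorem Same.trans {s₁ s₂ s₃ : State} (h : Same rg s₁ s₂) (h' : Same rg s₂ s₃) : Same rg s₁ s₃ :=
  ⟨h'.1.trans h.1, fun x hx hk => (h'.2 x hx hk).trans (h.2 x hx hk)⟩

theorem same_setReg_rg (s : State) (k : K) (v : ℕ) : Same rg s (s.setReg (rg k) v) :=
  ⟨rfl, fun x _ hk => by simp [State.setReg_reg, hk k]⟩

theorem same_setReg_pc (s : State) (v : ℕ) : Same rg s (s.setReg 100 v) :=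
  ⟨rfl, fun x hx _ => by simp [State.setReg_reg, hx]⟩

theorem Rep.setReg_rg [DecidableEq K] (hrg : Function.Injective rg) {S : ∀ k, List (Γ k)} {s : State}
    (h : Rep F b rg S s) (k : K) (l : List (Γ k)) (hl : ∀ g ∈ l, g ∈ F k) :
    Rep F b rg (Function.update S k l) (s.setReg (rg k) (encStack b (F k) l)) := by
  intro k'
  by_cases hk : k' = k
  · subst hk; simpa using hl
  · simpa [State.setReg_reg, hrg.eq_iff, hk] using h k'

theorem Rep.setReg_of_ne {S : ∀ k, List (Γ k)} {s : State} (h : Rep F b rg S s) {x v : ℕ}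
    (hx : ∀ k, x ≠ rg k) : Rep F b rg S (s.setReg x v) := by
  intro k
  simpa [State.setReg_reg, (hx k).symm] using h k

/-- The parameters of a bounded run without multiplications. -/
structure Params (w : ℕ) (iMul : ℕ → ℕ → ℕ) (B U : ℕ) : Prop where
  mono : Monotone (iMul w)
  one_le : 1 ≤ B
  words_le : B / w + 1 ≤ U

/-- The overhead `c` is chosen before the machine parameters, the branches and the state, so it is a
constant of the simulated machine. -/
theorem exec_topChain (hb : ∀ k, (F k).length < 2 ^ b) {k : K} (l : List (Γ k)) :
    ∃ c, ∀ (w : ℕ) (iMul : ℕ → ℕ → ℕ) (B U : ℕ), Params w iMul B U →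
      ∀ (p : Γ k → Cmd) (g : Γ k) (r : ℕ) (s s' : State) (t : ℕ), g ∈ l → g ∈ F k →
      s.reg (rg k) = enc (F k) g + 2 ^ b * r → s.reg (rg k) < 2 ^ B → Exec w iMul (p g) s s' t →
        ∃ t', Exec w iMul (topChain F b rg p l) s s' t' ∧ t' ≤ c * U + t := by
  induction l with
  | nil => exact ⟨0, by simp⟩
  | cons a l ih =>
      obtain ⟨c, hc⟩ := ih
      refine ⟨(topExpr b (rg k) (enc (F k) a)).tick + (topExpr b (rg k) (enc (F k) a)).growth + 1 + c,
        fun w iMul B U hP p g r s s' t hg hgF hs hlt hex => ?_⟩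
      have hw : (topExpr b (rg k) (enc (F k) a)).Within w iMul B U s :=
        ⟨hlt, Expr.within_dbl (Expr.within_halve (e := .reg (rg k)) hlt b) b, trivial⟩
      have h1 := Expr.cost_le hP.mono hP.one_le hP.words_le hw
      have h2 := Expr.words_eval_le hP.one_le hP.words_le hw
      have h3 := eval_topExpr (c := enc (F k) a) hs (enc_lt hgF (hb k))
      by_cases hga : g = a
      · subst hga
        refine ⟨_, .ite_true (by simp [h3]) hex, ?_⟩
        nlinarith
      · obtain ⟨t', hex', ht'⟩ := hc w iMul B U hP p g r s s' t
          ((List.mem_cons.1 hg).resolve_left hga) hgF hs hlt hex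
        refine ⟨_, .ite_false (by simp [h3, enc_inj hgF, hga]) hex', ?_⟩
        nlinarith

theorem exec_topCases (hb : ∀ k, (F k).length < 2 ^ b) (k : K) :
    ∃ c, ∀ (w : ℕ) (iMul : ℕ → ℕ → ℕ) (B U : ℕ), Params w iMul B U →
      ∀ (p : Option (Γ k) → Cmd) (l : List (Γ k)) (s s' : State) (t : ℕ),
      s.reg (rg k) = encStack b (F k) l → (∀ g ∈ l, g ∈ F k) → s.reg (rg k) < 2 ^ B →
      Exec w iMul (p l.head?) s s' t →
        ∃ t', Exec w iMul (topCases F b rg p) s s' t' ∧ t' ≤ c * U + t := by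
  obtain ⟨c, hc⟩ := exec_topChain (F := F) (rg := rg) hb (F k)
  refine ⟨c + 10, fun w iMul B U hP p l s s' t hs hl hlt hex => ?_⟩
  have hw : (Expr.reg (rg k)).Within w iMul B U s := hlt
  have h1 := Expr.cost_le hP.mono hP.one_le hP.words_le hw
  have h2 := Expr.words_eval_le hP.one_le hP.words_le hw
  simp only [Expr.tick, Expr.growth] at h1 h2
  cases l with
  | nil =>
      refine ⟨_, .ite_false (by simpa [Expr.eval, encStack] using hs) hex, ?_⟩
      nlinarith
  | cons g l =>
      obtain ⟨t', hex', ht'⟩ := hc w iMul B U hP (fun g => p (some g)) g (encStack b (F k) l) s s' t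
        (hl g (by simp)) (hl g (by simp)) hs hlt hex
      refine ⟨_, .ite_true ?_ hex', ?_⟩
      -- Codes of symbols start at `1`, so a nonempty stack is never stored as `0`.
      · have : s.reg (rg k) ≠ 0 := by rw [hs]; simp [encStack, enc]
        exact this
      · nlinarith

theorem encStack_tail {α : Type} {l : List α} (hb : l.length < 2 ^ b) :
    ∀ {S : List α}, (∀ g ∈ S, g ∈ l) → encStack b l S / 2 ^ b = encStack b l S.tail
  | [], _ => by simp [encStack]
  | g :: S, h => by
      rw [encStack, Nat.add_mul_div_left _ _ (by positivity),
        Nat.div_eq_of_lt (enc_lt (h g (by simp)) hb), zero_add, List.tail_cons]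

/-- The execution of a statement. -/
theorem exec_compile [DecidableEq K] [Finite σ] (hrg : Function.Injective rg)
    (hrg100 : ∀ k, 100 ≠ rg k) (hb : ∀ k, (F k).length < 2 ^ b) (q : TM2.Stmt Γ Λ σ) :
    PushesIn F q → ∃ c, ∀ (w : ℕ) (iMul : ℕ → ℕ → ℕ) (B U : ℕ), Params w iMul B U →
      ∀ (v : σ) (S : ∀ k, List (Γ k)) (s : State), Rep F b rg S s →
      (∀ k, b * ((S k).length + pushes q) ≤ B) →
      ∃ s' t, Exec w iMul (compile F b rg pc q v) s s' t ∧ t ≤ c * U ∧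
        Rep F b rg (TM2.stepAux q v S).stk s' ∧ s'.reg 100 = pcVal pc (TM2.stepAux q v S) ∧
        Same rg s s' ∧ ∀ k, ((TM2.stepAux q v S).stk k).length ≤ (S k).length + pushes q := by
  have hlt : ∀ {S : ∀ k, List (Γ k)} {s : State} {a B : ℕ}, Rep F b rg S s → ∀ k,
      b * ((S k).length + a) ≤ B → s.reg (rg k) < 2 ^ B := by
    intro S s a B hS k hL
    rw [(hS k).1]
    refine (encStack_lt (hb k) (hS k).2).trans_le (Nat.pow_le_pow_right two_pos (le_trans ?_ hL))
    exact Nat.mul_le_mul_left _ (Nat.le_add_right _ _)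
  induction q with
  | push k f q ih =>
      rintro ⟨hf, hq⟩
      obtain ⟨c, hc⟩ := ih hq
      -- The pushed constant depends on the internal state; finiteness of `σ` gives one bound for
      -- all of them.
      obtain ⟨d, hd⟩ := (Set.finite_range fun v => (pushExpr b (rg k) (enc (F k) (f v))).tick +
        (pushExpr b (rg k) (enc (F k) (f v))).growth + 1).bddAbove
      refine ⟨d + c, fun w iMul B U hP v S s hS hL => ?_⟩
      have hd' := hd ⟨v, rfl⟩
      simp only at hd'
      have hw : (pushExpr b (rg k) (enc (F k) (f v))).Within w iMul B U s :=
        ⟨Expr.within_dbl (e := .reg (rg k)) (hlt hS k (hL k)) b, trivial⟩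
      have h1 := Expr.cost_le hP.mono hP.one_le hP.words_le hw
      have h2 := Expr.words_eval_le hP.one_le hP.words_le hw
      have hev : (pushExpr b (rg k) (enc (F k) (f v))).eval s = encStack b (F k) (f v :: S k) := by
        simp [pushExpr, Expr.eval, (hS k).1, encStack, add_comm]
      have hS' := hS.setReg_rg hrg k (f v :: S k) (by
        simp only [List.mem_cons, forall_eq_or_imp]
        exact ⟨hf v, (hS k).2⟩)
      have hex := Exec.assign (w := w) (iMul := iMul) (rg k)
        (pushExpr b (rg k) (enc (F k) (f v))) s
      rw [hev] at hex h2
      have hlen : ∀ k', ((Function.update S k (f v :: S k)) k').length ≤ (S k').length + 1 := by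
        intro k'
        by_cases hk : k' = k
        · subst hk; simp
        · simp [hk]
      obtain ⟨s', t, hex', ht, hR, hpc, hsame, hl⟩ := hc w iMul B U hP v _ _ hS' fun k' => by
        refine (Nat.mul_le_mul_left b ?_).trans (hL k')
        have := hlen k'
        simp only [pushes]
        omega
      refine ⟨s', _, .seq hex hex', ?_, hR, hpc, (same_setReg_rg s k _).trans hsame, fun k' => ?_⟩
      · nlinarith [Nat.mul_le_mul_right U hd']
      · have := hl k'
        have := hlen k'
        simp only [pushes, TM2.stepAux] at *
        omega
  | peek k f q ih =>
      intro hq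
      obtain ⟨c, hc⟩ := ih hq
      obtain ⟨d, hd⟩ := exec_topCases (F := F) (rg := rg) hb k
      refine ⟨d + c, fun w iMul B U hP v S s hS hL => ?_⟩
      obtain ⟨s', t, hex', ht, hR⟩ := hc w iMul B U hP (f v (S k).head?) S s hS hL
      obtain ⟨t', hex, ht'⟩ := hd w iMul B U hP (fun o => compile F b rg pc q (f v o)) (S k) s s' t
        (hS k).1 (hS k).2 (hlt hS k (hL k)) hex'
      exact ⟨s', t', hex, by nlinarith, hR⟩
  | pop k f q ih =>
      intro hq
      obtain ⟨c, hc⟩ := ih hq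
      obtain ⟨d, hd⟩ := exec_topCases (F := F) (rg := rg) hb k
      refine ⟨d + (c + (Expr.halve b (.reg (rg k))).tick + (Expr.halve b (.reg (rg k))).growth + 1),
        fun w iMul B U hP v S s hS hL => ?_⟩
      have hw : (Expr.halve b (.reg (rg k))).Within w iMul B U s :=
        Expr.within_halve (e := .reg (rg k)) (hlt hS k (hL k)) b
      have h1 := Expr.cost_le hP.mono hP.one_le hP.words_le hw
      have h2 := Expr.words_eval_le hP.one_le hP.words_le hw
      have hev : (Expr.halve b (.reg (rg k))).eval s = encStack b (F k) (S k).tail := by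
        simp [Expr.eval, (hS k).1, encStack_tail (hb k) (hS k).2]
      have hS' := hS.setReg_rg hrg k (S k).tail fun g hg => (hS k).2 g (List.mem_of_mem_tail hg)
      have hex := Exec.assign (w := w) (iMul := iMul) (rg k) (Expr.halve b (.reg (rg k))) s
      rw [hev] at hex h2
      have hlen : ∀ k', ((Function.update S k (S k).tail) k').length ≤ (S k').length := by
        intro k'
        by_cases hk : k' = k
        · subst hk; simp
        · simp [hk]
      obtain ⟨s', t, hex', ht, hR, hpc, hsame, hl⟩ := hc w iMul B U hP (f v (S k).head?) _ _ hS'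
        fun k' => (Nat.mul_le_mul_left b (Nat.add_le_add_right (hlen k') _)).trans (hL k')
      obtain ⟨t', hex'', ht'⟩ := hd w iMul B U hP
        (fun o => .seq (.assign (rg k) (.halve b (.reg (rg k)))) (compile F b rg pc q (f v o)))
        (S k) s s' _ (hS k).1 (hS k).2 (hlt hS k (hL k)) (.seq hex hex')
      refine ⟨s', t', hex'', ?_, hR, hpc, (same_setReg_rg s k _).trans hsame, fun k' => ?_⟩
      · nlinarith
      · have := hl k'
        have := hlen k'
        simp only [pushes, TM2.stepAux] at *
        omega
  | load a q ih =>
      intro hq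
      obtain ⟨c, hc⟩ := ih hq
      exact ⟨c, fun w iMul B U hP v S s hS hL => hc w iMul B U hP (a v) S s hS hL⟩
  | branch f q₁ q₂ ih₁ ih₂ =>
      rintro ⟨hq₁, hq₂⟩
      obtain ⟨c₁, hc₁⟩ := ih₁ hq₁
      obtain ⟨c₂, hc₂⟩ := ih₂ hq₂
      refine ⟨c₁ + c₂, fun w iMul B U hP v S s hS hL => ?_⟩
      simp only [pushes] at hL
      cases hfv : f v with
      | true =>
          obtain ⟨s', t, hex, ht, hR, hpc, hsame, hl⟩ := hc₁ w iMul B U hP v S s hS fun k =>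
            (Nat.mul_le_mul_left b (by omega)).trans (hL k)
          simp only [compile, TM2.stepAux, hfv, cond_true, pushes]
          exact ⟨s', t, hex, by nlinarith, hR, hpc, hsame, fun k => by have := hl k; omega⟩
      | false =>
          obtain ⟨s', t, hex, ht, hR, hpc, hsame, hl⟩ := hc₂ w iMul B U hP v S s hS fun k =>
            (Nat.mul_le_mul_left b (by omega)).trans (hL k)
          simp only [compile, TM2.stepAux, hfv, cond_false, pushes]
          exact ⟨s', t, hex, by nlinarith, hR, hpc, hsame, fun k => by have := hl k; omega⟩
  | goto f =>
      intro _
      obtain ⟨d, hd⟩ := (Set.finite_range fun v => 2 * (pc (f v, v)) + 2).bddAbove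
      refine ⟨d, fun w iMul B U hP v S s hS hL => ⟨_, _, .assign _ _ _, ?_, hS.setReg_of_ne hrg100,
        by simp [pcVal, Expr.eval, TM2.stepAux], same_setReg_pc _ _, fun k => by simp [TM2.stepAux]⟩⟩
      have hd' := hd ⟨v, rfl⟩
      have hw : (Expr.const (pc (f v, v))).Within w iMul B U s := trivial
      have h1 := Expr.cost_le hP.mono hP.one_le hP.words_le hw
      have h2 := Expr.words_eval_le hP.one_le hP.words_le hw
      simp only [Expr.tick, Expr.growth] at h1 h2 hd'
      nlinarith [Nat.mul_le_mul_right U hd']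
  | halt =>
      intro _
      refine ⟨2, fun w iMul B U hP v S s hS hL => ⟨_, _, .assign _ _ _, ?_, hS.setReg_of_ne hrg100,
        by simp [pcVal, Expr.eval, TM2.stepAux], same_setReg_pc _ _, fun k => by simp [TM2.stepAux]⟩⟩
      have hw : (Expr.const 0).Within w iMul B U s := trivial
      have h1 := Expr.cost_le hP.mono hP.one_le hP.words_le hw
      have h2 := Expr.words_eval_le hP.one_le hP.words_le hw
      simp only [Expr.tick, Expr.growth] at h1 h2
      nlinarith

/-- Execution of the statement of the current label, where `l` lists labels and states. -/
noncomputable def dispatch (M : Λ → TM2.Stmt Γ Λ σ) (F : ∀ k, List (Γ k)) (b : ℕ) (rg : K → ℕ)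
    (pc : Λ × σ → ℕ) : List (Λ × σ) → Cmd
  | [] => .skip
  | x :: l => .ite (.eq (.reg 100) (.const (pc x))) (compile F b rg pc (M x.1) x.2)
      (dispatch M F b rg pc l)

variable {M : Λ → TM2.Stmt Γ Λ σ} {m : ℕ}

theorem exec_dispatch [DecidableEq K] [Finite σ] (hrg : Function.Injective rg)
    (hrg100 : ∀ k, 100 ≠ rg k) (hpc : Function.Injective pc) (hb : ∀ k, (F k).length < 2 ^ b)
    (hM : ∀ l, PushesIn F (M l) ∧ pushes (M l) ≤ m) (l : List (Λ × σ)) :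
    ∃ c, ∀ (w : ℕ) (iMul : ℕ → ℕ → ℕ) (B U : ℕ), Params w iMul B U →
      ∀ (x : Λ × σ) (S : ∀ k, List (Γ k)) (s : State), x ∈ l → Rep F b rg S s →
      s.reg 100 = pc x → pc x < 2 ^ B → (∀ k, b * ((S k).length + m) ≤ B) →
      ∃ s' t, Exec w iMul (dispatch M F b rg pc l) s s' t ∧ t ≤ c * U ∧
        Rep F b rg (TM2.stepAux (M x.1) x.2 S).stk s' ∧
        s'.reg 100 = pcVal pc (TM2.stepAux (M x.1) x.2 S) ∧
        Same rg s s' ∧ ∀ k, ((TM2.stepAux (M x.1) x.2 S).stk k).length ≤ (S k).length + m := by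
  induction l with
  | nil => exact ⟨0, by simp⟩
  | cons y l ih =>
      obtain ⟨c, hc⟩ := ih
      obtain ⟨d, hd⟩ := exec_compile (pc := pc) hrg hrg100 hb (M y.1) (hM y.1).1
      refine ⟨(Expr.eq (.reg 100) (.const (pc y))).tick + 2 + c + d,
        fun w iMul B U hP x S s hx hS hs hlt hL => ?_⟩
      have hw : (Expr.eq (.reg 100) (.const (pc y))).Within w iMul B U s := by
        refine ⟨?_, trivial⟩
        change s.reg 100 < 2 ^ B
        rwa [hs]
      have h1 := Expr.cost_le hP.mono hP.one_le hP.words_le hw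
      have h2 := Expr.words_eval_le hP.one_le hP.words_le hw
      rw [show (Expr.eq (.reg 100) (.const (pc y))).growth = 1 from rfl] at h2
      by_cases hxy : x = y
      · subst hxy
        obtain ⟨s', t, hex, ht, hR, hpc', hsame, hl⟩ := hd w iMul B U hP x.2 S s hS fun k =>
          (Nat.mul_le_mul_left b (Nat.add_le_add_left (hM x.1).2 _)).trans (hL k)
        refine ⟨s', _, .ite_true (by simp [Expr.eval, hs]) hex, by nlinarith, hR, hpc', hsame,
          fun k => (hl k).trans (Nat.add_le_add_left (hM x.1).2 _)⟩
      · obtain ⟨s', t, hex, ht, hR⟩ := hc w iMul B U hP x S s ((List.mem_cons.1 hx).resolve_left hxy)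
          hS hs hlt hL
        refine ⟨s', _, .ite_false (by simp [Expr.eval, hs, hpc.eq_iff, hxy]) hex, by nlinarith, hR⟩

/-- The simulation of a halting computation. -/
theorem exec_run [DecidableEq K] [Finite σ] (hrg : Function.Injective rg)
    (hrg100 : ∀ k, 100 ≠ rg k) (hpc : Function.Injective pc) (hpc0 : ∀ x, pc x ≠ 0)
    (hb : ∀ k, (F k).length < 2 ^ b)
    (hM : ∀ l, PushesIn F (M l) ∧ pushes (M l) ≤ m) {l : List (Λ × σ)} (hl : ∀ x, x ∈ l) :
    ∃ c, ∀ (w : ℕ) (iMul : ℕ → ℕ → ℕ) (B U : ℕ), Params w iMul B U → (∀ x, pc x < 2 ^ B) →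
      ∀ (n : ℕ) (a a' : TM2.Cfg Γ Λ σ) (s : State), Rep F b rg a.stk s → s.reg 100 = pcVal pc a →
      (∀ k, b * ((a.stk k).length + n * m) ≤ B) → a'.l = none →
      (flip bind (TM2.step M))^[n] (some a) = some a' →
      ∃ s' t, Exec w iMul (.loop (.reg 100) (dispatch M F b rg pc l)) s s' t ∧
        t ≤ (n + 1) * c * U ∧ Rep F b rg a'.stk s' ∧ s'.reg 100 = 0 ∧ Same rg s s' := by
  obtain ⟨c, hc⟩ := exec_dispatch hrg hrg100 hpc hb hM l
  refine ⟨c + 5, fun w iMul B U hP hpcB n => ?_⟩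
  have hcost : ∀ s : State, s.reg 100 < 2 ^ B → (Expr.reg 100).cost w iMul s +
      words w ((Expr.reg 100).eval s) ≤ 5 * U := by
    intro s hs
    have hw : (Expr.reg 100).Within w iMul B U s := hs
    have h1 := Expr.cost_le hP.mono hP.one_le hP.words_le hw
    have h2 := Expr.words_eval_le hP.one_le hP.words_le hw
    simp only [Expr.tick, Expr.growth] at h1 h2
    omega
  induction n with
  | zero =>
      intro a a' s hR hs hL ha' hit
      obtain rfl : a = a' := by simpa using hit
      have hs0 : s.reg 100 = 0 := by rw [hs, pcVal, ha']; rfl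
      have h1 := hcost s (by rw [hs0]; positivity)
      exact ⟨s, _, .loop_false hs0, by nlinarith, hR, hs0, Same.refl rg s⟩
  | succ n ih =>
      rintro ⟨_ | q, v, S⟩ a' s hR hs hL ha' hit
      -- A configuration that has already halted has no successor, so iterating further cannot end
      -- in `some a'`.
      · exfalso
        rw [Function.iterate_succ_apply] at hit
        have h1 : flip bind (TM2.step M) (some ⟨none, v, S⟩) = none := rfl
        have h2 : ∀ n, (flip bind (TM2.step M))^[n] none = none := fun n =>
          Function.iterate_fixed rfl n
        rw [h1, h2] at hit
        cases hit
      · rw [Function.iterate_succ_apply] at hit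
        have h1 : flip bind (TM2.step M) (some ⟨some q, v, S⟩) = some (TM2.stepAux (M q) v S) := rfl
        rw [h1] at hit
        obtain ⟨s₁, t₁, hex₁, ht₁, hR₁, hpc₁, hsame₁, hl₁⟩ := hc w iMul B U hP (q, v) S s (hl _) hR
          hs (hpcB _) fun k => (Nat.mul_le_mul_left b (by
            change (S k).length + m ≤ (S k).length + (n + 1) * m
            rw [Nat.add_mul]; omega)).trans (hL k)
        obtain ⟨s₂, t₂, hex₂, ht₂, hR₂, hpc₂, hsame₂⟩ := ih _ a' s₁ hR₁ hpc₁ (fun k =>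
          (Nat.mul_le_mul_left b (by
            have := hl₁ k
            change _ ≤ (S k).length + (n + 1) * m
            rw [Nat.add_mul]
            simp only at *
            omega)).trans (hL k)) ha' hit
        have hs' : s.reg 100 = pc (q, v) := hs
        have h2 := hcost s (by rw [hs']; exact hpcB _)
        refine ⟨s₂, _, .loop_true ?_ hex₁ hex₂, ?_, hR₂, hpc₂, hsame₁.trans hsame₂⟩
        · change s.reg 100 ≠ 0
          rw [hs']
          exact hpc0 _
        · nlinarith

theorem PushesIn.mono {F' : ∀ k, List (Γ k)} (hF : ∀ k, F k ⊆ F' k) :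
    ∀ {q : TM2.Stmt Γ Λ σ}, PushesIn F q → PushesIn F' q
  | .push k _ _, h => ⟨fun v => hF k (h.1 v), PushesIn.mono hF h.2⟩
  | .peek _ _ q, h | .pop _ _ q, h | .load _ q, h => PushesIn.mono (q := q) hF h
  | .branch _ _ _, h => ⟨PushesIn.mono hF h.1, PushesIn.mono hF h.2⟩
  | .goto _, _ | .halt, _ => trivial

/-- The stack alphabets may be infinite, but a pushed symbol is a function of the internal state, so
only finitely many symbols can ever be pushed. -/
theorem exists_pushesIn [DecidableEq K] [Finite σ] (q : TM2.Stmt Γ Λ σ) :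
    ∃ F : ∀ k, List (Γ k), PushesIn F q := by
  induction q with
  | push k f q ih =>
      obtain ⟨F, hF⟩ := ih
      refine ⟨Function.update F k ((Set.finite_range f).toFinset.toList ++ F k), fun v => by simp,
        hF.mono fun k' => ?_⟩
      by_cases hk : k' = k
      · subst hk; simp
      · simp [hk]
  | peek _ _ _ ih | pop _ _ _ ih | load _ _ ih => exact ih
  | branch _ q₁ q₂ ih₁ ih₂ =>
      obtain ⟨F₁, hF₁⟩ := ih₁
      obtain ⟨F₂, hF₂⟩ := ih₂
      exact ⟨fun k => F₁ k ++ F₂ k, hF₁.mono fun k => by simp, hF₂.mono fun k => by simp⟩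
  | goto _ => exact ⟨fun _ => [], trivial⟩
  | halt => exact ⟨fun _ => [], trivial⟩

end StackSim

end RAM

/-! ### Running the decision machine on all relevant sizes -/

namespace RAM

open Turing Turing.TM2

namespace StackSim

/-- Data for the simulation of a machine with finitely many stacks. -/
structure Coding (tm : FinTM2) where
  F : ∀ k, List (tm.Γ k)
  b : ℕ
  rg : tm.K → ℕ
  pc : tm.Λ × tm.σ → ℕ
  m : ℕ
  l : List (tm.Λ × tm.σ)
  rg_injective : Function.Injective rg
  rg_gt : ∀ k, 100 < rg k
  pc_injective : Function.Injective pc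
  pc_ne : ∀ x, pc x ≠ 0
  pc_bound : ∃ c, ∀ x, pc x < c
  length_lt : ∀ k, (F k).length < 2 ^ b
  pushes : ∀ l, PushesIn F (tm.m l) ∧ pushes (tm.m l) ≤ m
  mem_l : ∀ x, x ∈ l
  mem_input : ∀ g, g ∈ F tm.k₀

/-- Symbols on the stacks stem from pushes or from the input, and those in `out` are added so that
outputs can be compared. Taking for `b` the total number of listed symbols makes `2 ^ b` exceed
every list. Program counters are shifted by one because `0` means halted; the stacks use the
registers from `101` on. -/
theorem exists_coding (tm : FinTM2) (out : List (tm.Γ tm.k₁)) :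
    ∃ D : Coding tm, ∀ g ∈ out, g ∈ D.F tm.k₁ := by
  classical
  let _ := tm.kFin
  let _ := tm.ΛFin
  let _ := tm.σFin
  let _ := tm.Γk₀Fin
  choose Fl hFl using fun l => exists_pushesIn (tm.m l)
  let F : ∀ k, List (tm.Γ k) := fun k => (Finset.univ.toList.flatMap fun l => Fl l k) ++
    (Function.update (fun k => ([] : List (tm.Γ k))) tm.k₀ Finset.univ.toList k ++
      Function.update (fun k => ([] : List (tm.Γ k))) tm.k₁ out k)
  refine ⟨⟨F, ∑ k, (F k).length, fun k => 101 + Fintype.equivFin tm.K k,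
    fun x => Fintype.equivFin (tm.Λ × tm.σ) x + 1, ∑ l, StackSim.pushes (tm.m l),
    Finset.univ.toList, fun x y h => ?_, fun k => by omega, fun x y h => ?_, fun x => by omega,
    ⟨Fintype.card (tm.Λ × tm.σ) + 1, fun x => Nat.succ_lt_succ (Fin.is_lt _)⟩, fun k => ?_, fun l => ⟨?_, ?_⟩,
    fun x => by simp, fun g => by simp [F]⟩, fun g hg => by simp [F, hg]⟩
  · simpa [Fin.val_inj] using h
  · simpa [Fin.val_inj] using h
  · exact (Finset.single_le_sum (f := fun k => (F k).length) (fun _ _ => Nat.zero_le _)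
      (Finset.mem_univ k)).trans_lt Nat.lt_two_pow_self
  · refine (hFl l).mono fun k => ?_
    refine List.subset_append_of_subset_left _ fun g hg => ?_
    simp only [List.mem_flatMap, Finset.mem_toList, Finset.mem_univ, true_and]
    exact ⟨l, hg⟩
  · exact Finset.single_le_sum (f := fun l => StackSim.pushes (tm.m l)) (fun _ _ => Nat.zero_le _)
      (Finset.mem_univ l)

variable {tm : FinTM2} (D : Coding tm) (gin : tm.Γ tm.k₀) (gout : tm.Γ tm.k₁)

/-- One run of the machine, on an input that consists of copies of `gin`, and the comparison of the
output with `gout`. -/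
noncomputable def testBody : Cmd :=
  .seq (.assign (D.rg tm.k₀) (.reg 99)) <|
  .seq (.assign 99 (pushExpr D.b 99 (enc (D.F tm.k₀) gin))) <|
  .seq (.assign 100 (.const (D.pc (tm.main, tm.initialState)))) <|
  .seq (.loop (.reg 100) (dispatch tm.m D.F D.b D.rg D.pc D.l)) <|
  .seq (.store 3 (.reg 98) (.eq (.reg (D.rg tm.k₁)) (.const (enc (D.F tm.k₁) gout)))) <|
  .seq (.assign (D.rg tm.k₁) (.const 0)) <|
  .assign 98 (.add (.reg 98) (.const 1))

/-- The content of the registers before the run on an input of length `j`. -/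
structure TestInv (s₀ : State) (f : ℕ → ℕ) (j : ℕ) (s : State) : Prop where
  reg98 : s.reg 98 = j
  reg99 : s.reg 99 = encStack D.b (D.F tm.k₀) (List.replicate j gin)
  other : ∀ x, x ≠ 98 → x ≠ 99 → s.reg x = s₀.reg x
  mem : ∀ A ≠ 3, s.mem A = s₀.mem A
  mem3 : ∀ i, s.mem 3 i = if i < j then f i else s₀.mem 3 i

theorem initList_stk (l : List (tm.Γ tm.k₀)) :
    (initList tm l).stk = Function.update (fun _ => []) tm.k₀ l := by
  funext k
  by_cases h : k = tm.k₀
  · subst h; simp [initList]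
  · simp [initList, h]

theorem haltList_stk (l : List (tm.Γ tm.k₁)) :
    (haltList tm l).stk = Function.update (fun _ => []) tm.k₁ l := by
  funext k
  by_cases h : k = tm.k₁
  · subst h; simp [haltList]
  · simp [haltList, h]

/-- A halting run leaves every stack but the output stack empty and the program counter zero, so
clearing the output makes the registers ready for the next test. Register `99` keeps the encoded
unary input, which grows by one push per test. -/
theorem exec_testBody :
    ∃ c, ∀ (w : ℕ) (iMul : ℕ → ℕ → ℕ) (B U : ℕ), Params w iMul B U → (∀ x, D.pc x < 2 ^ B) →
      ∀ (n j : ℕ) (g : tm.Γ tm.k₁) (s₀ s : State) (f : ℕ → ℕ), g ∈ D.F tm.k₁ →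
      (∀ x, 100 ≤ x → s₀.reg x = 0) →
      TestInv D gin s₀ f j s → j < 2 ^ B → D.b * (j + n * D.m + 1) ≤ B →
      (flip bind tm.step)^[n] (some (initList tm (List.replicate j gin))) =
        some (haltList tm [g]) →
      (g = gout → f j = 1) → (g ≠ gout → f j = 0) →
      ∃ s' t, Exec w iMul (testBody D gin gout) s s' t ∧ t ≤ (n + 1) * c * U ∧
        TestInv D gin s₀ f (j + 1) s' := by
  classical
  let _ := tm.σFin
  have hrg := D.rg_gt
  obtain ⟨c, hc⟩ := exec_run D.rg_injective (fun k => (hrg k).ne) D.pc_injective D.pc_ne D.length_lt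
    D.pushes D.mem_l
  refine ⟨c + (Expr.reg 99).tick + 2 + (pushExpr D.b 99 (enc (D.F tm.k₀) gin)).tick +
    (pushExpr D.b 99 (enc (D.F tm.k₀) gin)).growth + 1 +
    2 * D.pc (tm.main, tm.initialState) + 2 +
    (Expr.eq (.reg (D.rg tm.k₁)) (.const (enc (D.F tm.k₁) gout))).tick + 20,
    fun w iMul B U hP hpcB n j g s₀ s f hg hs₀ hI hj hB hrun hf hf' => ?_⟩
  have hin : ∀ j, ∀ g ∈ List.replicate j gin, g ∈ D.F tm.k₀ := fun _ g _ => D.mem_input g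
  have hB' : D.b * j ≤ B := (Nat.mul_le_mul_left _ (by omega)).trans hB
  have h99 : s.reg 99 < 2 ^ B := by
    rw [hI.reg99]
    refine (encStack_lt (D.length_lt _) (hin j)).trans_le (Nat.pow_le_pow_right two_pos ?_)
    simpa using hB'
  -- the input
  have hex₁ := Exec.assign (w := w) (iMul := iMul) (D.rg tm.k₀) (.reg 99) s
  have hw₁ : (Expr.reg 99).Within w iMul B U s := h99
  have c₁ := Expr.cost_le hP.mono hP.one_le hP.words_le hw₁
  have d₁ := Expr.words_eval_le hP.one_le hP.words_le hw₁
  rw [show (Expr.reg 99).eval s = encStack D.b (D.F tm.k₀) (List.replicate j gin) from hI.reg99]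
    at hex₁ d₁
  set s₁ := s.setReg (D.rg tm.k₀) (encStack D.b (D.F tm.k₀) (List.replicate j gin)) with hs₁
  have e₁ : ∀ x ≤ 100, s₁.reg x = s.reg x := fun x hx => by
    have := hrg tm.k₀
    rw [hs₁, State.setReg_reg, if_neg (by omega)]
  have hR₀ : Rep D.F D.b D.rg (fun _ => []) s := fun k => ⟨by
    have := hrg k
    rw [hI.other _ (by omega) (by omega), hs₀ _ (by omega)]
    rfl, by simp⟩
  have hR₁ := hR₀.setReg_rg D.rg_injective tm.k₀ (List.replicate j gin) (hin j)
  rw [← initList_stk, ← hs₁] at hR₁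
  -- the next input
  have hex₂ := Exec.assign (w := w) (iMul := iMul) 99 (pushExpr D.b 99 (enc (D.F tm.k₀) gin)) s₁
  have hw₂ : (pushExpr D.b 99 (enc (D.F tm.k₀) gin)).Within w iMul B U s₁ :=
    ⟨Expr.within_dbl (e := .reg 99) (by change s₁.reg 99 < _; rwa [e₁ 99 (by omega)]) _, trivial⟩
  have c₂ := Expr.cost_le hP.mono hP.one_le hP.words_le hw₂
  have d₂ := Expr.words_eval_le hP.one_le hP.words_le hw₂
  have v₂ : (pushExpr D.b 99 (enc (D.F tm.k₀) gin)).eval s₁ =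
      encStack D.b (D.F tm.k₀) (List.replicate (j + 1) gin) := by
    simp [pushExpr, Expr.eval, e₁, hI.reg99, encStack, List.replicate_succ, add_comm]
  rw [v₂] at hex₂ d₂
  set s₂ := s₁.setReg 99 (encStack D.b (D.F tm.k₀) (List.replicate (j + 1) gin)) with hs₂
  have hR₂ : Rep D.F D.b D.rg _ s₂ := hR₁.setReg_of_ne fun k => by have := hrg k; omega
  -- the program counter
  have hex₃ := Exec.assign (w := w) (iMul := iMul) 100 (.const (D.pc (tm.main, tm.initialState))) s₂
  have hw₃ : (Expr.const (D.pc (tm.main, tm.initialState))).Within w iMul B U s₂ := trivial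
  have c₃ := Expr.cost_le hP.mono hP.one_le hP.words_le hw₃
  have d₃ := Expr.words_eval_le hP.one_le hP.words_le hw₃
  simp only [Expr.eval, Expr.tick, Expr.growth] at hex₃ c₃ d₃
  set s₃ := s₂.setReg 100 (D.pc (tm.main, tm.initialState)) with hs₃
  have hR₃ : Rep D.F D.b D.rg _ s₃ := hR₂.setReg_of_ne fun k => by have := hrg k; omega
  -- the run
  have hlen : ∀ k, D.b * (((initList tm (List.replicate j gin)).stk k).length + n * D.m) ≤ B := by
    intro k
    refine (Nat.mul_le_mul_left _ ?_).trans hB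
    rw [initList_stk]
    by_cases hk : k = tm.k₀
    · subst hk; simp
    · simp [hk]; omega
  obtain ⟨s₄, t₄, hex₄, ht₄, hR₄, hpc₄, hsame₄⟩ := hc w iMul B U hP hpcB n _
    (haltList tm [g]) s₃ hR₃ (by rw [hs₃]; simp [pcVal, initList]) hlen rfl hrun
  have e₄ : ∀ x, x ≠ 100 → x ≠ 99 → (∀ k, x ≠ D.rg k) → s₄.reg x = s.reg x := by
    intro x h1 h2 h3
    rw [hsame₄.2 x h1 h3, hs₃, State.setReg_reg, if_neg h1, hs₂, State.setReg_reg, if_neg h2, hs₁,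
      State.setReg_reg, if_neg (h3 _)]
  have h98 : s₄.reg 98 = j := by
    rw [e₄ 98 (by omega) (by omega) fun k => by have := hrg k; omega, hI.reg98]
  have hk₁ : s₄.reg (D.rg tm.k₁) = enc (D.F tm.k₁) g := by
    have := (hR₄ tm.k₁).1
    rw [haltList_stk] at this
    simpa [encStack] using this
  have hk₁B : s₄.reg (D.rg tm.k₁) < 2 ^ B := by
    rw [hk₁]
    refine (enc_lt hg (D.length_lt _)).trans_le (Nat.pow_le_pow_right two_pos ?_)
    exact (Nat.le_mul_of_pos_right _ (by omega)).trans hB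
  -- the output
  have hex₅ := Exec.store (w := w) (iMul := iMul) 3 (.reg 98)
    (.eq (.reg (D.rg tm.k₁)) (.const (enc (D.F tm.k₁) gout))) s₄
  have hw₅ : (Expr.reg 98).Within w iMul B U s₄ := by change s₄.reg 98 < _; rwa [h98]
  have hw₅' : (Expr.eq (.reg (D.rg tm.k₁)) (.const (enc (D.F tm.k₁) gout))).Within w iMul B U s₄ :=
    ⟨hk₁B, trivial⟩
  have c₅ := Expr.cost_le hP.mono hP.one_le hP.words_le hw₅
  have d₅ := Expr.words_eval_le hP.one_le hP.words_le hw₅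
  have c₅' := Expr.cost_le hP.mono hP.one_le hP.words_le hw₅'
  have d₅' := Expr.words_eval_le hP.one_le hP.words_le hw₅'
  have v₅ : (Expr.eq (.reg (D.rg tm.k₁)) (.const (enc (D.F tm.k₁) gout))).eval s₄ = f j := by
    by_cases h : g = gout
    · simp [Expr.eval, hk₁, h, hf]
    · simp [Expr.eval, hk₁, enc_inj hg, h, hf' h]
  rw [v₅] at hex₅ d₅'
  rw [show (Expr.reg 98).eval s₄ = j from h98] at hex₅ d₅
  rw [show (Expr.eq (.reg (D.rg tm.k₁)) (.const (enc (D.F tm.k₁) gout))).growth = 1 from rfl] at d₅'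
  rw [show (Expr.reg 98).growth = 1 from rfl] at d₅
  rw [show (Expr.reg 98).tick = 2 from rfl] at c₅
  set s₅ := s₄.setMem 3 j (f j) with hs₅
  -- clearing the output stack
  have hex₆ := Exec.assign (w := w) (iMul := iMul) (D.rg tm.k₁) (.const 0) s₅
  have hw₆ : (Expr.const 0).Within w iMul B U s₅ := trivial
  have c₆ := Expr.cost_le hP.mono hP.one_le hP.words_le hw₆
  have d₆ := Expr.words_eval_le hP.one_le hP.words_le hw₆
  simp only [Expr.eval, Expr.tick, Expr.growth] at hex₆ c₆ d₆
  set s₆ := s₅.setReg (D.rg tm.k₁) 0 with hs₆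
  have h98' : s₆.reg 98 = j := by
    have := hrg tm.k₁
    rw [hs₆, State.setReg_reg, if_neg (by omega), hs₅, State.setMem_reg, h98]
  -- the counter
  have hex₇ := Exec.assign (w := w) (iMul := iMul) 98 (.add (.reg 98) (.const 1)) s₆
  have hw₇ : (Expr.add (.reg 98) (.const 1)).Within w iMul B U s₆ :=
    ⟨by change s₆.reg 98 < _; rwa [h98'], trivial⟩
  have c₇ := Expr.cost_le hP.mono hP.one_le hP.words_le hw₇
  have d₇ := Expr.words_eval_le hP.one_le hP.words_le hw₇
  rw [show (Expr.add (.reg 98) (.const 1)).eval s₆ = j + 1 by simp [Expr.eval, h98']] at hex₇ d₇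
  rw [show (Expr.add (.reg 98) (.const 1)).growth = 3 from rfl] at d₇
  rw [show (Expr.add (.reg 98) (.const 1)).tick = 8 from rfl] at c₇
  rw [show (Expr.reg 99).growth = 1 from rfl] at d₁
  refine ⟨_, _, .seq hex₁ (.seq hex₂ (.seq hex₃ (.seq hex₄ (.seq hex₅ (.seq hex₆ hex₇))))), ?_, ?_⟩
  · have hU : 0 ≤ n * U := Nat.zero_le _
    simp only [Nat.add_mul, one_mul, Nat.mul_add] at *
    have hn : ∀ x, 0 ≤ n * x * U := fun _ => Nat.zero_le _
    linarith [hn (Expr.reg 99).tick, hn (pushExpr D.b 99 (enc (D.F tm.k₀) gin)).tick,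
      hn (pushExpr D.b 99 (enc (D.F tm.k₀) gin)).growth, hn 2, hn 1, hn 20,
      hn (2 * D.pc (tm.main, tm.initialState)),
      hn (Expr.eq (.reg (D.rg tm.k₁)) (.const (enc (D.F tm.k₁) gout))).tick]
  · have hmem : s₄.mem = s.mem := by rw [hsame₄.1, hs₃, hs₂, hs₁]; rfl
    refine ⟨by simp, ?_, ?_, ?_, ?_⟩
    · have h1 : (99 : ℕ) ≠ D.rg tm.k₁ := by have := hrg tm.k₁; omega
      rw [State.setReg_reg, if_neg (by omega), hs₆, State.setReg_reg, if_neg h1, hs₅,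
        State.setMem_reg, hsame₄.2 99 (by omega) fun k => by have := hrg k; omega, hs₃,
        State.setReg_reg, if_neg (by omega), hs₂]
      simp
    · intro x hx hx'
      rw [State.setReg_reg, if_neg hx, hs₆, State.setReg_reg]
      by_cases hxk : ∃ k, x = D.rg k
      · obtain ⟨k, rfl⟩ := hxk
        rw [hs₀ _ (hrg k).le, hs₅, State.setMem_reg]
        split_ifs with h
        · rfl
        · rw [(hR₄ k).1, haltList_stk]
          have : k ≠ tm.k₁ := fun hk => h (by rw [hk])
          simp [this, encStack]
      · push Not at hxk
        rw [if_neg (hxk _), hs₅, State.setMem_reg]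
        by_cases h100 : x = 100
        · rw [h100, hpc₄, hs₀ _ le_rfl]
        · rw [e₄ x h100 hx' hxk, hI.other x hx hx']
    · intro A hA
      rw [State.setReg_mem, hs₆, State.setReg_mem, hs₅, State.setMem_mem_ne _ _ _ _ _ hA, hmem,
        hI.mem A hA]
    · intro i
      rw [State.setReg_mem, hs₆, State.setReg_mem, hs₅, State.setMem_mem, hmem, hI.mem3]
      by_cases hij : i = j
      · simp [hij]
      · have : i < j + 1 ↔ i < j := by omega
        simp [hij, this]

/-- The tests for all inputs of length at most `reg 2 + 1`. -/
noncomputable def testProgram : Cmd :=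
  .seq (.loop (.lt (.reg 98) (.add (.reg 2) (.const 2))) (testBody D gin gout)) <|
  .seq (.assign 98 (.const 0)) (.assign 99 (.const 0))

/-- The tested lengths `0, …, k + 1` include all sizes of cliques in a graph of width `k`. Each test
is charged at most `T + 1` rounds of constant cost, and the two auxiliary registers are reset at the
end. -/
theorem exec_testProgram :
    ∃ c, ∀ (w : ℕ) (iMul : ℕ → ℕ → ℕ) (B U : ℕ), Params w iMul B U → (∀ x, D.pc x < 2 ^ B) →
      ∀ (T k : ℕ) (s₀ : State) (f : ℕ → ℕ), s₀.reg 2 = k → (∀ x, 98 ≤ x → s₀.reg x = 0) →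
      k + 2 < 2 ^ B → D.b * (k + 2 + T * D.m + 1) ≤ B →
      (∀ j < k + 2, ∃ g ∈ D.F tm.k₁, ∃ n ≤ T,
        (flip bind tm.step)^[n] (some (initList tm (List.replicate j gin))) =
          some (haltList tm [g]) ∧ (g = gout → f j = 1) ∧ (g ≠ gout → f j = 0)) →
      ∃ s' t, Exec w iMul (testProgram D gin gout) s₀ s' t ∧ t ≤ (k + 3) * (T + 1) * c * U ∧
        s'.reg = s₀.reg ∧ (∀ A ≠ 3, s'.mem A = s₀.mem A) ∧
        ∀ i, s'.mem 3 i = if i < k + 2 then f i else s₀.mem 3 i := by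
  obtain ⟨c, hc⟩ := exec_testBody D gin gout
  refine ⟨c + 40, fun w iMul B U hP hpcB T k s₀ f hk hs₀ hkB hB hrun => ?_⟩
  have key : ∀ i j s, j + i = k + 2 → TestInv D gin s₀ f j s → ∃ s' t,
      Exec w iMul (.loop (.lt (.reg 98) (.add (.reg 2) (.const 2))) (testBody D gin gout)) s s' t ∧
        t ≤ (i + 1) * ((T + 1) * (c + 30) * U) ∧ TestInv D gin s₀ f (k + 2) s' := by
    intro i
    have hcond : ∀ j s, j ≤ k + 2 → TestInv D gin s₀ f j s →
        (Expr.lt (.reg 98) (.add (.reg 2) (.const 2))).cost w iMul s +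
          words w ((Expr.lt (.reg 98) (.add (.reg 2) (.const 2))).eval s) ≤ 30 * U ∧
        (Expr.lt (.reg 98) (.add (.reg 2) (.const 2))).eval s = if j < k + 2 then 1 else 0 := by
      intro j s hj hI
      have hw : (Expr.lt (.reg 98) (.add (.reg 2) (.const 2))).Within w iMul B U s := by
        refine ⟨?_, ?_, trivial⟩
        · change s.reg 98 < _
          rw [hI.reg98]; omega
        · change s.reg 2 < _
          rw [hI.other 2 (by omega) (by omega), hk]; omega
      have h1 := Expr.cost_le hP.mono hP.one_le hP.words_le hw
      have h2 := Expr.words_eval_le hP.one_le hP.words_le hw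
      rw [show (Expr.lt (.reg 98) (.add (.reg 2) (.const 2))).tick = 19 from rfl] at h1
      rw [show (Expr.lt (.reg 98) (.add (.reg 2) (.const 2))).growth = 1 from rfl] at h2
      refine ⟨by omega, ?_⟩
      simp [Expr.eval, hI.reg98, hI.other 2, hk]
    induction i with
    | zero =>
        intro j s hj hI
        obtain ⟨h1, h2⟩ := hcond j s (by omega) hI
        obtain rfl : j = k + 2 := hj
        refine ⟨s, _, .loop_false (by simp [h2]), h1.trans ?_, hI⟩
        nlinarith [Nat.zero_le (T * c * U), Nat.zero_le (T * U), Nat.zero_le (c * U)]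
    | succ i ih =>
        intro j s hj hI
        obtain ⟨h1, h2⟩ := hcond j s (by omega) hI
        have hjk : j < k + 2 := by omega
        obtain ⟨g, hg, n, hn, hit, hf, hf'⟩ := hrun j hjk
        obtain ⟨s₁, t₁, hex₁, ht₁, hI₁⟩ := hc w iMul B U hP hpcB n j g s₀ s f hg
          (fun x hx => hs₀ x (by omega)) hI (by omega)
          ((Nat.mul_le_mul_left _ (by
            have := Nat.mul_le_mul_right D.m hn
            omega)).trans hB) hit hf hf'
        obtain ⟨s₂, t₂, hex₂, ht₂, hI₂⟩ := ih (j + 1) s₁ (by omega) hI₁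
        refine ⟨s₂, _, .loop_true (by simp [h2, hjk]) hex₁ hex₂, ?_, hI₂⟩
        have h3 : (n + 1) * c * U ≤ (T + 1) * c * U :=
          Nat.mul_le_mul_right _ (Nat.mul_le_mul_right _ (by omega))
        nlinarith [Nat.zero_le (T * U)]
  obtain ⟨s₁, t₁, hex₁, ht₁, hI₁⟩ := key (k + 2) 0 s₀ (by omega)
    ⟨hs₀ 98 le_rfl, by rw [hs₀ 99 (by omega)]; rfl, fun _ _ _ => rfl, fun _ _ => rfl, by simp⟩
  have hw0 : ∀ s, (Expr.const 0).Within w iMul B U s := fun _ => trivial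
  have h1 := fun s => Expr.cost_le hP.mono hP.one_le hP.words_le (hw0 s)
  have h2 := fun s => Expr.words_eval_le hP.one_le hP.words_le (hw0 s)
  simp only [Expr.tick, Expr.growth] at h1 h2
  refine ⟨_, _, .seq hex₁ (.seq (.assign _ _ _) (.assign _ _ _)), ?_, ?_, ?_, ?_⟩
  · have h3 := h1 s₁
    have h4 := h2 s₁
    have h5 := h1 (s₁.setReg 98 ((Expr.const 0).eval s₁))
    have h6 := h2 (s₁.setReg 98 ((Expr.const 0).eval s₁))
    nlinarith [Nat.zero_le (T * U), Nat.zero_le (k * U), Nat.zero_le (k * T * U)]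
  · funext x
    simp only [State.setReg_reg, Expr.eval]
    split_ifs with h h'
    · rw [h, hs₀ 99 (by omega)]
    · rw [h', hs₀ 98 (by omega)]
    · exact hI₁.other x h' h
  · exact fun A hA => hI₁.mem A hA
  · exact hI₁.mem3

end StackSim

/-- The power is at most the descending factorial of `k + n` of length `n`, which is `n!` times a
binomial coefficient, and the latter is at most `2 ^ (k + n)`. This absorbs the cost of deciding `γ`
into `2 ^ k`. -/
theorem exists_pow_le_mul_two_pow (n : ℕ) : ∃ C, ∀ k : ℕ, k ^ n ≤ C * 2 ^ k := by
  refine ⟨n.factorial * 2 ^ n, fun k => ?_⟩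
  calc k ^ n ≤ (k + n + 1 - n) ^ n := Nat.pow_le_pow_left (by omega) n
    _ ≤ (k + n).descFactorial n := Nat.pow_sub_le_descFactorial _ _
    _ = n.factorial * (k + n).choose n := Nat.descFactorial_eq_factorial_mul_choose _ _
    _ ≤ n.factorial * 2 ^ (k + n) := Nat.mul_le_mul_left _ (Nat.choose_le_two_pow _ _)
    _ = _ := by rw [pow_add]; ring

theorem exists_eval_le_mul_two_pow (p : Polynomial ℕ) : ∃ C, ∀ k : ℕ, p.eval k ≤ C * 2 ^ k := by
  induction p using Polynomial.induction_on' with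
  | add p q hp hq =>
      obtain ⟨C, hC⟩ := hp
      obtain ⟨C', hC'⟩ := hq
      refine ⟨C + C', fun k => ?_⟩
      rw [Polynomial.eval_add, Nat.add_mul]
      exact Nat.add_le_add (hC k) (hC' k)
  | monomial n a =>
      obtain ⟨C, hC⟩ := exists_pow_le_mul_two_pow n
      refine ⟨a * C, fun k => ?_⟩
      rw [Polynomial.eval_monomial, mul_assoc]
      exact Nat.mul_le_mul_left _ (hC k)

theorem eval_mono (p : Polynomial ℕ) {i j : ℕ} (h : i ≤ j) : p.eval i ≤ p.eval j := by
  induction p using Polynomial.induction_on' with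
  | add p q hp hq =>
      rw [Polynomial.eval_add, Polynomial.eval_add]
      exact Nat.add_le_add hp hq
  | monomial n a =>
      rw [Polynomial.eval_monomial, Polynomial.eval_monomial]
      exact Nat.mul_le_mul_left _ (Nat.pow_le_pow_left h n)

theorem unaryEncodeNat_eq_replicate (j : ℕ) :
    Computability.unaryEncodeNat j = List.replicate j true := by
  induction j with
  | zero => rfl
  | succ j ih => rw [Computability.unaryEncodeNat, ih, List.replicate_succ]

open Classical in
/-- A program that tabulates a set that is decidable in polynomial time. -/
theorem exists_tabulate {γ : Set ℕ} (hγ : PolyTimeDecidable γ) :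
    ∃ (p : Cmd) (C : ℕ), ∀ (w : ℕ) (iMul : ℕ → ℕ → ℕ), Monotone (iMul w) →
      ∀ (k : ℕ) (s : State), s.reg 2 = k → (∀ x, 98 ≤ x → s.reg x = 0) →
      ∃ s' t, Exec w iMul p s s' t ∧ t ≤ C * 2 ^ k ∧ s'.reg = s.reg ∧
        (∀ A ≠ 3, s'.mem A = s.mem A) ∧
        ∀ i, s'.mem 3 i = if i < k + 2 then (if i ∈ γ then 1 else 0) else s.mem 3 i := by
  obtain ⟨h⟩ := hγ
  obtain ⟨D, hD⟩ := StackSim.exists_coding h.tm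
    [h.outputAlphabet.symm true, h.outputAlphabet.symm false]
  obtain ⟨c, hc⟩ := StackSim.exec_testProgram D (h.inputAlphabet.symm true)
    (h.outputAlphabet.symm true)
  obtain ⟨e, he⟩ := D.pc_bound
  let X : Polynomial ℕ := Polynomial.X
  let T : Polynomial ℕ := h.time.comp (X + 2)
  -- Room for stacks whose length is at most that of the input plus the pushes of `T` steps, for the
  -- counter, and for the program counters. This bit bound belongs to the tabulation alone; since `B
  -- / w ≤ B`, the unit `B + 1` works for every word size.
  let B : Polynomial ℕ := Polynomial.C D.b * (X + 2 + T * Polynomial.C D.m + 1) + X + 3 +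
    Polynomial.C e
  obtain ⟨C, hC⟩ := exists_eval_le_mul_two_pow
    ((X + 3) * (T + 1) * Polynomial.C c * (B + 1))
  refine ⟨StackSim.testProgram D (h.inputAlphabet.symm true) (h.outputAlphabet.symm true), C,
    fun w iMul hmono k s hk hs => ?_⟩
  have hT : T.eval k = h.time.eval (k + 2) := by simp [T, X]
  have hB : B.eval k = D.b * (k + 2 + T.eval k * D.m + 1) + k + 3 + e := by simp [B, X]
  have hP : StackSim.Params w iMul (B.eval k) (B.eval k + 1) :=
    ⟨hmono, by omega, Nat.succ_le_succ (Nat.div_le_self _ _)⟩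
  have hB2 := (B.eval k).lt_two_pow_self
  obtain ⟨s', t, hex, ht, hreg, hmem, hmem3⟩ := hc w iMul _ _ hP
    (fun x => (he x).trans (by omega)) (T.eval k) k s (fun i => if i ∈ γ then 1 else 0) hk hs
    (by omega) (by omega) fun j hj => by
      have hout := h.outputsFun j
      rw [unaryEncodeNat_eq_replicate, List.length_replicate, List.map_replicate] at hout
      refine ⟨h.outputAlphabet.symm (decide (j ∈ γ)), hD _ ?_, hout.steps, ?_, ?_, ?_, ?_⟩
      · cases decide (j ∈ γ) <;> simp
      · refine hout.steps_le_m.trans ?_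
        rw [hT]
        exact eval_mono _ (by omega)
      · simpa [Computability.encodeBool] using hout.evals_in_steps
      · intro h'
        simpa using h.outputAlphabet.symm.injective h'
      · intro h'
        simpa using h'
  refine ⟨s', t, hex, ht.trans ?_, hreg, hmem, hmem3⟩
  have := hC k
  simpa [X] using this

end RAM

/-! ### Tables of powers, bits and binomial coefficients -/

namespace RAM

/-- The cell in row `x` and column `y` of the array `A` with `z` columns, for registers `x y z`. -/
def Expr.cell (A x z y : ℕ) : Expr := .load A (.add (.mul (.reg x) (.reg z)) (.reg y))

/-- The address of the cell in row `x` and column `y` of an array with `z` columns. -/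
def Expr.addr (x z y : ℕ) : Expr := .add (.mul (.reg x) (.reg z)) (.reg y)

@[simp] theorem Expr.eval_cell (s : State) (A x z y : ℕ) :
    (Expr.cell A x z y).eval s = s.mem A (s.reg x * s.reg z + s.reg y) := rfl

@[simp] theorem Expr.eval_addr (s : State) (x z y : ℕ) :
    (Expr.addr x z y).eval s = s.reg x * s.reg z + s.reg y := rfl

theorem addr_inj {W i j i' j' : ℕ} (hj : j < W) (hj' : j' < W) :
    i * W + j = i' * W + j' ↔ i = i' ∧ j = j' := by
  constructor
  · intro h
    have h1 : (i * W + j) / W = (i' * W + j') / W := by rw [h]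
    have h2 : (i * W + j) % W = (i' * W + j') % W := by rw [h]
    rw [mul_comm i, mul_comm i', Nat.mul_add_div (by omega), Nat.mul_add_div (by omega),
      Nat.div_eq_of_lt hj, Nat.div_eq_of_lt hj'] at h1
    rw [mul_comm i, mul_comm i', Nat.mul_add_mod, Nat.mul_add_mod, Nat.mod_eq_of_lt hj,
      Nat.mod_eq_of_lt hj'] at h2
    exact ⟨h1, h2⟩
  · rintro ⟨rfl, rfl⟩
    rfl

/-- The registers that hold the parameters of the input. -/
structure Ctx (n N k : ℕ) (s : State) : Prop where
  r0 : s.reg 0 = n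
  r1 : s.reg 1 = N
  r2 : s.reg 2 = k
  r3 : s.reg 3 = k + 1
  r4 : s.reg 4 = 2 ^ (k + 1)
  r5 : s.reg 5 = n + 1

theorem Ctx.frame {n N k : ℕ} {p : Cmd} {s s' : State} (h : Ctx n N k s) (hf : Frame p s s')
    (hp : ∀ x ∈ [0, 1, 2, 3, 4, 5], x ∉ p.wreg) : Ctx n N k s' := by
  constructor <;> rw [hf.1 _ (hp _ (by decide))]
  exacts [h.r0, h.r1, h.r2, h.r3, h.r4, h.r5]

/-- `B` bits suffice for all numbers that occur in the computation. -/
structure Fits (n N k B : ℕ) : Prop where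
  addr : (n + 2) * 2 ^ (k + 1) * (n + 2) < lim B
  node : N + n + k + 3 < lim B
  choose : ∀ d ≤ n, (n * 2 ^ k).choose d < lim B
  lt : k < n

theorem Fits.pow {n N k B : ℕ} (h : Fits n N k B) : 2 ^ (k + 1) * 2 < lim B := by
  refine lt_of_le_of_lt ?_ h.addr
  nlinarith [Nat.zero_le (n * 2 ^ (k + 1)), Nat.zero_le (n * n * 2 ^ (k + 1)),
    Nat.zero_le (2 ^ (k + 1))]

def setup : Cmd :=
  .seq
    (.seq (.assign 3 (.add (.reg 2) (.const 1))) <|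
      .seq (.assign 5 (.add (.reg 0) (.const 1))) (.assign 4 (.const 1)))
    (.for 6 3 (.seq (.store 12 (.reg 6) (.reg 4)) (.assign 4 (.add (.reg 4) (.reg 4)))))

variable {E : Env} {n N k : ℕ} {s : State}

theorem runs_setup (hB : Fits n N k E.B) (hs : Bdd E.B s) (h0 : s.reg 0 = n) (h1 : s.reg 1 = N)
    (h2 : s.reg 2 = k) :
    E.Runs setup s ((k + 3) * 100) fun s' => Ctx n N k s' ∧ ∀ j ≤ k, s'.mem 12 j = 2 ^ j := by
  have hN := hB.node
  have hP := hB.pow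
  refine (Env.Runs.seq (Env.runs_flat hs rfl ?_ (Q := fun s' => s'.reg 3 = k + 1 ∧
    s'.reg 4 = 1 ∧ s'.reg 5 = n + 1) ?_) ?_ (T₂ := (k + 2) * (70 + 21))).weaken ?_
      fun _ _ _ h => h
  · simp [Cmd.Safe, Cmd.den, Expr.eval, State.setReg_reg, h2, h0]
    omega
  · simp [Cmd.den, Expr.eval, State.setReg_reg, h2, h0]
  · rintro s₁ hs₁ hf ⟨r3, r4, r5⟩
    refine (Env.runs_for (T := 70) (by decide) (by decide) hs₁ r3
      (fun i s => s.reg 4 = 2 ^ i ∧ ∀ j < i, s.mem 12 j = 2 ^ j) ?_ ?_ ?_)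
    · simp [State.setReg_reg, r4]
    · rintro i hi s₂ hs₂ hf₂ r6 ⟨r4, hm⟩
      have hpow : 2 ^ i ≤ 2 ^ k := Nat.pow_le_pow_right two_pos (by omega)
      rw [pow_succ] at hP
      refine (Env.runs_flat hs₂ rfl ?_ ?_).weaken (by decide) fun _ _ _ h => h
      · simp [Cmd.Safe, Cmd.den, Expr.eval, r4]
        omega
      · simp only [Cmd.den, Expr.eval, State.setReg_reg, State.setMem_reg, State.setReg_mem,
          State.setMem_mem, r4, r6]
        refine ⟨by simp; ring, fun j hj => ?_⟩
        by_cases hji : j = i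
        · simp [hji]
        · simp [hji, hm j (by omega)]
    · rintro s₂ hs₂ hf₂ ⟨r4, hm⟩
      refine ⟨⟨?_, ?_, ?_, ?_, r4, ?_⟩, fun j hj => hm j (by omega)⟩
      · rw [hf₂.1 0 (by decide), hf.1 0 (by decide), h0]
      · rw [hf₂.1 1 (by decide), hf.1 1 (by decide), h1]
      · rw [hf₂.1 2 (by decide), hf.1 2 (by decide), h2]
      · rw [hf₂.1 3 (by decide), r3]
      · rw [hf₂.1 5 (by decide), r5]
  · have : Cmd.tick (.seq (.assign 3 (.add (.reg 2) (.const 1))) <|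
      .seq (.assign 5 (.add (.reg 0) (.const 1))) (.assign 4 (.const 1))) ≤ 80 := by decide
    omega

/-- Bit `j` of the number `m`. -/
def bit (m j : ℕ) : ℕ := m / 2 ^ j % 2

/-- Register `7` runs through `m / 2 ^ j`; subtracting its half twice leaves its parity. -/
def bitTable : Cmd :=
  .for 6 4 <| .seq (.assign 7 (.reg 6)) <| .for 8 3 <|
    .seq (.store 11 (.addr 6 3 8) (.sub (.sub (.reg 7) (.half (.reg 7))) (.half (.reg 7))))
      (.assign 7 (.half (.reg 7)))

theorem runs_bitTable (hB : Fits n N k E.B) (hs : Bdd E.B s) (hc : Ctx n N k s) :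
    E.Runs bitTable s ((2 ^ (k + 1) + 1) * ((k + 2) * 100 + 31)) fun s' =>
      ∀ m < 2 ^ (k + 1), ∀ j ≤ k, s'.mem 11 (m * (k + 1) + j) = bit m j := by
  have hP := hB.pow
  refine (Env.runs_for (T := 4 + (k + 2) * 100) (by decide) (by decide) hs hc.r4
    (fun i s => ∀ m < i, ∀ j ≤ k, s.mem 11 (m * (k + 1) + j) = bit m j) (by simp) ?_
    fun _ _ _ h => h).weaken (by apply Nat.mul_le_mul_left; omega) fun _ _ _ h => h
  intro m hm s₁ hs₁ hf₁ r6 hI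
  have hc₁ := hc.frame hf₁ (by decide)
  refine Env.Runs.seq (Env.runs_flat hs₁ rfl ?_ (Q := fun s' => s'.reg 6 = m ∧ s'.reg 7 = m ∧
    s'.reg 3 = k + 1 ∧ s'.mem = s₁.mem) ?_) ?_
  · simp [Cmd.Safe, Expr.eval, r6]
    omega
  · simp [Cmd.den, Expr.eval, State.setReg_reg, r6, hc₁.r3]
  · rintro s₂ hs₂ hf₂ ⟨r6, r7, r3, hmem⟩
    refine (Env.runs_for (T := 79) (by decide) (by decide) hs₂ r3
      (fun i s => s.reg 7 = m / 2 ^ i ∧ (∀ j < i, s.mem 11 (m * (k + 1) + j) = bit m j) ∧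
        ∀ m' < m, ∀ j ≤ k, s.mem 11 (m' * (k + 1) + j) = bit m' j) ?_ ?_ ?_)
    · simpa [State.setReg_reg, r7, hmem] using hI
    · rintro j hj s₃ hs₃ hf₃ r8 ⟨r7', h1, h2⟩
      have r6' : s₃.reg 6 = m := (hf₃.1 6 (by decide)).trans r6
      have r3' : s₃.reg 3 = k + 1 := (hf₃.1 3 (by decide)).trans r3
      have hle : m / 2 ^ j ≤ m := Nat.div_le_self _ _
      refine (Env.runs_flat hs₃ rfl ?_ ?_).weaken (by decide) fun _ _ _ h => h
      · simp only [Cmd.Safe, Cmd.den, Expr.eval, State.setMem_reg, r7']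
        omega
      · simp only [Cmd.den, Expr.eval, State.setReg_reg, State.setMem_reg, State.setReg_mem,
          State.setMem_mem, r7', r8, Expr.eval_addr, r6', r3', reduceIte, Nat.reduceEqDiff, true_and]
        refine ⟨by rw [pow_succ, Nat.div_div_eq_div_mul], fun j' hj' => ?_, fun m' hm' j' hj' => ?_⟩
        · rcases (Nat.lt_succ_iff_lt_or_eq.1 hj') with h | rfl
          · rw [if_neg (by omega), h1 j' h]
          · rw [if_pos rfl]
            unfold bit
            omega
        · rw [if_neg (by rw [addr_inj (by omega) hj]; omega), h2 m' hm' j' hj']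
    · rintro s₃ hs₃ hf₃ ⟨-, h1, h2⟩ m' hm' j hj
      rw [State.setReg_mem]
      rcases (Nat.lt_succ_iff_lt_or_eq.1 hm') with h | rfl
      · exact h2 m' h j hj
      · exact h1 j (by omega)

/-- Pascal's rule, row by row. The rows are indexed by numbers of cliques with a common last vertex,
the columns by degrees up to `n`. -/
def binomialTable : Cmd :=
  .for 6 4 <| .for 7 5 <|
    .ite (.reg 7)
      (.ite (.reg 6)
        (.seq (.assign 8 (.sub (.reg 6) (.const 1))) <|
          .seq (.assign 9 (.sub (.reg 7) (.const 1)))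
            (.store 13 (.addr 6 5 7) (.add (.cell 13 8 5 9) (.cell 13 8 5 7))))
        (.store 13 (.addr 6 5 7) (.const 0)))
      (.store 13 (.addr 6 5 7) (.const 1))

/-- For `n ≥ 2` the row index is at most `n * 2 ^ k`; otherwise `n = 1`, `k = 0` and the row index
is at most `1`. -/
theorem Fits.choose_lt {B : ℕ} (h : Fits n N k B) {c d : ℕ} (hc : c < 2 ^ (k + 1)) (hd : d ≤ n) :
    c.choose d < lim B := by
  refine (Nat.choose_le_choose d ?_).trans_lt (h.choose d hd)
  have hn := h.lt
  rcases Nat.lt_or_ge n 2 with h2 | h2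
  · obtain rfl : k = 0 := by omega
    obtain rfl : n = 1 := by omega
    simp at hc ⊢
    omega
  · rw [pow_succ] at hc
    nlinarith [Nat.zero_le (2 ^ k)]

theorem runs_binomialTable (hB : Fits n N k E.B) (hs : Bdd E.B s) (hc : Ctx n N k s) :
    E.Runs binomialTable s ((2 ^ (k + 1) + 1) * ((n + 2) * 150 + 21)) fun s' =>
      ∀ c < 2 ^ (k + 1), ∀ d ≤ n, s'.mem 13 (c * (n + 1) + d) = c.choose d := by
  have hN := hB.node
  have hP := hB.pow
  refine Env.runs_for (T := (n + 2) * 150) (by decide) (by decide) hs hc.r4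
    (fun i s => ∀ c < i, ∀ d ≤ n, s.mem 13 (c * (n + 1) + d) = c.choose d) (by simp) ?_
    fun _ _ _ h => h
  intro c hc' s₁ hs₁ hf₁ r6 hI
  have hc₁ := hc.frame hf₁ (by decide)
  refine (Env.runs_for (T := 129) (by decide) (by decide) hs₁ hc₁.r5
    (fun i s => (∀ d < i, s.mem 13 (c * (n + 1) + d) = c.choose d) ∧
      ∀ c' < c, ∀ d ≤ n, s.mem 13 (c' * (n + 1) + d) = c'.choose d) ?_ ?_ ?_)
  · simpa using hI
  · rintro d hd s₂ hs₂ hf₂ r7 ⟨h1, h2⟩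
    have r6' : s₂.reg 6 = c := (hf₂.1 6 (by decide)).trans r6
    have hc₂ := hc₁.frame hf₂ (by decide)
    have hlim : c.choose d < lim E.B := hB.choose_lt hc' (by omega)
    have key : ∀ s' : State, s'.mem 13 = (s₂.setMem 13 (c * (n + 1) + d) (c.choose d)).mem 13 →
        (∀ d' < d + 1, s'.mem 13 (c * (n + 1) + d') = c.choose d') ∧
        ∀ c' < c, ∀ d' ≤ n, s'.mem 13 (c' * (n + 1) + d') = c'.choose d' := by
      intro s' hs'
      rw [hs']
      refine ⟨fun d' hd' => ?_, fun c' hc' d' hd' => ?_⟩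
      · rw [State.setMem_mem]
        rcases (Nat.lt_succ_iff_lt_or_eq.1 hd') with h | rfl
        · rw [if_neg (by omega), h1 d' h]
        · rw [if_pos ⟨rfl, rfl⟩]
      · rw [State.setMem_mem, if_neg (by rw [addr_inj (by omega) hd]; omega), h2 c' hc' d' hd']
    refine (Env.runs_flat hs₂ rfl ?_ (key _ ?_)).weaken (by decide) fun _ _ _ h => h
    · simp only [Cmd.Safe, Cmd.den, Expr.eval, r7, r6']
      cases d with
      | zero => simp; omega
      | succ d =>
          cases c with
          | zero => simp; omega
          | succ c =>
              rw [Nat.choose_succ_succ, ← h2 c (by omega) d (by omega),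
                ← h2 c (by omega) (d + 1) (by omega)] at hlim
              simp [State.setReg_reg, r7, hc₂.r5, hlim]
              omega
    · simp only [Cmd.den, Expr.eval, r7, r6']
      cases d with
      | zero => simp [r6', r7, hc₂.r5]
      | succ d =>
          cases c with
          | zero => simp [r6', r7, hc₂.r5]
          | succ c =>
              simp [State.setReg_reg, r7, r6', hc₂.r5, Nat.choose_succ_succ,
                ← h2 c (by omega) d (by omega), ← h2 c (by omega) (d + 1) (by omega), State.setMem]
  · rintro s₂ hs₂ hf₂ ⟨h1, h2⟩ c' hc' d hd
    rw [State.setReg_mem]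
    rcases (Nat.lt_succ_iff_lt_or_eq.1 hc') with h | rfl
    · exact h2 c' h d hd
    · exact h1 d (by omega)

end RAM

/-! ### Elimination orderings from tree decompositions -/

/-- An ordering of the nodes of a tree decomposition in which each node but the first is adjacent to
an earlier one. -/
structure NodeOrder {V : Type*} {G : SimpleGraph V} {N : ℕ} (D : TreeDecomposition G (Fin N))
    (o : ℕ → Fin N) : Prop where
  inj : ∀ a < N, ∀ b < N, o a = o b → a = b
  surj : ∀ x, ∃ a < N, o a = x
  parent : ∀ a < N, 0 < a → ∃ b < a, D.tree.Adj (o b) (o a)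

namespace NodeOrder

section

variable {V : Type*} {G : SimpleGraph V} {N : ℕ} {D : TreeDecomposition G (Fin N)} {o : ℕ → Fin N}
  (h : NodeOrder D o)

include h

/-- Following parents leads back to the first node through earlier nodes only. -/
theorem exists_walk {a : ℕ} (ha : a < N) :
    ∃ p : D.tree.Walk (o a) (o 0), ∀ x ∈ p.support, ∃ b ≤ a, o b = x := by
  induction a using Nat.strong_induction_on with
  | _ a ih =>
      rcases Nat.eq_zero_or_pos a with rfl | h0
      · exact ⟨.nil, fun x hx => ⟨0, le_rfl, by simpa [eq_comm] using hx⟩⟩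
      · obtain ⟨b, hb, hadj⟩ := h.parent a ha h0
        obtain ⟨p, hp⟩ := ih b hb (hb.trans ha)
        refine ⟨.cons hadj.symm p, fun x hx => ?_⟩
        rw [SimpleGraph.Walk.support_cons, List.mem_cons] at hx
        rcases hx with rfl | hx
        · exact ⟨a, le_rfl, rfl⟩
        · obtain ⟨c, hc, hcx⟩ := hp x hx
          exact ⟨c, hc.trans hb.le, hcx⟩

/-- The tree path from `o a` to an earlier node starts with the edge to the parent `o b`: from `o b`
one can go on through nodes earlier than `o a`. A vertex in both end bags is therefore in the bag of
the parent. -/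
theorem exists_parent {a : ℕ} (ha : a < N) (h0 : 0 < a) :
    ∃ b < a, ∀ v c, c < a → v ∈ D.bag (o a) → v ∈ D.bag (o c) → v ∈ D.bag (o b) := by
  classical
  obtain ⟨b, hb, hadj⟩ := h.parent a ha h0
  refine ⟨b, hb, fun v c hc hva hvc => ?_⟩
  obtain ⟨p, hp⟩ := h.exists_walk (hb.trans ha)
  obtain ⟨q, hq⟩ := h.exists_walk (hc.trans ha)
  have hsupp : ∀ x ∈ (p.append q.reverse).bypass.support, ∃ b < a, o b = x := by
    intro x hx
    have hx := SimpleGraph.Walk.support_bypass_subset_support _ hx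
    rw [SimpleGraph.Walk.mem_support_append_iff, SimpleGraph.Walk.support_reverse,
      List.mem_reverse] at hx
    rcases hx with hx | hx
    · obtain ⟨d, hd, hdx⟩ := hp x hx
      exact ⟨d, hd.trans_lt hb, hdx⟩
    · obtain ⟨d, hd, hdx⟩ := hq x hx
      exact ⟨d, hd.trans_lt hc, hdx⟩
  -- All nodes after the first edge have index below `a`, so `o a` does not recur.
  have hpath : (SimpleGraph.Walk.cons hadj.symm (p.append q.reverse).bypass).IsPath := by
    rw [SimpleGraph.Walk.cons_isPath_iff]
    refine ⟨SimpleGraph.Walk.bypass_isPath _, fun hmem => ?_⟩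
    obtain ⟨d, hd, hda⟩ := hsupp _ hmem
    have := h.inj d (hd.trans ha) a ha hda
    omega
  refine D.mem_of_path v _ _ _ hpath hva hvc _ ?_
  rw [SimpleGraph.Walk.support_cons]
  exact List.mem_cons_of_mem _ (SimpleGraph.Walk.start_mem_support _)

/-- The running intersection property. -/
theorem mem_bag_of_mem {u w : V} {i a j : ℕ} (hj : j < N) (hia : i ≤ a) (haj : a ≤ j)
    (hu : u ∈ D.bag (o a)) (hu' : ∀ b < a, u ∉ D.bag (o b)) (huj : u ∈ D.bag (o j))
    (hw : w ∈ D.bag (o i)) (hwj : w ∈ D.bag (o j)) : w ∈ D.bag (o a) := by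
  induction j using Nat.strong_induction_on with
  | _ j ih =>
      rcases haj.eq_or_lt with rfl | hlt
      · exact hwj
      -- Both `u` and `w` occur in a bag before `o j`, so both pass to the bag of the parent of `o
      -- j`. As `u` occurs in no bag before `a`, that parent has index at least `a`, and the descent
      -- continues until it stops at `a`.
      · obtain ⟨b, hb, hpar⟩ := h.exists_parent hj (by omega)
        have hub := hpar u a hlt huj hu
        refine ih b hb (hb.trans hj) ?_ hub (hpar w i (by omega) hwj hw)
        by_contra hab
        exact hu' b (by omega) hub

theorem exists_mem_bag (v : V) : ∃ a, a < N ∧ v ∈ D.bag (o a) := by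
  obtain ⟨x, hx⟩ := D.vertex_mem v
  obtain ⟨a, ha, rfl⟩ := h.surj x
  exact ⟨a, ha, hx⟩

end

/-! ### The vertex order induced by an order of the nodes -/

variable {n N : ℕ} {G : SimpleGraph (Fin n)} {D : TreeDecomposition G (Fin N)} {o : ℕ → Fin N}
  (h : NodeOrder D o)

open Classical in
/-- The index of the first node whose bag contains the vertex. -/
noncomputable def top (v : Fin n) : ℕ := Nat.find (h.exists_mem_bag v)

theorem top_lt (v : Fin n) : h.top v < N := by
  classical exact (Nat.find_spec (h.exists_mem_bag v)).1

theorem mem_bag_top (v : Fin n) : v ∈ D.bag (o (h.top v)) := by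
  classical exact (Nat.find_spec (h.exists_mem_bag v)).2

theorem top_le {v : Fin n} {a : ℕ} (ha : a < N) (hv : v ∈ D.bag (o a)) : h.top v ≤ a := by
  classical exact Nat.find_min' _ ⟨ha, hv⟩

theorem notMem_bag {v : Fin n} {a : ℕ} (ha : a < h.top v) : v ∉ D.bag (o a) := fun hv => by
  have := h.top_le (ha.trans (h.top_lt v)) hv
  omega

/-- Lexicographic order by first bag and then by number: the order in which a scan of the bags meets
the vertices for the first time. -/
noncomputable def key (v : Fin n) : ℕ := h.top v * n + v

theorem key_inj {u v : Fin n} : h.key u = h.key v ↔ u = v := by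
  rw [key, key, RAM.addr_inj u.2 v.2, Fin.ext_iff]
  constructor
  · exact fun h => h.2
  · intro huv
    obtain rfl := Fin.ext huv
    simp

theorem top_le_of_key_lt {u v : Fin n} (huv : h.key u < h.key v) : h.top u ≤ h.top v := by
  by_contra hlt
  have h1 : (h.top v + 1) * n ≤ h.top u * n := Nat.mul_le_mul_right _ (by omega)
  have h2 := v.2
  simp only [key] at huv
  rw [Nat.add_mul] at h1
  omega

theorem key_lt_iff {v : Fin n} {a i : ℕ} (hi : i ≤ n) :
    h.key v < a * n + i ↔ h.top v < a ∨ h.top v = a ∧ v.1 < i := by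
  have h2 := v.2
  simp only [key]
  rcases lt_trichotomy (h.top v) a with hlt | heq | hgt
  · have h1 : (h.top v + 1) * n ≤ a * n := Nat.mul_le_mul_right _ (by omega)
    rw [Nat.add_mul] at h1
    simp only [hlt, true_or, iff_true]
    omega
  · simp [heq]
  · have h1 : (a + 1) * n ≤ h.top v * n := Nat.mul_le_mul_right _ (by omega)
    rw [Nat.add_mul] at h1
    constructor <;> intro <;> omega

noncomputable def before (t : ℕ) : Finset (Fin n) := Finset.univ.filter fun u => h.key u < t

theorem mem_before {t : ℕ} {u : Fin n} : u ∈ h.before t ↔ h.key u < t := by simp [before]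

/-- These need not be neighbours in `G`; the whole earlier part of the first bag is kept, so that
the sets nest along parents. -/
noncomputable def nbr (v : Fin n) : Finset (Fin n) :=
  (D.bag (o (h.top v))).filter fun u => h.key u < h.key v

theorem mem_nbr {u v : Fin n} : u ∈ h.nbr v ↔ u ∈ D.bag (o (h.top v)) ∧ h.key u < h.key v := by
  simp [nbr]

noncomputable def rank (v : Fin n) : ℕ := (h.before (h.key v)).card

theorem rank_lt_rank {u v : Fin n} (huv : h.key u < h.key v) : h.rank u < h.rank v := by
  refine Finset.card_lt_card (Finset.ssubset_iff_of_subset ?_ |>.2 ⟨u, ?_, ?_⟩)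
  · intro w hw
    rw [mem_before] at *
    omega
  · rwa [mem_before]
  · rw [mem_before]
    omega

theorem rank_lt_iff {u v : Fin n} : h.rank u < h.rank v ↔ h.key u < h.key v := by
  refine ⟨fun hlt => ?_, h.rank_lt_rank⟩
  by_contra hge
  rcases (not_lt.1 hge).eq_or_lt with he | hl
  · obtain rfl := (h.key_inj).1 he
    exact lt_irrefl _ hlt
  · exact lt_asymm hlt (h.rank_lt_rank hl)

theorem rank_injective : Function.Injective h.rank := by
  intro u v huv
  by_contra hne
  rcases lt_or_gt_of_ne fun hk => hne ((h.key_inj).1 hk) with hk | hk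
  · exact (h.rank_lt_rank hk).ne huv
  · exact (h.rank_lt_rank hk).ne huv.symm

theorem rank_lt (v : Fin n) : h.rank v < n := by
  have : (h.before (h.key v)).card < (Finset.univ : Finset (Fin n)).card :=
    Finset.card_lt_card (Finset.ssubset_iff_of_subset (Finset.subset_univ _) |>.2
      ⟨v, Finset.mem_univ v, by simp [mem_before]⟩)
  rwa [Finset.card_univ, Fintype.card_fin] at this

open Classical in
noncomputable def par (v : Fin n) : Option (Fin n) :=
  if hv : (h.nbr v).Nonempty then some ((h.nbr v).exists_max_image h.rank hv).choose else none

theorem par_mem {v p : Fin n} (hp : h.par v = some p) :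
    p ∈ h.nbr v ∧ ∀ u ∈ h.nbr v, h.rank u ≤ h.rank p := by
  unfold par at hp
  split_ifs at hp with hv
  obtain rfl := Option.some_injective _ hp
  exact ((h.nbr v).exists_max_image h.rank hv).choose_spec

theorem par_eq {v p : Fin n} (hp : p ∈ h.nbr v) (hmax : ∀ u ∈ h.nbr v, h.rank u ≤ h.rank p) :
    h.par v = some p := by
  cases hq : h.par v with
  | none =>
      unfold par at hq
      rw [dif_pos ⟨p, hp⟩] at hq
      cases hq
  | some q =>
      obtain ⟨h1, h2⟩ := h.par_mem hq
      rw [h.rank_injective (le_antisymm (h2 p hp) (hmax q h1))]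

theorem par_eq_none {v : Fin n} : h.par v = none ↔ h.nbr v = ∅ := by
  unfold par
  split_ifs with hv
  · simp [hv.ne_empty]
  · simpa using hv

/-- The elimination ordering in which the vertices of the first bag come first, then the remaining
vertices of the second bag, and so on. -/
noncomputable def elimination : Elimination G where
  rank := h.rank
  nbr := h.nbr
  par := h.par
  rank_injective := h.rank_injective
  rank_lt hu := h.rank_lt_rank (h.mem_nbr.1 hu).2
  mem_nbr {u v} huv hlt := by
    have hk := h.rank_lt_iff.1 hlt
    refine h.mem_nbr.2 ⟨?_, hk⟩
    -- A bag contains both ends of the edge, and `u` enters no later than `v`; the running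
    -- intersection property puts `u` into the first bag of `v`.
    obtain ⟨x, hux, hvx⟩ := D.edge_mem u v huv
    obtain ⟨j, hj, rfl⟩ := h.surj x
    exact h.mem_bag_of_mem hj (h.top_le_of_key_lt hk) (h.top_le hj hvx) (h.mem_bag_top v)
      (fun b hb => h.notMem_bag hb) hvx (h.mem_bag_top u) hux
  par_none := h.par_eq_none.1
  par_mem hp := (h.par_mem hp).1
  nbr_subset {v p} hp u hu := by
    obtain ⟨hpv, hmax⟩ := h.par_mem hp
    by_cases hup : u = p
    · simp [hup]
    · refine Finset.mem_insert_of_mem (h.mem_nbr.2 ?_)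
      -- The parent `p` is the last vertex of `nbr v`, so any other `u` in `nbr v` precedes it. Both
      -- lie in the first bag of `v`, hence `u` is already in the first bag of `p`.
      have hk : h.key u < h.key p :=
        h.rank_lt_iff.1 (lt_of_le_of_ne (hmax u hu) fun he => hup (h.rank_injective he))
      refine ⟨?_, hk⟩
      obtain ⟨hpb, hpk⟩ := h.mem_nbr.1 hpv
      exact h.mem_bag_of_mem (h.top_lt v) (h.top_le_of_key_lt hk) (h.top_le_of_key_lt hpk)
        (h.mem_bag_top p) (fun b hb => h.notMem_bag hb) hpb (h.mem_bag_top u) (h.mem_nbr.1 hu).1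

theorem card_nbr_le {k : ℕ} (hk : D.HasWidth k) (v : Fin n) : (h.nbr v).card ≤ k := by
  have h1 : insert v (h.nbr v) ⊆ D.bag (o (h.top v)) := by
    intro u hu
    rcases Finset.mem_insert.1 hu with rfl | hu
    · exact h.mem_bag_top u
    · exact (h.mem_nbr.1 hu).1
  have h2 := (Finset.card_le_card h1).trans (hk.1 _)
  rw [Finset.card_insert_of_notMem (by simp [mem_nbr])] at h2
  omega

end NodeOrder

/-! ### Traversal of the tree -/

namespace RAM

/-- The input in the memory. -/
structure Input {n N : ℕ} (G : SimpleGraph (Fin n)) (D : TreeDecomposition G (Fin N))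
    (s : State) : Prop where
  adj : ∀ u v : Fin n, s.mem 0 (u * n + v) ≠ 0 ↔ G.Adj u v
  tree : ∀ x y : Fin N, s.mem 1 (x * N + y) ≠ 0 ↔ D.tree.Adj x y
  bag : ∀ (x : Fin N) (v : Fin n), s.mem 2 (x * n + v) ≠ 0 ↔ v ∈ D.bag x

theorem Input.frame {n N : ℕ} {G : SimpleGraph (Fin n)} {D : TreeDecomposition G (Fin N)}
    {p : Cmd} {s s' : State} (h : Input G D s) (hf : Frame p s s')
    (hp : ∀ x ∈ [0, 1, 2], x ∉ p.warr) : Input G D s' := by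
  constructor
  · rw [hf.2 0 (hp 0 (by decide))]; exact h.adj
  · rw [hf.2 1 (hp 1 (by decide))]; exact h.tree
  · rw [hf.2 2 (hp 2 (by decide))]; exact h.bag

/-- The state of the traversal of a graph with adjacency relation `A` after the neighbours of the
first `i` nodes have been visited. -/
structure Traversal {N : ℕ} (A : Fin N → Fin N → Prop) (i cnt : ℕ) (ord vis : ℕ → ℕ) : Prop where
  pos : 0 < cnt
  ord_zero : ord 0 = 0
  ord_lt : ∀ a < cnt, ord a < N
  vis_ord : ∀ a < cnt, vis (ord a) ≠ 0
  surj : ∀ y < N, vis y ≠ 0 → ∃ a < cnt, ord a = y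
  inj : ∀ a < cnt, ∀ b < cnt, ord a = ord b → a = b
  parent : ∀ a < cnt, 0 < a → ∃ b < a, ∃ x y : Fin N, ord b = x ∧ ord a = y ∧ A x y
  nbr : ∀ a < cnt, a < i → ∀ x y : Fin N, ord a = x → A x y → vis y ≠ 0
  ord_eq : ∀ a, cnt ≤ a → ord a = 0

namespace Traversal

variable {N : ℕ} {A : Fin N → Fin N → Prop} {i cnt : ℕ} {ord vis : ℕ → ℕ}

theorem cnt_le (h : Traversal A i cnt ord vis) : cnt ≤ N := by
  have := Finset.card_le_card_of_injOn (s := Finset.range cnt) (t := Finset.range N) ord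
    (fun a ha => by simpa using h.ord_lt a (by simpa using ha))
    (fun a ha b hb hab => h.inj a (by simpa using ha) b (by simpa using hb) hab)
  simpa using this

theorem visit (h : Traversal A i cnt ord vis) (hi : i < cnt) {x y : Fin N} (hx : ord i = x)
    (hA : A x y) (hy : vis y = 0) :
    Traversal A i (cnt + 1) (Function.update ord cnt y) (Function.update vis y 1) := by
  have hne : ∀ a < cnt, a ≠ cnt := fun a ha => ha.ne
  have hvis : ∀ z, vis z ≠ 0 → Function.update vis y 1 z ≠ 0 := by
    intro z hz
    by_cases hzy : z = y
    · simp [hzy]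
    · simpa [hzy] using hz
  constructor
  · omega
  · rw [Function.update_of_ne h.pos.ne, h.ord_zero]
  · intro a ha
    rcases Nat.lt_succ_iff_lt_or_eq.1 ha with ha | rfl
    · rw [Function.update_of_ne ha.ne]; exact h.ord_lt a ha
    · rw [Function.update_self]; exact y.2
  · intro a ha
    rcases Nat.lt_succ_iff_lt_or_eq.1 ha with ha | rfl
    · rw [Function.update_of_ne ha.ne]; exact hvis _ (h.vis_ord a ha)
    · simp
  · intro z hz hvz
    by_cases hzy : z = y
    · exact ⟨cnt, by omega, by simp [hzy]⟩
    · rw [Function.update_of_ne hzy] at hvz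
      obtain ⟨a, ha, haz⟩ := h.surj z hz hvz
      exact ⟨a, by omega, by rw [Function.update_of_ne ha.ne, haz]⟩
  · intro a ha b hb hab
    have hnew : ∀ a < cnt, ord a ≠ y := fun a ha he => h.vis_ord a ha (by rw [he, hy])
    rcases Nat.lt_succ_iff_lt_or_eq.1 ha with ha | rfl <;>
      rcases Nat.lt_succ_iff_lt_or_eq.1 hb with hb | rfl
    · rw [Function.update_of_ne ha.ne, Function.update_of_ne hb.ne] at hab
      exact h.inj a ha b hb hab
    · rw [Function.update_of_ne ha.ne, Function.update_self] at hab
      exact absurd hab (hnew a ha)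
    · rw [Function.update_of_ne hb.ne, Function.update_self] at hab
      exact absurd hab.symm (hnew b hb)
    · rfl
  · intro a ha h0
    rcases Nat.lt_succ_iff_lt_or_eq.1 ha with ha | rfl
    · obtain ⟨b, hb, hA'⟩ := h.parent a ha h0
      exact ⟨b, hb, by rwa [Function.update_of_ne ha.ne, Function.update_of_ne (by omega)]⟩
    · exact ⟨i, hi, x, y, by rw [Function.update_of_ne hi.ne, hx], by simp, hA⟩
  · intro a ha hai x' y' hx' hA'
    rw [Function.update_of_ne (by omega)] at hx'
    exact hvis _ (h.nbr a (by omega) hai x' y' hx' hA')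
  · intro a ha
    rw [Function.update_of_ne (by omega)]
    exact h.ord_eq a (by omega)

/-- The visited set contains node `0` and is closed under adjacency, so it is everything by
connectedness, and the queue without repetitions has exactly `N` entries. -/
theorem exists_nodeOrder {n : ℕ} {G : SimpleGraph (Fin n)} {D : TreeDecomposition G (Fin N)}
    (h : Traversal D.tree.Adj N cnt ord vis) :
    ∃ o : ℕ → Fin N, NodeOrder D o ∧ ∀ a < N, ord a = o a := by
  have hN : 0 < N := (Nat.zero_le _).trans_lt (h.ord_lt 0 h.pos)
  have hall : ∀ y : Fin N, vis y ≠ 0 := by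
    have h0 : vis (⟨0, hN⟩ : Fin N) ≠ 0 := by
      have := h.vis_ord 0 h.pos
      rwa [h.ord_zero] at this
    have hcl : ∀ x y : Fin N, D.tree.Adj x y → vis x ≠ 0 → vis y ≠ 0 := by
      intro x y hA hx
      obtain ⟨a, ha, hax⟩ := h.surj x x.2 hx
      exact h.nbr a ha (ha.trans_le h.cnt_le) x y hax hA
    have hw : ∀ x y : Fin N, D.tree.Walk x y → vis x ≠ 0 → vis y ≠ 0 := by
      intro x y p hx
      induction p with
      | nil => exact hx
      | cons hA p ih => exact ih (hcl _ _ hA hx)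
    intro y
    obtain ⟨p⟩ := D.isTree.connected.preconnected ⟨0, hN⟩ y
    exact hw _ _ p h0
  have hcnt : cnt = N := by
    refine le_antisymm h.cnt_le ?_
    have := Finset.card_le_card_of_surjOn (s := Finset.range cnt) (t := Finset.range N) ord
      (fun y hy => by
        obtain ⟨a, ha, hay⟩ := h.surj y (by simpa using hy) (hall ⟨y, by simpa using hy⟩)
        exact ⟨a, by simpa using ha, hay⟩)
    simpa using this
  subst hcnt
  have ho : ∀ a < cnt, ord a = ((fun a => if ha : ord a < cnt then (⟨ord a, ha⟩ : Fin cnt) else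
      ⟨0, hN⟩) a : ℕ) := fun a ha => by simp [h.ord_lt a ha]
  refine ⟨_, ⟨fun a ha b hb hab => ?_, fun x => ?_, fun a ha h0 => ?_⟩, ho⟩
  · exact h.inj a ha b hb ((ho a ha).trans ((congrArg Fin.val hab).trans (ho b hb).symm))
  · obtain ⟨a, ha, hax⟩ := h.surj x x.2 (hall x)
    exact ⟨a, ha, Fin.ext ((ho a ha).symm.trans hax)⟩
  · obtain ⟨b, hb, x, y, hbx, hay, hA⟩ := h.parent a ha h0
    refine ⟨b, hb, ?_⟩
    convert hA
    · exact Fin.ext ((ho b (hb.trans ha)).symm.trans hbx)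
    · exact Fin.ext ((ho a ha).symm.trans hay)

end Traversal

/-- Visit the neighbours of the node in register `7`. -/
def visitNeighbours : Cmd :=
  .for 8 1 <| .ite (.cell 1 7 1 8)
    (.ite (.load 4 (.reg 8)) .skip
      (.seq (.store 4 (.reg 8) (.const 1)) <| .seq (.store 5 (.reg 10) (.reg 8))
        (.assign 10 (.add (.reg 10) (.const 1)))))
    .skip

def traverse : Cmd :=
  .seq (.seq (.store 4 (.const 0) (.const 1)) (.assign 10 (.const 1)))
    (.for 6 1 (.seq (.assign 7 (.load 5 (.reg 6))) visitNeighbours))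

variable {E : Env} {n N k : ℕ} {s : State} {G : SimpleGraph (Fin n)}
  {D : TreeDecomposition G (Fin N)}

theorem runs_visitNeighbours (hB : Fits n N k E.B) (hs : Bdd E.B s) (hc : Ctx n N k s)
    (hin : Input G D s) {i : ℕ} (h7 : s.reg 7 = s.mem 5 i)
    (hI : Traversal D.tree.Adj i (s.reg 10) (s.mem 5) (s.mem 4)) :
    E.Runs visitNeighbours s ((N + 1) * 121) fun s' =>
      Traversal D.tree.Adj (i + 1) (s'.reg 10) (s'.mem 5) (s'.mem 4) := by
  have hN := hB.node
  obtain ⟨x, hx⟩ : ∃ x : Fin N, s.reg 7 = x := by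
    have h0 := hI.ord_lt 0 hI.pos
    rcases lt_or_ge i (s.reg 10) with hi | hi
    · exact ⟨⟨s.mem 5 i, hI.ord_lt i hi⟩, h7⟩
    -- Beyond the end of the queue the cells hold `0`, so node `0` is inspected again. This has no
    -- effect, since its neighbours are then already visited; the third clause of the invariant
    -- below records that.
    · exact ⟨⟨s.mem 5 0, h0⟩, by rw [h7, hI.ord_eq i hi]; exact hI.ord_zero.symm⟩
  refine Env.runs_for (T := 100) (by decide) (by decide) hs hc.r1
    (fun j s' => Traversal D.tree.Adj i (s'.reg 10) (s'.mem 5) (s'.mem 4) ∧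
      (i < s'.reg 10 → s'.mem 5 i = x) ∧
      (s'.reg 10 ≤ i → ∀ y, D.tree.Adj x y → s'.mem 4 y ≠ 0) ∧
      ∀ y : Fin N, y < j → D.tree.Adj x y → s'.mem 4 y ≠ 0) ?_ ?_ ?_
  · refine ⟨hI, fun _ => by rw [State.setReg_mem, ← h7, hx], fun hi y hA => ?_, by simp⟩
    have hi : s.reg 10 ≤ i := hi
    refine hI.nbr 0 hI.pos (hI.pos.trans_le hi) x y ?_ hA
    rw [hI.ord_zero, ← hI.ord_eq i hi, ← h7, hx]
  · rintro j hj s₁ hs₁ hf r8 ⟨h1, h2, h3, h4⟩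
    have hc₁ := hc.frame hf (by decide)
    have hin₁ := hin.frame hf (by decide)
    have r7 : s₁.reg 7 = x := (hf.1 7 (by decide)).trans hx
    have hcnt := h1.cnt_le
    have hadj := hin₁.tree x ⟨j, hj⟩
    simp only at hadj
    refine (Env.runs_flat hs₁ rfl ?_ ?_).weaken (by decide) fun _ _ _ h => h
    · simp [Cmd.Safe, Cmd.den, Expr.eval, r8]
      intros
      omega
    · have hcell : (Expr.cell 1 7 1 8).eval s₁ = s₁.mem 1 (x * N + j) := by
        rw [Expr.eval_cell, r7, hc₁.r1, r8]
      have hload : (Expr.load 4 (.reg 8)).eval s₁ = s₁.mem 4 j := by simp [Expr.eval, r8]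
      simp only [Cmd.den, hcell, hload]
      by_cases hA : D.tree.Adj x ⟨j, hj⟩
      · by_cases hv : s₁.mem 4 j = 0
        · have hi : i < s₁.reg 10 := by
            by_contra hi
            exact h3 (by omega) _ hA hv
          have hvis := h1.visit hi (h2 hi) hA hv
          rw [if_pos (hadj.2 hA), if_neg (not_not.2 hv)]
          simp [Expr.eval, r8, State.setReg, State.setMem]
          refine ⟨hvis, fun _ => ?_, fun h => absurd h (by omega), fun y hy hAy => ?_⟩
          · rw [Function.update_of_ne hi.ne, h2 hi]
          · by_cases hyj : (y : ℕ) = j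
            · simp [hyj]
            · rw [Function.update_of_ne hyj]
              exact h4 y (by omega) hAy
        · rw [if_pos (hadj.2 hA), if_pos hv]
          refine ⟨h1, h2, h3, fun y hy hAy => ?_⟩
          rcases Nat.lt_succ_iff_lt_or_eq.1 hy with h | rfl
          · exact h4 y h hAy
          · exact hv
      · rw [if_neg fun h => hA (hadj.1 h)]
        refine ⟨h1, h2, h3, fun y hy hAy => ?_⟩
        rcases Nat.lt_succ_iff_lt_or_eq.1 hy with h | rfl
        · exact h4 y h hAy
        · exact absurd hAy hA
  · rintro s₁ hs₁ hf ⟨h1, h2, h3, h4⟩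
    refine { h1 with nbr := fun a ha hai x' y hx' hA => ?_ }
    rcases Nat.lt_succ_iff_lt_or_eq.1 hai with h | rfl
    · exact h1.nbr a ha h x' y hx' hA
    · have : x' = x := Fin.ext (by rw [← hx', h2 ha])
      subst this
      exact h4 y y.2 hA

theorem runs_traverse (hB : Fits n N k E.B) (hs : Bdd E.B s) (hc : Ctx n N k s)
    (hin : Input G D s) (h4 : ∀ i, s.mem 4 i = 0) (h5 : ∀ i, s.mem 5 i = 0) :
    E.Runs traverse s ((N + 2) * ((N + 2) * 150)) fun s' =>
      ∃ o : ℕ → Fin N, NodeOrder D o ∧ ∀ a < N, s'.mem 5 a = o a := by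
  have hN := hB.node
  have hN0 : 0 < N := by
    obtain ⟨x⟩ := D.isTree.connected.nonempty
    exact (Nat.zero_le _).trans_lt x.2
  refine (Env.Runs.seq (Env.runs_flat hs rfl ?_ (Q := fun s' =>
    Traversal D.tree.Adj 0 (s'.reg 10) (s'.mem 5) (s'.mem 4)) ?_) ?_
      (T₂ := (N + 1) * ((9 + (N + 1) * 121) + 21))).weaken ?_ fun _ _ _ h => h
  · simp [Cmd.Safe, Expr.eval]
    omega
  · have hm : (s.setMem 4 0 1).mem 4 = Function.update (fun _ => 0) 0 1 := by
      funext i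
      rw [State.setMem_mem, h4]
      by_cases hi : i = 0 <;> simp [hi]
    have hm' : (s.setMem 4 0 1).mem 5 = fun _ => 0 := by
      funext i
      rw [State.setMem_mem, h5]
      simp
    simp only [Cmd.den, Expr.eval, State.setReg_reg_self, State.setReg_mem, hm, hm']
    constructor
    · omega
    · rfl
    · exact fun _ _ => hN0
    · simp
    · intro y _ hy
      refine ⟨0, by omega, ?_⟩
      by_contra hne
      exact hy (by rw [Function.update_of_ne (Ne.symm hne)])
    · intros; omega
    · intros; omega
    · intros; omega
    · intros; rfl
  · rintro s₁ hs₁ hf₁ hI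
    have hc₁ := hc.frame hf₁ (by decide)
    have hin₁ := hin.frame hf₁ (by decide)
    refine Env.runs_for (by decide) (by decide) hs₁ hc₁.r1
      (fun i s' => Traversal D.tree.Adj i (s'.reg 10) (s'.mem 5) (s'.mem 4)) hI ?_ ?_
    · rintro i hi s₂ hs₂ hf₂ r6 hI₂
      have hc₂ := hc₁.frame hf₂ (by decide)
      have hin₂ := hin₁.frame hf₂ (by decide)
      refine (Env.Runs.seq (Env.runs_flat hs₂ rfl ?_ (Q := fun s' => s'.reg 7 = s₂.mem 5 i ∧
        s'.reg 10 = s₂.reg 10 ∧ s'.mem = s₂.mem) ?_) ?_ (T₂ := (N + 1) * 121)).weaken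
          (Nat.add_le_add_right (by decide) _) fun _ _ _ h => h
      · exact hs₂.mem_lt _ _
      · simp [Cmd.den, Expr.eval, State.setReg_reg, r6]
      · rintro s₃ hs₃ hf₃ ⟨r7, r10, hm⟩
        refine (runs_visitNeighbours hB hs₃ (hc₂.frame hf₃ (by decide))
          (hin₂.frame hf₃ (by decide)) (i := i) (by rw [r7, hm]) (by rwa [r10, hm])).weaken le_rfl
          fun s' _ _ h => ?_
        exact h
    · exact fun s' _ _ h => h.exists_nodeOrder
  · have : Cmd.tick (.seq (.store 4 (.const 0) (.const 1)) (.assign 10 (.const 1))) ≤ 20 := by decide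
    nlinarith

end RAM

/-! ### Elimination ordering and colouring of the vertices -/

namespace RAM

/-- The number that stands for an optional vertex. -/
def code {n : ℕ} : Option (Fin n) → ℕ
  | none => 0
  | some v => v + 1

/-- The vertices with key less than `t` have been introduced: ranks, colours, the vertices of each
colour, parents, and the elimination sequence are stored in the arrays `6` to `10`. -/
structure Introduced {n N : ℕ} {G : SimpleGraph (Fin n)} {D : TreeDecomposition G (Fin N)}
    {o : ℕ → Fin N} (h : NodeOrder D o) (k t : ℕ) (s : State) : Prop where
  count : s.reg 20 = (h.before t).card
  rank : ∀ u, h.key u < t → s.mem 6 u = h.rank u + 1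
  rank_zero : ∀ u, t ≤ h.key u → s.mem 6 u = 0
  col_le : ∀ u, h.key u < t → s.mem 7 u ≤ k
  col_inj : ∀ u, h.key u < t → ∀ w ∈ insert u (h.nbr u), ∀ w' ∈ insert u (h.nbr u),
    s.mem 7 w = s.mem 7 w' → w = w'
  slot : ∀ u, h.key u < t → ∀ w ∈ insert u (h.nbr u),
    s.mem 8 (u * (k + 1) + s.mem 7 w) = w + 1
  slot_ne : ∀ u, h.key u < t → ∀ c ≤ k, s.mem 8 (u * (k + 1) + c) ≠ 0 →
    ∃ w ∈ insert u (h.nbr u), s.mem 7 w = c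
  slot_zero : ∀ u, t ≤ h.key u → ∀ c ≤ k, s.mem 8 (u * (k + 1) + c) = 0
  par : ∀ u, h.key u < t → s.mem 9 u = code (h.par u)
  seq : ∀ u, h.key u < t → s.mem 10 (h.rank u) = u

namespace Introduced

variable {n N k t : ℕ} {G : SimpleGraph (Fin n)} {D : TreeDecomposition G (Fin N)}
  {o : ℕ → Fin N} {h : NodeOrder D o} {s s' : State}

theorem congr (hI : Introduced h k t s) (hr : s'.reg 20 = s.reg 20)
    (hm : ∀ A ∈ [6, 7, 8, 9, 10], s'.mem A = s.mem A) : Introduced h k t s' := by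
  have h6 := hm 6 (by decide)
  have h7 := hm 7 (by decide)
  have h8 := hm 8 (by decide)
  have h9 := hm 9 (by decide)
  have h10 := hm 10 (by decide)
  obtain ⟨a1, a2, a3, a4, a5, a6, a7, a8, a9, a10⟩ := hI
  constructor <;> simp only [hr, h6, h7, h8, h9, h10] <;> assumption

theorem frame {p : Cmd} (hI : Introduced h k t s) (hf : Frame p s s') (hr : 20 ∉ p.wreg)
    (hm : ∀ A ∈ [6, 7, 8, 9, 10], A ∉ p.warr) : Introduced h k t s' :=
  hI.congr (hf.1 20 hr) fun A hA => hf.2 A (hm A hA)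

theorem mono (hI : Introduced h k t s) (ht : ∀ u, h.key u ≠ t) : Introduced h k (t + 1) s := by
  have hlt : ∀ u, h.key u < t + 1 ↔ h.key u < t := fun u => by have := ht u; omega
  have hle : ∀ u, t + 1 ≤ h.key u ↔ t ≤ h.key u := fun u => by have := ht u; omega
  have hb : h.before (t + 1) = h.before t := by
    ext u
    rw [h.mem_before, h.mem_before, hlt]
  obtain ⟨a1, a2, a3, a4, a5, a6, a7, a8, a9, a10⟩ := hI
  constructor <;> simp only [hlt, hle, hb] <;> assumption

/-- The set `nbr v` lies in the bag of the parent of `v`, where the colours are already distinct. -/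
theorem col_inj_nbr {v : Fin n} (hI : Introduced h k (h.key v) s) :
    ∀ w ∈ h.nbr v, ∀ w' ∈ h.nbr v, s.mem 7 w = s.mem 7 w' → w = w' := by
  intro w hw w' hw' he
  cases hp : h.par v with
  | none =>
      rw [h.par_eq_none.1 hp] at hw
      simp at hw
  | some p =>
      have hsub := h.elimination.nbr_subset hp
      exact hI.col_inj p (h.mem_nbr.1 (h.par_mem hp).1).2 w (hsub hw) w' (hsub hw') he

/-- The row of the vertex `v` after its neighbours `u < i` have been entered. -/
structure Row (h : NodeOrder D o) (k i : ℕ) (v : Fin n) (s s' : State) : Prop where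
  slot : ∀ w ∈ h.nbr v, w < i → s'.mem 8 (v * (k + 1) + s.mem 7 w) = w + 1
  slot_ne : ∀ c ≤ k, s'.mem 8 (v * (k + 1) + c) ≠ 0 → ∃ w ∈ h.nbr v, s.mem 7 w = c
  other : ∀ u : Fin n, u ≠ v → ∀ c ≤ k, s'.mem 8 (u * (k + 1) + c) = s.mem 8 (u * (k + 1) + c)
  le : ∀ w ∈ h.nbr v, w < i → h.rank w + 1 ≤ s'.reg 12
  par : s'.reg 11 = 0 ∧ s'.reg 12 = 0 ∨
    ∃ p ∈ h.nbr v, s'.reg 11 = p + 1 ∧ s'.reg 12 = h.rank p + 1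

theorem Row.par_eq {v : Fin n} (hR : Row h k n v s s') :
    s'.reg 11 = code (h.par v) := by
  rcases hR.par with ⟨h1, h2⟩ | ⟨p, hp, h1, h2⟩
  · have : h.par v = none := by
      rw [h.par_eq_none, Finset.eq_empty_iff_forall_notMem]
      intro w hw
      have := hR.le w hw w.2
      omega
    rw [h1, this]
    rfl
  · have : h.par v = some p := h.par_eq hp fun u hu => by
      have := hR.le u hu u.2
      omega
    rw [h1, this]
    rfl

theorem before_succ (v : Fin n) : h.before (h.key v + 1) = insert v (h.before (h.key v)) := by
  ext u
  rw [Finset.mem_insert, h.mem_before, h.mem_before, ← h.key_inj]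
  omega

/-- The row of `v` holds the colours of `nbr v`, so a free slot is a colour unlike all of them. No
bag of an earlier vertex contains `v`, so the earlier rows and colours keep their meaning. -/
theorem enter {v : Fin n} {c : ℕ} {s₂ : State} (hI : Introduced h k (h.key v) s)
    (hR : Row h k n v s s₂) (hc : c ≤ k) (h0 : s₂.mem 8 (v * (k + 1) + c) = 0)
    (h20 : s'.reg 20 = h.rank v + 1)
    (h6 : ∀ j, s'.mem 6 j = if j = v then h.rank v + 1 else s.mem 6 j)
    (h7 : ∀ j, s'.mem 7 j = if j = v then c else s.mem 7 j)
    (h8 : ∀ j, s'.mem 8 j = if j = v * (k + 1) + c then v.1 + 1 else s₂.mem 8 j)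
    (h9 : ∀ j, s'.mem 9 j = if j = v then code (h.par v) else s.mem 9 j)
    (h10 : ∀ j, s'.mem 10 j = if j = h.rank v then v.1 else s.mem 10 j) :
    Introduced h k (h.key v + 1) s' := by
  have hlt : ∀ u, h.key u < h.key v + 1 ↔ u = v ∨ h.key u < h.key v := by
    intro u
    rw [← h.key_inj]
    omega
  have hne : ∀ u, h.key u < h.key v → u ≠ v := by
    rintro _ hu rfl
    exact lt_irrefl _ hu
  have hge : ∀ u, h.key v + 1 ≤ h.key u → u ≠ v := by
    rintro _ hu rfl
    omega
  have hnv : ∀ u, h.key u < h.key v → ∀ w ∈ insert u (h.nbr u), w ≠ v := by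
    rintro u hu w hw rfl
    rcases Finset.mem_insert.1 hw with rfl | hw
    · exact lt_irrefl _ hu
    · exact lt_asymm hu (h.mem_nbr.1 hw).2
  have hnbr : ∀ w ∈ h.nbr v, w ≠ v := fun w hw => hne w (h.mem_nbr.1 hw).2
  have hval : ∀ u w : Fin n, u ≠ w → (u : ℕ) ≠ w := fun u w huw he => huw (Fin.ext he)
  have h7' : ∀ w : Fin n, w ≠ v → s'.mem 7 w = s.mem 7 w := fun w hw => by
    rw [h7, if_neg (hval w v hw)]
  have h7v : s'.mem 7 v = c := by rw [h7, if_pos rfl]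
  have hcol : ∀ w ∈ h.nbr v, s.mem 7 w ≤ k := fun w hw => hI.col_le w (h.mem_nbr.1 hw).2
  have hfresh : ∀ w ∈ h.nbr v, s.mem 7 w ≠ c := by
    rintro w hw rfl
    rw [hR.slot w hw w.2] at h0
    omega
  have h8' : ∀ u : Fin n, u ≠ v → ∀ d ≤ k,
      s'.mem 8 (u * (k + 1) + d) = s.mem 8 (u * (k + 1) + d) := by
    intro u hu d hd
    rw [h8, if_neg, hR.other u hu d hd]
    rw [addr_inj (by omega) (by omega)]
    exact fun he => hval u v hu he.1
  constructor
  · rw [h20, before_succ, Finset.card_insert_of_notMem (by simp [h.mem_before])]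
    rfl
  · intro u hu
    rcases (hlt u).1 hu with rfl | hu
    · rw [h6, if_pos rfl]
    · rw [h6, if_neg (hval u v (hne u hu)), hI.rank u hu]
  · intro u hu
    rw [h6, if_neg (hval u v (hge u hu)), hI.rank_zero u (by omega)]
  · intro u hu
    rcases (hlt u).1 hu with rfl | hu
    · rwa [h7v]
    · rw [h7' u (hne u hu)]
      exact hI.col_le u hu
  · intro u hu w hw w' hw' he
    rcases (hlt u).1 hu with rfl | hu
    · rcases Finset.mem_insert.1 hw with rfl | hw <;> rcases Finset.mem_insert.1 hw' with rfl | hw'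
      · rfl
      · rw [h7v, h7' w' (hnbr w' hw')] at he
        exact absurd he.symm (hfresh w' hw')
      · rw [h7v, h7' w (hnbr w hw)] at he
        exact absurd he (hfresh w hw)
      · rw [h7' w (hnbr w hw), h7' w' (hnbr w' hw')] at he
        exact hI.col_inj_nbr w hw w' hw' he
    · rw [h7' w (hnv u hu w hw), h7' w' (hnv u hu w' hw')] at he
      exact hI.col_inj u hu w hw w' hw' he
  · intro u hu w hw
    rcases (hlt u).1 hu with rfl | hu
    · rcases Finset.mem_insert.1 hw with rfl | hw
      · rw [h7v, h8, if_pos rfl]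
      · rw [h7' w (hnbr w hw), h8, if_neg, hR.slot w hw w.2]
        rw [addr_inj (by have := hcol w hw; omega) (by omega)]
        exact fun he => hfresh w hw he.2
    · have hlt := hI.slot u hu w hw
      rw [h7' w (hnv u hu w hw), h8' u (hne u hu), hlt]
      rcases Finset.mem_insert.1 hw with rfl | hw
      · exact hI.col_le _ hu
      · exact hI.col_le w ((h.mem_nbr.1 hw).2.trans hu)
  · intro u hu d hd hd0
    rcases (hlt u).1 hu with rfl | hu
    · rw [h8] at hd0
      split_ifs at hd0 with he
      · exact ⟨u, Finset.mem_insert_self _ _, by rw [h7v]; omega⟩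
      · obtain ⟨w, hw, hwd⟩ := hR.slot_ne d hd hd0
        exact ⟨w, Finset.mem_insert_of_mem hw, by rw [h7' w (hnbr w hw), hwd]⟩
    · rw [h8' u (hne u hu) d hd] at hd0
      obtain ⟨w, hw, hwd⟩ := hI.slot_ne u hu d hd hd0
      exact ⟨w, hw, by rw [h7' w (hnv u hu w hw), hwd]⟩
  · intro u hu d hd
    rw [h8' u (hge u hu) d hd, hI.slot_zero u (by omega) d hd]
  · intro u hu
    rcases (hlt u).1 hu with rfl | hu
    · rw [h9, if_pos rfl]
    · rw [h9, if_neg (hval u v (hne u hu)), hI.par u hu]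
  · intro u hu
    rcases (hlt u).1 hu with rfl | hu
    · rw [h10, if_pos rfl]
    · rw [h10, if_neg fun he => hne u hu (h.rank_injective he), hI.seq u hu]

end Introduced

open Introduced

/-- Enter the neighbours of the vertex in register `8` in the bag of the node in register `7`. -/
def linkNeighbours : Cmd :=
  .for 9 0 <| .ite (.cell 2 7 0 9)
    (.ite (.load 6 (.reg 9))
      (.seq (.assign 13 (.load 7 (.reg 9))) <|
        .seq (.store 8 (.addr 8 3 13) (.add (.reg 9) (.const 1)))
          (.ite (.lt (.reg 12) (.load 6 (.reg 9)))
            (.seq (.assign 12 (.load 6 (.reg 9))) (.assign 11 (.add (.reg 9) (.const 1))))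
            .skip))
      .skip)
    .skip

/-- Find a colour that does not occur in the row of the vertex in register `8`. -/
def findColour : Cmd :=
  .for 9 3 <| .ite (.cell 8 8 3 9) .skip (.assign 14 (.reg 9))

def enterVertex : Cmd :=
  .seq (.store 8 (.addr 8 3 14) (.add (.reg 8) (.const 1))) <|
    .seq (.store 7 (.reg 8) (.reg 14)) <| .seq (.store 9 (.reg 8) (.reg 11)) <|
      .seq (.store 10 (.reg 20) (.reg 8)) <|
        .seq (.assign 20 (.add (.reg 20) (.const 1))) (.store 6 (.reg 8) (.reg 20))

def introduceVertex : Cmd :=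
  .seq (.seq (.assign 11 (.const 0)) (.assign 12 (.const 0))) <|
    .seq linkNeighbours <| .seq findColour enterVertex

def introduce : Cmd :=
  .seq (.assign 20 (.const 0)) <| .for 6 1 <| .seq (.assign 7 (.load 5 (.reg 6))) <|
    .for 8 0 <| .ite (.cell 2 7 0 8) (.ite (.load 6 (.reg 8)) .skip introduceVertex) .skip

variable {E : Env} {n N k : ℕ} {s : State} {G : SimpleGraph (Fin n)}
  {D : TreeDecomposition G (Fin N)} {o : ℕ → Fin N} {h : NodeOrder D o}

theorem runs_linkNeighbours (hB : Fits n N k E.B) (hs : Bdd E.B s) (hc : Ctx n N k s)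
    (hin : Input G D s) {v : Fin n} (hI : Introduced h k (h.key v) s)
    (h7 : s.reg 7 = o (h.top v)) (h8 : s.reg 8 = v) (h11 : s.reg 11 = 0) (h12 : s.reg 12 = 0) :
    E.Runs linkNeighbours s ((n + 1) * 200) fun s' => Row h k n v s s' := by
  have hN := hB.node
  refine Env.runs_for (T := 179) (by decide) (by decide) hs hc.r0
    (fun i s' => Row h k i v s s') ?_ ?_ ?_
  · constructor
    · simp
    · exact fun c hck hne => absurd (hI.slot_zero v le_rfl c hck) hne
    · simp
    · simp
    · simp [State.setReg_reg, h11, h12]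
  · rintro i hi s₁ hs₁ hf r9 hR
    have hc₁ := hc.frame hf (by decide)
    have hin₁ := hin.frame hf (by decide)
    have r7 : s₁.reg 7 = o (h.top v) := (hf.1 7 (by decide)).trans h7
    have r8 : s₁.reg 8 = v := (hf.1 8 (by decide)).trans h8
    have hm6 : s₁.mem 6 = s.mem 6 := hf.2 6 (by decide)
    have hm7 : s₁.mem 7 = s.mem 7 := hf.2 7 (by decide)
    have hcell : (Expr.cell 2 7 0 9).eval s₁ = s₁.mem 2 (o (h.top v) * n + i) := by
      rw [Expr.eval_cell, r7, hc₁.r0, r9]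
    have hload : (Expr.load 6 (.reg 9)).eval s₁ = s.mem 6 i := by simp [Expr.eval, r9, hm6]
    have hbag := hin₁.bag (o (h.top v)) ⟨i, hi⟩
    simp only at hbag
    have hskip : (⟨i, hi⟩ : Fin n) ∉ h.nbr v → Row h k (i + 1) v s (s₁.setReg 9 (i + 1)) := by
      intro hnot
      have hR : Row h k i v s (s₁.setReg 9 (i + 1)) :=
        ⟨hR.slot, hR.slot_ne, hR.other, hR.le, hR.par⟩
      refine { hR with slot := fun w hw hwi => ?_, le := fun w hw hwi => ?_ }
      · refine hR.slot w hw (lt_of_le_of_ne (Nat.lt_succ_iff.1 hwi) fun he => hnot ?_)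
        subst he
        exact hw
      · refine hR.le w hw (lt_of_le_of_ne (Nat.lt_succ_iff.1 hwi) fun he => hnot ?_)
        subst he
        exact hw
    refine (Env.runs_flat hs₁ rfl ?_ ?_).weaken (by decide) fun _ _ _ h => h
    · have h1 := hs₁.mem_lt 7 i
      have h2 := hs₁.mem_lt 6 i
      simp only [Cmd.Safe, Cmd.den, hcell, hload]
      simp [Expr.eval, State.setReg_reg, State.setMem_mem, r9, h1, h2]
      intros
      omega
    · simp only [Cmd.den, hcell, hload]
      by_cases hA : (⟨i, hi⟩ : Fin n) ∈ D.bag (o (h.top v))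
      · rw [if_pos (hbag.2 hA)]
        by_cases hk : h.key ⟨i, hi⟩ < h.key v
        · have hrk : s.mem 6 i = h.rank ⟨i, hi⟩ + 1 := hI.rank _ hk
          have hmem : (⟨i, hi⟩ : Fin n) ∈ h.nbr v := h.mem_nbr.2 ⟨hA, hk⟩
          rw [if_pos (by omega)]
          have key : ∀ s' : State, s'.mem 8 = (s₁.setMem 8 (v * (k + 1) + s.mem 7 i) (i + 1)).mem 8 →
              (s'.reg 11 = i + 1 ∧ s'.reg 12 = s.mem 6 i ∧ s₁.reg 12 < s.mem 6 i ∨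
                s'.reg 11 = s₁.reg 11 ∧ s'.reg 12 = s₁.reg 12 ∧ s.mem 6 i ≤ s₁.reg 12) →
              Row h k (i + 1) v s s' := by
            intro s' hm hr
            have hcol : s.mem 7 i ≤ k := hI.col_le _ hk
            constructor
            · intro w hw hwi
              rw [hm, State.setMem_mem]
              split_ifs with he
              · have h1 : s.mem 7 w = s.mem 7 (⟨i, hi⟩ : Fin n) := by simpa using he
                rw [hI.col_inj_nbr w hw _ hmem h1]
              · refine hR.slot w hw (lt_of_le_of_ne (Nat.lt_succ_iff.1 hwi) ?_)
                rintro rfl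
                exact he ⟨rfl, rfl⟩
            · intro c hck hne
              rw [hm, State.setMem_mem] at hne
              split_ifs at hne with he
              · exact ⟨_, hmem, by simpa using he.2.symm⟩
              · exact hR.slot_ne c hck hne
            · intro u hu c hck
              rw [hm, State.setMem_mem, if_neg, hR.other u hu c hck]
              rw [addr_inj (by omega) (by omega)]
              exact fun he => hu (Fin.ext he.2.1)
            · intro w hw hwi
              rcases Nat.lt_succ_iff_lt_or_eq.1 hwi with hlt | rfl
              · have := hR.le w hw hlt
                omega
              · have : s.mem 6 w = h.rank w + 1 := hrk
                omega
            · rcases hr with ⟨h1, h2, -⟩ | ⟨h1, h2, -⟩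
              · exact .inr ⟨_, hmem, h1, by rw [h2, hrk]⟩
              · rw [h1, h2]
                exact hR.par
          refine key _ ?_ ?_
          · simp [Expr.eval, State.setReg_reg, r8, r9, hc₁.r3, hm7, State.setMem]
            split_ifs <;> simp
          · by_cases hlt : s₁.reg 12 < s.mem 6 i
            · left
              simp [Expr.eval, State.setReg_reg, State.setMem_mem, r9, hm6, hlt]
            · right
              simp [Expr.eval, State.setReg_reg, State.setMem_mem, r9, hm6, hlt]
              omega
        · have hrk : s.mem 6 i = 0 := hI.rank_zero ⟨i, hi⟩ (not_lt.1 hk)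
          rw [if_neg (not_not.2 hrk)]
          exact hskip fun hm => hk (h.mem_nbr.1 hm).2
      · rw [if_neg fun h => hA (hbag.1 h)]
        exact hskip fun hm => hA (h.mem_nbr.1 hm).1
  · exact fun s' _ _ h => h

theorem runs_findColour (hs : Bdd E.B s) (hc : Ctx n N k s) {v : ℕ} (h8 : s.reg 8 = v)
    (hfree : ∃ c ≤ k, s.mem 8 (v * (k + 1) + c) = 0) :
    E.Runs findColour s ((k + 2) * 100) fun s' =>
      s'.reg 14 ≤ k ∧ s.mem 8 (v * (k + 1) + s'.reg 14) = 0 := by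
  refine Env.runs_for (T := 79) (by decide) (by decide) hs hc.r3
    -- The claim is conditional because register `14` means nothing until a free slot has been met;
    -- the scan of all `k + 1` slots must meet one.
    (fun i s' => (∃ c < i, s.mem 8 (v * (k + 1) + c) = 0) →
      s'.reg 14 ≤ k ∧ s.mem 8 (v * (k + 1) + s'.reg 14) = 0) (by simp) ?_ ?_
  · rintro i hi s₁ hs₁ hf r9 hI
    have hc₁ := hc.frame hf (by decide)
    have r8 : s₁.reg 8 = v := (hf.1 8 (by decide)).trans h8
    have hcell : (Expr.cell 8 8 3 9).eval s₁ = s.mem 8 (v * (k + 1) + i) := by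
      rw [Expr.eval_cell, r8, hc₁.r3, r9, hf.2 8 (by decide)]
    refine (Env.runs_flat hs₁ rfl ?_ ?_).weaken (by decide) fun _ _ _ h => h
    · simp only [Cmd.Safe, Expr.eval, r9]
      have := hs₁.reg_lt 9
      rw [r9] at this
      simp [this]
    · simp only [Cmd.den, hcell, Expr.eval, r9]
      by_cases h0 : s.mem 8 (v * (k + 1) + i) = 0
      · rw [if_neg (not_not.2 h0)]
        intro
        simp [State.setReg_reg, h0]
        omega
      · rw [if_pos h0]
        rintro ⟨c, hci, hc0⟩
        refine hI ⟨c, lt_of_le_of_ne (Nat.lt_succ_iff.1 hci) ?_, hc0⟩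
        rintro rfl
        exact h0 hc0
  · intro s' hs' hf hI
    obtain ⟨c, hck, hc0⟩ := hfree
    exact hI ⟨c, by omega, hc0⟩

/-- Occupied slots are colours of vertices in `nbr v`, at most `k` of the `k + 1` available. -/
theorem Introduced.Row.exists_free {v : Fin n} {s' : State} (hR : Row h k n v s s')
    (hk : (h.nbr v).card ≤ k) : ∃ c ≤ k, s'.mem 8 (v * (k + 1) + c) = 0 := by
  by_contra! hne
  have := Finset.card_le_card_of_surjOn (s := h.nbr v) (t := Finset.range (k + 1))
    (fun w => s.mem 7 w) (fun c hc => by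
      have hc := Finset.mem_range.1 (Finset.mem_coe.1 hc)
      obtain ⟨w, hw, hwc⟩ := hR.slot_ne c (by omega) (hne c (by omega))
      exact ⟨w, hw, hwc⟩)
  rw [Finset.card_range] at this
  omega

theorem runs_introduceVertex (hB : Fits n N k E.B) (hs : Bdd E.B s) (hc : Ctx n N k s)
    (hin : Input G D s) (hk : D.HasWidth k) {v : Fin n} (hI : Introduced h k (h.key v) s)
    (h7 : s.reg 7 = o (h.top v)) (h8 : s.reg 8 = v) :
    E.Runs introduceVertex s (4 + 4 + 1 + ((n + 1) * 200 + ((k + 2) * 100 + 100)))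
      fun s' => Introduced h k (h.key v + 1) s' := by
  have hN := hB.node
  have hcard := h.card_nbr_le hk v
  refine (Env.Runs.seq (Env.runs_flat hs rfl ?_ (Q := fun s' => Introduced h k (h.key v) s' ∧
    s'.reg 7 = o (h.top v) ∧ s'.reg 8 = v ∧ s'.reg 11 = 0 ∧ s'.reg 12 = 0) ?_) ?_
      (T₂ := (n + 1) * 200 + ((k + 2) * 100 + 100))).weaken (Nat.add_le_add_right (by decide) _)
      fun _ _ _ h => h
  · simp [Cmd.Safe, Expr.eval]
    omega
  · refine ⟨hI.congr ?_ ?_, ?_⟩ <;> simp [Cmd.den, Expr.eval, State.setReg_reg, h7, h8]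
  · rintro s₁ hs₁ hf₁ ⟨hI₁, h7, h8, h11, h12⟩
    have hc₁ := hc.frame hf₁ (by decide)
    have hin₁ := hin.frame hf₁ (by decide)
    refine Env.Runs.seq (runs_linkNeighbours hB hs₁ hc₁ hin₁ hI₁ h7 h8 h11 h12) ?_
    rintro s₂ hs₂ hf₂ hR
    have hc₂ := hc₁.frame hf₂ (by decide)
    have r8 : s₂.reg 8 = v := (hf₂.1 8 (by decide)).trans h8
    refine Env.Runs.seq (runs_findColour hs₂ hc₂ r8 (hR.exists_free hcard)) ?_
    rintro s₃ hs₃ hf₃ ⟨h14, hfree⟩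
    have hc₃ := hc₂.frame hf₃ (by decide)
    have r8 : s₃.reg 8 = v := (hf₃.1 8 (by decide)).trans r8
    have hr : s₃.reg 20 = h.rank v := by
      rw [hf₃.1 20 (by decide), hf₂.1 20 (by decide), hI₁.count]
      rfl
    have h11 : s₃.reg 11 = code (h.par v) := by
      rw [hf₃.1 11 (by decide), hR.par_eq]
    have hm : ∀ A ≠ 8, s₃.mem A = s₁.mem A := fun A hA => by
      rw [hf₃.2 A (by simp [findColour, Cmd.for, Cmd.warr]),
        hf₂.2 A (by simpa [linkNeighbours, Cmd.for, Cmd.warr] using hA)]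
    have hm8 : s₃.mem 8 = s₂.mem 8 := hf₃.2 8 (by decide)
    have hrn := h.rank_lt v
    have hvn := v.2
    refine (Env.runs_flat hs₃ rfl ?_ ?_).weaken (by decide) fun _ _ _ h => h
    · have := hs₃.reg_lt 11
      have := hs₃.reg_lt 14
      simp [enterVertex, Cmd.Safe, Cmd.den, Expr.eval, hr, r8]
      omega
    · refine hI₁.enter hR h14 hfree ?_ ?_ ?_ ?_ ?_ ?_
      · simp [enterVertex, Cmd.den, Expr.eval, State.setReg_reg, hr]
      all_goals
        intro j
        simp [enterVertex, Cmd.den, Expr.eval, State.setReg_reg, State.setMem_mem, hr, r8, h11,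
          hc₃.r3, hm, hm8]

/-- The double loop over bag positions `a` and vertices `v` runs through the values `a * n + v` in
increasing order, and a vertex found in bag `a` is still unranked exactly when `a` is the position
of its first bag, that is, when its key is reached. -/
theorem runs_introduce (hB : Fits n N k E.B) (hs : Bdd E.B s) (hc : Ctx n N k s)
    (hin : Input G D s) (hk : D.HasWidth k) (ho : ∀ a < N, s.mem 5 a = o a)
    (h6 : ∀ i, s.mem 6 i = 0) (h8 : ∀ i, s.mem 8 i = 0) :
    E.Runs introduce s ((N + 1) * ((n + 1) * ((n + 2) * 600)) * 2) fun s' =>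
      Introduced h k (N * n) s' := by
  have hN := hB.node
  have hkn := hB.lt
  refine (Env.Runs.seq (Env.runs_flat hs rfl ?_ (Q := fun s' => Introduced h k 0 s') ?_) ?_
    (T₂ := (N + 1) * (9 + ((n + 1) * ((n + 2) * 500 + 21)) + 21))).weaken ?_ fun _ _ _ h => h
  · simp [Cmd.Safe, Expr.eval]
    omega
  · constructor <;> simp [Cmd.den, Expr.eval, h6, h8, NodeOrder.before]
  · rintro s₁ hs₁ hf₁ hI₁
    have hc₁ := hc.frame hf₁ (by decide)
    have hin₁ := hin.frame hf₁ (by decide)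
    refine Env.runs_for (by decide) (by decide) hs₁ hc₁.r1
      (fun a s' => Introduced h k (a * n) s') ?_ ?_ ?_
    · rw [zero_mul]
      exact hI₁.congr (by simp [State.setReg_reg]) (by simp)
    · rintro a ha s₂ hs₂ hf₂ r6 hI₂
      have hc₂ := hc₁.frame hf₂ (by decide)
      have hin₂ := hin₁.frame hf₂ (by decide)
      have h5 : s₂.mem 5 a = o a := by rw [hf₂.2 5 (by decide), hf₁.2 5 (by decide), ho a ha]
      refine (Env.Runs.seq (Env.runs_flat hs₂ rfl ?_ (Q := fun s' => s'.reg 7 = o a ∧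
        Introduced h k (a * n) s') ?_) ?_ (T₂ := (n + 1) * ((n + 2) * 500 + 21))).weaken
          (Nat.add_le_add_right (by decide) _) fun _ _ _ h => h
      · exact hs₂.mem_lt _ _
      · refine ⟨by simp [Cmd.den, Expr.eval, r6, h5], hI₂.congr ?_ ?_⟩ <;>
          simp [Cmd.den, State.setReg_reg]
      · rintro s₃ hs₃ hf₃ ⟨r7, hI₃⟩
        have hc₃ := hc₂.frame hf₃ (by decide)
        have hin₃ := hin₂.frame hf₃ (by decide)
        refine Env.runs_for (by decide) (by decide) hs₃ hc₃.r0
          (fun v s' => Introduced h k (a * n + v) s') ?_ ?_ ?_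
        · exact hI₃.congr (by simp [State.setReg_reg]) (by simp)
        · rintro v hv s₄ hs₄ hf₄ r8 hI₄
          have hc₄ := hc₃.frame hf₄ (by decide)
          have hin₄ := hin₃.frame hf₄ (by decide)
          have r7 : s₄.reg 7 = o a := (hf₄.1 7 (by decide)).trans r7
          have hcell : (Expr.cell 2 7 0 8).eval s₄ = s₄.mem 2 (o a * n + v) := by
            rw [Expr.eval_cell, r7, hc₄.r0, r8]
          have hload : (Expr.load 6 (.reg 8)).eval s₄ = s₄.mem 6 v := by simp [Expr.eval, r8]
          have hbag := hin₄.bag (o a) ⟨v, hv⟩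
          simp only at hbag
          -- A value `a * n + v` that is not the key of `v` is not the key of any vertex, so the
          -- threshold advances without change.
          have hskip : (h.key ⟨v, hv⟩ ≠ a * n + v) → E.Runs .skip s₄ ((n + 2) * 400) fun s'' =>
              Introduced h k (a * n + (v + 1)) (s''.setReg 8 (v + 1)) := by
            intro hne
            refine (Env.runs_flat (p := .skip) hs₄ rfl trivial ?_).weaken ?_ fun _ _ _ h => h
            · refine (hI₄.mono fun u hu => hne ?_).congr (by simp [Cmd.den, State.setReg_reg])
                (by simp [Cmd.den])
              have : u = ⟨v, hv⟩ := Fin.ext ((addr_inj u.2 hv).1 hu).2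
              rw [← this, hu]
            · have : Cmd.tick .skip ≤ 400 := by decide
              omega
          have htop : ∀ b, h.key ⟨v, hv⟩ = b * n + v ↔ h.top ⟨v, hv⟩ = b := fun b => by
            simp only [NodeOrder.key]
            rw [addr_inj hv hv]
            simp
          refine (Env.runs_ite hs₄ rfl (fun hA => ?_) (fun hA => ?_)
            (T := 50 + (n + 2) * 410)).weaken ?_ fun _ _ _ h => h
          · rw [hcell, hbag] at hA
            have hle := h.top_le ha hA
            refine (Env.runs_ite hs₄ rfl (fun hv0 => ?_) (fun hv0 => ?_)
              (T := (n + 2) * 410)).weaken (Nat.add_le_add_right (by decide) _) fun _ _ _ h => h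
            · refine (hskip fun he => hv0 ?_).weaken (by omega) fun _ _ _ h => h
              rw [hload]
              exact hI₄.rank_zero ⟨v, hv⟩ he.ge
            · rw [hload] at hv0
              have hat : h.top ⟨v, hv⟩ = a := by
                refine le_antisymm hle ?_
                by_contra hlt
                have := hI₄.rank ⟨v, hv⟩ ((h.key_lt_iff hv.le).2 (.inl (not_le.1 hlt)))
                simp only at this
                omega
              have hkey := (htop a).2 hat
              refine (runs_introduceVertex hB hs₄ hc₄ hin₄ hk (v := ⟨v, hv⟩) (hkey ▸ hI₄)
                (by rw [hat, r7]) r8).weaken (by omega) fun s' _ _ hI => ?_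
              rw [hkey] at hI
              exact hI.congr (by simp [State.setReg_reg]) (by simp)
          · rw [hcell] at hA
            refine (hskip fun he => ?_).weaken (by omega) fun _ _ _ h => h
            have hm := h.mem_bag_top ⟨v, hv⟩
            rw [(htop a).1 he, ← hbag] at hm
            exact hm hA
          · have : (Expr.cell 2 7 0 8).tick + (Expr.cell 2 7 0 8).growth + 1 ≤ 100 := by decide
            omega
        · intro s' _ _ hI
          rw [Nat.add_mul, one_mul]
          exact hI.congr (by simp [State.setReg_reg]) (by simp)
    · exact fun s' _ _ h => h
  · have : Cmd.tick (.assign 20 (.const 0)) ≤ 10 := by decide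
    nlinarith [Nat.zero_le (N * n), Nat.zero_le (N * n * n), Nat.zero_le (n * n)]

end RAM

/-! ### Masks of colours -/

namespace RAM

/-- The set of colours encoded by a mask. -/
def bits (k m : ℕ) : Finset ℕ := (Finset.range (k + 1)).filter fun j => bit m j ≠ 0

theorem mem_bits {k m j : ℕ} : j ∈ bits k m ↔ j ≤ k ∧ bit m j ≠ 0 := by
  simp [bits]

theorem bit_add_two_pow {m c : ℕ} (hc : bit m c = 0) (j : ℕ) :
    bit (m + 2 ^ c) j = if j = c then 1 else bit m j := by
  unfold bit at *
  rcases lt_trichotomy j c with hj | rfl | hj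
  · rw [if_neg hj.ne]
    obtain ⟨i, rfl⟩ := Nat.exists_eq_add_of_lt hj
    have : m + 2 ^ (j + i + 1) = m + 2 ^ j * (2 ^ i * 2) := by ring
    rw [this, Nat.add_mul_div_left _ _ (by positivity)]
    omega
  · rw [if_pos rfl, Nat.add_div_right _ (by positivity)]
    omega
  · rw [if_neg hj.ne']
    obtain ⟨i, rfl⟩ := Nat.exists_eq_add_of_lt hj
    have : 2 ^ (c + i + 1) = 2 ^ c * (2 * 2 ^ i) := by ring
    rw [this, ← Nat.div_div_eq_div_mul, ← Nat.div_div_eq_div_mul, ← Nat.div_div_eq_div_mul,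
      ← Nat.div_div_eq_div_mul, Nat.add_div_right _ (by positivity)]
    congr 2
    omega

theorem bits_add_two_pow {k m c : ℕ} (hck : c ≤ k) (hc : bit m c = 0) :
    bits k (m + 2 ^ c) = insert c (bits k m) := by
  ext j
  rw [Finset.mem_insert, mem_bits, mem_bits, bit_add_two_pow hc]
  split_ifs with hj
  · simp [hj, hck]
  · simp [hj]

theorem two_pow_le_of_bit {m c : ℕ} (hc : bit m c ≠ 0) : 2 ^ c ≤ m := by
  by_contra hlt
  exact hc (by rw [bit, Nat.div_eq_of_lt (not_le.1 hlt)])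

theorem bit_sub_two_pow {m c : ℕ} (hc : bit m c ≠ 0) : bit (m - 2 ^ c) c = 0 := by
  obtain ⟨r, rfl⟩ := Nat.exists_eq_add_of_le (two_pow_le_of_bit hc)
  unfold bit at *
  rw [Nat.add_div_left _ (by positivity)] at hc
  rw [Nat.add_sub_cancel_left]
  omega

theorem bits_sub_two_pow {k m c : ℕ} (hck : c ≤ k) (hc : bit m c ≠ 0) :
    bits k m = insert c (bits k (m - 2 ^ c)) := by
  rw [← bits_add_two_pow hck (bit_sub_two_pow hc), Nat.sub_add_cancel (two_pow_le_of_bit hc)]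

theorem add_two_pow_lt {k m c : ℕ} (hck : c ≤ k) (hm : m < 2 ^ (k + 1)) (hc : bit m c = 0) :
    m + 2 ^ c < 2 ^ (k + 1) := by
  obtain ⟨i, rfl⟩ := Nat.exists_eq_add_of_le hck
  have hpow : 2 ^ (c + i + 1) = 2 * 2 ^ i * 2 ^ c := by ring
  rw [hpow, ← Nat.div_lt_iff_lt_mul (by positivity)] at hm ⊢
  rw [Nat.add_div_right _ (by positivity)]
  unfold bit at hc
  omega

open Classical in
/-- The data from which the tables of the dynamic program are computed. -/
structure Prepared (γ : Set ℕ) {n N : ℕ} {G : SimpleGraph (Fin n)}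
    {D : TreeDecomposition G (Fin N)} {o : ℕ → Fin N} (h : NodeOrder D o) (k : ℕ) (s : State) :
    Prop where
  ctx : Ctx n N k s
  input : Input G D s
  intro : Introduced h k (N * n) s
  bit : ∀ m < 2 ^ (k + 1), ∀ j ≤ k, s.mem 11 (m * (k + 1) + j) = bit m j
  pow : ∀ j ≤ k, s.mem 12 j = 2 ^ j
  choose : ∀ c < 2 ^ (k + 1), ∀ d ≤ n, s.mem 13 (c * (n + 1) + d) = c.choose d
  sizes : ∀ i ≤ k + 1, s.mem 3 i = if i ∈ γ then 1 else 0

namespace Prepared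

variable {γ : Set ℕ} {n N k : ℕ} {G : SimpleGraph (Fin n)} {D : TreeDecomposition G (Fin N)}
  {o : ℕ → Fin N} {h : NodeOrder D o} {s s' : State}

theorem frame {p : Cmd} (hp : Prepared γ h k s) (hf : Frame p s s')
    (hr : ∀ x ∈ [0, 1, 2, 3, 4, 5, 20], x ∉ p.wreg)
    (hm : ∀ A ∈ [0, 1, 2, 3, 6, 7, 8, 9, 10, 11, 12, 13], A ∉ p.warr) : Prepared γ h k s' where
  ctx := hp.ctx.frame hf fun x hx => hr x (by simp at hx ⊢; omega)
  input := hp.input.frame hf fun x hx => hm x (by simp at hx ⊢; omega)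
  intro := hp.intro.frame hf (hr 20 (by decide)) fun x hx => hm x (by simp at hx ⊢; omega)
  bit := by rw [hf.2 11 (hm 11 (by decide))]; exact hp.bit
  pow := by rw [hf.2 12 (hm 12 (by decide))]; exact hp.pow
  choose := by rw [hf.2 13 (hm 13 (by decide))]; exact hp.choose
  sizes := by rw [hf.2 3 (hm 3 (by decide))]; exact hp.sizes

theorem congr (hp : Prepared γ h k s) (hr : ∀ x ∈ [0, 1, 2, 3, 4, 5, 20], s'.reg x = s.reg x)
    (hm : ∀ A ∈ [0, 1, 2, 3, 6, 7, 8, 9, 10, 11, 12, 13], s'.mem A = s.mem A) :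
    Prepared γ h k s' := by
  have h0 := hm 0 (by decide)
  have h1 := hm 1 (by decide)
  have h2 := hm 2 (by decide)
  obtain ⟨⟨b0, b1, b2, b3, b4, b5⟩, ⟨c1, c2, c3⟩, a3, a4, a5, a6, a7⟩ := hp
  refine ⟨?_, ?_, a3.congr (hr 20 (by decide)) fun A hA => hm A (by simp at hA ⊢; omega),
    ?_, ?_, ?_, ?_⟩
  · constructor <;> rw [hr _ (by decide)] <;> assumption
  · constructor <;> simp only [h0, h1, h2] <;> assumption
  · rwa [hm 11 (by decide)]
  · rwa [hm 12 (by decide)]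
  · rwa [hm 13 (by decide)]
  · rwa [hm 3 (by decide)]

end Prepared

/-- Check that the vertex whose successor is in register `13` is equal or adjacent to all vertices of
the row in register `6` whose colours belong to the mask in register `7`. -/
def testPairs : Cmd :=
  .for 9 3 <| .ite (.cell 11 7 3 9)
    (.seq (.assign 14 (.cell 8 6 3 9)) <|
      .ite (.reg 14)
        (.ite (.eq (.reg 13) (.reg 14)) .skip
          (.seq (.assign 15 (.sub (.reg 13) (.const 1))) <|
            .seq (.assign 16 (.sub (.reg 14) (.const 1)))
              (.ite (.cell 0 15 0 16) .skip (.assign 10 (.const 0)))))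
        .skip)
    .skip

variable {γ : Set ℕ} {E : Env} {n N k : ℕ} {s : State} {G : SimpleGraph (Fin n)}
  {D : TreeDecomposition G (Fin N)} {o : ℕ → Fin N} {h : NodeOrder D o}

/-- The condition checked by `testPairs`, for the colour `j`. -/
def PairOk (n k : ℕ) (s : State) (v x j : ℕ) : Prop :=
  s.mem 8 (v * (k + 1) + j) ≠ 0 → x ≠ s.mem 8 (v * (k + 1) + j) →
    s.mem 0 ((x - 1) * n + (s.mem 8 (v * (k + 1) + j) - 1)) ≠ 0

theorem runs_testPairs (hs : Bdd E.B s) (hp : Prepared γ h k s)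
    {m v : ℕ} (h6 : s.reg 6 = v) (h7 : s.reg 7 = m) (hm : m < 2 ^ (k + 1)) :
    E.Runs testPairs s ((k + 2) * 200) fun s' =>
      s'.reg 10 ≠ 0 ↔ s.reg 10 ≠ 0 ∧ ∀ j ∈ bits k m, PairOk n k s v (s.reg 13) j := by
  refine Env.runs_for (T := 179) (by decide) (by decide) hs hp.ctx.r3
    (fun i s' => s'.reg 10 ≠ 0 ↔
      s.reg 10 ≠ 0 ∧ ∀ j < i, j ∈ bits k m → PairOk n k s v (s.reg 13) j) ?_ ?_ ?_
  · simp [State.setReg_reg]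
  · rintro j hj s₁ hs₁ hf r9 hI
    have hp₁ := hp.frame hf (by decide) (by decide)
    have r6 : s₁.reg 6 = v := (hf.1 6 (by decide)).trans h6
    have r7 : s₁.reg 7 = m := (hf.1 7 (by decide)).trans h7
    have r13 : s₁.reg 13 = s.reg 13 := hf.1 13 (by decide)
    have hm8 : s₁.mem 8 = s.mem 8 := hf.2 8 (by decide)
    have hm0 : s₁.mem 0 = s.mem 0 := hf.2 0 (by decide)
    have hcell : (Expr.cell 11 7 3 9).eval s₁ = bit m j := by
      rw [Expr.eval_cell, r7, hp₁.ctx.r3, r9, hp₁.bit m hm j (by omega)]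
    have hcell' : (Expr.cell 8 6 3 9).eval s₁ = s.mem 8 (v * (k + 1) + j) := by
      rw [Expr.eval_cell, r6, hp₁.ctx.r3, r9, hm8]
    have hstep : (∀ j' < j + 1, j' ∈ bits k m → PairOk n k s v (s.reg 13) j') ↔
        (∀ j' < j, j' ∈ bits k m → PairOk n k s v (s.reg 13) j') ∧
          (bit m j ≠ 0 → PairOk n k s v (s.reg 13) j) := by
      constructor
      · exact fun H => ⟨fun j' hj' => H j' (by omega),
          fun hb => H j (by omega) (mem_bits.2 ⟨by omega, hb⟩)⟩
      · rintro ⟨H1, H2⟩ j' hj' hb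
        rcases Nat.lt_succ_iff_lt_or_eq.1 hj' with hlt | rfl
        · exact H1 j' hlt hb
        · exact H2 (mem_bits.1 hb).2
    refine (Env.runs_flat hs₁ rfl ?_ ?_).weaken (by decide) fun _ _ _ h => h
    · have h1 := hs₁.mem_lt 8 (v * (k + 1) + j)
      have h2 := hs₁.reg_lt 13
      rw [hm8] at h1
      simp [Cmd.Safe, Cmd.den, hcell, hcell']
      simp [Expr.eval, State.setReg_reg, h1]
      omega
    · rw [hstep, ← and_assoc, ← hI]
      simp only [Cmd.den, hcell, hcell']
      by_cases hb : bit m j = 0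
      · simp [hb, State.setReg_reg]
      · by_cases h0 : s.mem 8 (v * (k + 1) + j) = 0
        · simp [hb, Expr.eval, State.setReg_reg, h0, PairOk]
        · by_cases he : s.reg 13 = s.mem 8 (v * (k + 1) + j)
          · simp [hb, Expr.eval, State.setReg_reg, r13, ← he, PairOk]
          · by_cases ha : s.mem 0 ((s.reg 13 - 1) * n + (s.mem 8 (v * (k + 1) + j) - 1)) = 0
            · simp [hb, Expr.eval, State.setReg_reg, r13, hm0, he, h0, hp₁.ctx.r0, PairOk, ha]
            · simp [hb, Expr.eval, State.setReg_reg, r13, hm0, he, h0, hp₁.ctx.r0, PairOk, ha]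
  · intro s' _ _ hI
    rw [hI]
    refine and_congr_right fun _ => ⟨fun H j hj => H j ?_ hj, fun H j _ hj => H j hj⟩
    have := (mem_bits.1 hj).1
    omega

/-- Count the colours in the mask in register `7`, and check that they belong to pairwise adjacent
vertices of the row in register `6`, one of which is the vertex in register `6`. -/
def testMask : Cmd :=
  .seq (.seq (.assign 10 (.const 1)) <| .seq (.assign 11 (.const 0)) <|
      .seq (.assign 12 (.load 7 (.reg 6))) <|
        .ite (.cell 11 7 3 12) .skip (.assign 10 (.const 0)))
    (.for 8 3 <| .ite (.cell 11 7 3 8)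
      (.seq (.seq (.assign 11 (.add (.reg 11) (.const 1))) (.assign 13 (.cell 8 6 3 8)))
        (.ite (.reg 13) testPairs (.assign 10 (.const 0))))
      .skip)

/-- The condition checked by `testMask`. -/
def MaskOk (n k : ℕ) (s : State) (v m : ℕ) : Prop :=
  bit m (s.mem 7 v) ≠ 0 ∧ ∀ i ∈ bits k m, s.mem 8 (v * (k + 1) + i) ≠ 0 ∧
    ∀ j ∈ bits k m, PairOk n k s v (s.mem 8 (v * (k + 1) + i)) j

theorem key_lt (h : NodeOrder D o) (v : Fin n) : h.key v < N * n := by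
  have := (h.key_lt_iff (v := v) (a := N) (Nat.zero_le n)).2 (.inl (h.top_lt v))
  simpa using this

theorem runs_testMask (hB : Fits n N k E.B) (hs : Bdd E.B s) (hp : Prepared γ h k s)
    {m : ℕ} {v : Fin n} (h6 : s.reg 6 = v) (h7 : s.reg 7 = m) (hm : m < 2 ^ (k + 1)) :
    E.Runs testMask s (100 + (k + 2) * ((k + 2) * 400)) fun s' =>
      (s'.reg 10 ≠ 0 ↔ MaskOk n k s v m) ∧ s'.reg 11 = (bits k m).card := by
  have hN := hB.node
  refine (Env.Runs.seq (Env.runs_flat hs rfl ?_ (Q := fun s' => s'.mem = s.mem ∧ s'.reg 6 = v ∧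
    s'.reg 7 = m ∧ s'.reg 3 = k + 1 ∧ s'.reg 11 = 0 ∧ (s'.reg 10 ≠ 0 ↔ bit m (s.mem 7 v) ≠ 0)) ?_) ?_
      (T₂ := (k + 2) * ((k + 2) * 200 + 250 + 21))).weaken ?_ fun _ _ _ h => h
  · have h1 := hs.mem_lt 7 v
    simp [Cmd.Safe, Cmd.den, Expr.eval, State.setReg_reg, h6, h1]
    omega
  · have h1 := hp.bit m hm (s.mem 7 v) (hp.intro.col_le v (key_lt h v))
    simp [Cmd.den, Expr.eval, State.setReg_reg, h6, h7, hp.ctx.r3, h1]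
    by_cases hb : bit m (s.mem 7 v) = 0 <;>
      simp [hb, State.setReg_reg, h6, h7, hp.ctx.r3]
  · rintro s₁ hs₁ hf₁ ⟨hm₁, r6, r7, r3, r11, r10⟩
    have hp₁ : Prepared γ h k s₁ := hp.frame hf₁ (by decide) (by decide)
    refine Env.runs_for (by decide) (by decide) hs₁ r3 (fun i s' =>
      (s'.reg 10 ≠ 0 ↔ bit m (s.mem 7 v) ≠ 0 ∧ ∀ i' < i, i' ∈ bits k m →
        s.mem 8 (v * (k + 1) + i') ≠ 0 ∧
          ∀ j ∈ bits k m, PairOk n k s v (s.mem 8 (v * (k + 1) + i')) j) ∧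
      s'.reg 11 = ((bits k m).filter (· < i)).card) ?_ ?_ ?_
    · simpa [State.setReg_reg, r11] using r10
    · rintro i hi s₂ hs₂ hf₂ r8 ⟨hI, h11⟩
      have hp₂ := hp₁.frame hf₂ (by decide) (by decide)
      have r6 : s₂.reg 6 = v := (hf₂.1 6 (by decide)).trans r6
      have r7 : s₂.reg 7 = m := (hf₂.1 7 (by decide)).trans r7
      have hm₂ : s₂.mem = s.mem := by
        rw [← hm₁]
        funext A
        exact hf₂.2 A (by simp [testPairs, Cmd.for, Cmd.warr])
      have hcell : (Expr.cell 11 7 3 8).eval s₂ = bit m i := by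
        rw [Expr.eval_cell, r7, hp₂.ctx.r3, r8, hp₂.bit m hm i (by omega)]
      have hstep : ∀ q : ℕ → Prop, (∀ i' < i + 1, i' ∈ bits k m → q i') ↔
          (∀ i' < i, i' ∈ bits k m → q i') ∧ (bit m i ≠ 0 → q i) := by
        intro q
        constructor
        · exact fun H => ⟨fun j' hj' => H j' (by omega),
            fun hb => H i (by omega) (mem_bits.2 ⟨by omega, hb⟩)⟩
        · rintro ⟨H1, H2⟩ j' hj' hb
          rcases Nat.lt_succ_iff_lt_or_eq.1 hj' with hlt | rfl
          · exact H1 j' hlt hb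
          · exact H2 (mem_bits.1 hb).2
      refine (Env.runs_ite hs₂ rfl (fun hb => ?_) (fun hb => ?_)
        (T := (k + 2) * 200 + 120)).weaken (?_ : _ ≤ (k + 2) * 200 + 250) fun _ _ _ h => h
      · rw [hcell] at hb
        have hcard : ((bits k m).filter (· < i + 1)).card =
            ((bits k m).filter (· < i)).card + 1 := by
          have : (bits k m).filter (· < i + 1) = insert i ((bits k m).filter (· < i)) := by
            ext j
            have : i ∈ bits k m := mem_bits.2 ⟨by omega, hb⟩
            simp only [Finset.mem_filter, Finset.mem_insert]
            constructor
            · rintro ⟨h1, h2⟩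
              by_cases hj : j = i
              · exact .inl hj
              · exact .inr ⟨h1, by omega⟩
            · rintro (rfl | ⟨h1, h2⟩)
              · exact ⟨this, by omega⟩
              · exact ⟨h1, by omega⟩
          rw [this, Finset.card_insert_of_notMem (by simp)]
        have hle : ((bits k m).filter (· < i)).card ≤ k + 1 :=
          (Finset.card_le_card (Finset.filter_subset _ _)).trans
            ((Finset.card_filter_le _ _).trans (by simp))
        refine (Env.Runs.seq (Env.runs_flat hs₂ rfl ?_ (Q := fun s' =>
          s'.mem = s.mem ∧ s'.reg 6 = v ∧ s'.reg 7 = m ∧ s'.reg 10 = s₂.reg 10 ∧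
          s'.reg 11 = ((bits k m).filter (· < i + 1)).card ∧
          s'.reg 13 = s.mem 8 (v * (k + 1) + i)) ?_) ?_ (T₂ := (k + 2) * 200 + 50)).weaken ?_
            fun _ _ _ h => h
        · have h1 := hs₂.mem_lt 8 (v * (k + 1) + i)
          simp [Cmd.Safe, Cmd.den, Expr.eval, State.setReg_reg, h11, r6, r8, hp₂.ctx.r3, h1]
          omega
        · simp [Cmd.den, Expr.eval, State.setReg_reg, h11, r6, r7, r8, hp₂.ctx.r3, hm₂]
          simp only [Nat.lt_succ_iff] at hcard
          exact hcard.symm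
        · rintro s₃ hs₃ hf₃ ⟨hm₃, r6, r7, r10, r11, r13⟩
          have hp₃ := hp₂.frame hf₃ (by decide) (by decide)
          simp only [hstep, State.setReg_reg]
          refine (Env.runs_ite hs₃ rfl (fun h0 => ?_) (fun h0 => ?_)
            (T := (k + 2) * 200 + 10)).weaken (?_ : _ ≤ (k + 2) * 200 + 50) fun _ _ _ h => h
          · refine (runs_testPairs hs₃ hp₃ r6 r7 hm).weaken (by omega) fun s' hs' hf' hQ => ?_
            have h11 : s'.reg 11 = s₃.reg 11 := hf'.1 11 (by decide)
            have h0 : s.mem 8 (v * (k + 1) + i) ≠ 0 := by rw [← r13]; exact h0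
            refine ⟨?_, by simp [h11, r11]⟩
            simp only [PairOk, hm₃, r13] at hQ ⊢
            rw [if_neg (by decide), hQ, r10, hI]
            simp only [PairOk]
            tauto
          · have h0 : s.mem 8 (v * (k + 1) + i) = 0 := by rw [← r13]; exact h0
            refine (Env.runs_flat hs₃ rfl (?_ : 0 < _) ?_).weaken ?_ fun _ _ _ h => h
            · omega
            · simp [Cmd.den, Expr.eval, State.setReg_reg, h0, hb, r11]
            · have : Cmd.tick (.assign 10 (.const 0)) ≤ 10 := by decide
              omega
          · have : (Expr.reg 13).tick + (Expr.reg 13).growth + 1 ≤ 40 := by decide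
            omega
        · have : Cmd.tick (.seq (.assign 11 (.add (.reg 11) (.const 1)))
            (.assign 13 (.cell 8 6 3 8))) ≤ 70 := by decide
          omega
      · rw [hcell] at hb
        have hcard : (bits k m).filter (· < i + 1) = (bits k m).filter (· < i) := by
          refine Finset.filter_congr fun j hj => ?_
          have : j ≠ i := by
            rintro rfl
            exact (mem_bits.1 hj).2 hb
          omega
        refine (Env.runs_flat (p := .skip) hs₂ rfl trivial ?_).weaken ?_ fun _ _ _ h => h
        · rw [hstep, hcard]
          simp only [Cmd.den, State.setReg_reg]
          simp [hb, hI, h11]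
        · have : Cmd.tick .skip ≤ 100 := by decide
          omega
      · have : (Expr.cell 11 7 3 8).tick + (Expr.cell 11 7 3 8).growth + 1 ≤ 100 := by decide
        omega
    · rintro s' _ _ ⟨hI, h11⟩
      have hlt : ∀ i ∈ bits k m, i < k + 1 := fun i hi => by
        have := (mem_bits.1 hi).1
        omega
      refine ⟨hI.trans (and_congr_right fun _ => ?_), ?_⟩
      · exact ⟨fun H i hi => H i (hlt i hi) hi, fun H i _ hi => H i hi⟩
      · rw [h11, Finset.filter_true_of_mem hlt]
  · have : Cmd.tick (.seq (.assign 10 (.const 1)) <| .seq (.assign 11 (.const 0)) <|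
      .seq (.assign 12 (.load 7 (.reg 6))) <|
        .ite (.cell 11 7 3 12) .skip (.assign 10 (.const 0))) ≤ 100 := by decide
    nlinarith

/-- Store in the array `14`, for each mask, whether it encodes a clique that contains the vertex in
register `6`, has a size in `γ`, and lies in the row of this vertex. -/
def markMasks : Cmd :=
  .for 7 4 <| .seq testMask <|
    .ite (.reg 10) (.store 14 (.reg 7) (.load 3 (.reg 11))) (.store 14 (.reg 7) (.const 0))

open Classical in
theorem runs_markMasks (hB : Fits n N k E.B) (hs : Bdd E.B s) (hp : Prepared γ h k s)
    {v : Fin n} (h6 : s.reg 6 = v) :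
    E.Runs markMasks s ((2 ^ (k + 1) + 1) * ((k + 2) * ((k + 2) * 500))) fun s' =>
      ∀ m < 2 ^ (k + 1), s'.mem 14 m =
        if MaskOk n k s v m ∧ (bits k m).card ∈ γ then 1 else 0 := by
  have hN := hB.node
  refine (Env.runs_for (T := 100 + (k + 2) * ((k + 2) * 400) + 50) (by decide) (by decide) hs
    hp.ctx.r4 (fun i s' => ∀ m < i, s'.mem 14 m =
        if MaskOk n k s v m ∧ (bits k m).card ∈ γ then 1 else 0) (by simp) ?_
          fun _ _ _ h => h).weaken ?_ fun _ _ _ h => h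
  · rintro m hm s₁ hs₁ hf₁ r7 hI
    have hp₁ := hp.frame hf₁ (by decide) (by decide)
    have r6 : s₁.reg 6 = v := (hf₁.1 6 (by decide)).trans h6
    refine Env.Runs.seq (runs_testMask hB hs₁ hp₁ r6 r7 hm) ?_
    rintro s₂ hs₂ hf₂ ⟨h10, h11⟩
    have hp₂ := hp₁.frame hf₂ (by decide) (by decide)
    have hle : (bits k m).card ≤ k + 1 := (Finset.card_filter_le _ _).trans (by simp)
    have hsz := hp₂.sizes _ hle
    have hok : MaskOk n k s₁ v m ↔ MaskOk n k s v m := by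
      simp only [MaskOk, PairOk, hf₁.2 7 (by decide), hf₁.2 8 (by decide), hf₁.2 0 (by decide)]
    have r7 : s₂.reg 7 = m := (hf₂.1 7 (by decide)).trans r7
    have hm14 : s₂.mem 14 = s₁.mem 14 := hf₂.2 14 (by decide)
    refine (Env.runs_flat hs₂ rfl ?_ ?_).weaken (by decide) fun _ _ _ h => h
    · have := hs₂.mem_lt 3 (bits k m).card
      simp [Cmd.Safe, Expr.eval, h11, this]
      omega
    · intro m' hm'
      simp only [Cmd.den, Expr.eval, State.setReg_mem, h10, hok, h11, r7, hsz]
      by_cases hmk : MaskOk n k s v m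
      · simp only [hmk, if_true, true_and, State.setMem_mem]
        rcases Nat.lt_succ_iff_lt_or_eq.1 hm' with hlt | rfl
        · rw [if_neg hlt.ne, hm14, hI m' hlt]
        · simp [hmk]
      · simp only [hmk, if_false, State.setMem_mem]
        rcases Nat.lt_succ_iff_lt_or_eq.1 hm' with hlt | rfl
        · rw [if_neg (by omega), hm14, hI m' hlt]
        · simp [hmk]
  · refine Nat.mul_le_mul_left _ ?_
    nlinarith

/-- The zeta transform of the array `14`. -/
def zetaTransform : Cmd :=
  .for 8 3 <| .for 7 4 <| .ite (.cell 11 7 3 8)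
    (.store 14 (.reg 7) (.add (.load 14 (.reg 7))
      (.load 14 (.sub (.reg 7) (.load 12 (.reg 8))))))
    .skip

/-- The partial sum after the colours `c < j` have been treated. -/
def partialZeta (f : Finset ℕ → ℕ) (j : ℕ) (A : Finset ℕ) : ℕ :=
  ∑ S ∈ A.powerset with ∀ c ∈ A, c ∉ S → c < j, f S

theorem partialZeta_zero (f : Finset ℕ → ℕ) (A : Finset ℕ) : partialZeta f 0 A = f A := by
  have : (A.powerset.filter fun S => ∀ c ∈ A, c ∉ S → c < 0) = {A} := by
    ext S
    simp only [Finset.mem_filter, Finset.mem_powerset, Finset.mem_singleton]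
    constructor
    · rintro ⟨h1, h2⟩
      exact h1.antisymm fun c hc => by_contra fun hcs => Nat.not_lt_zero _ (h2 c hc hcs)
    · rintro rfl
      exact ⟨subset_rfl, fun c hc hcs => absurd hc hcs⟩
  rw [partialZeta, this, Finset.sum_singleton]

theorem partialZeta_of_lt (f : Finset ℕ → ℕ) {j : ℕ} {A : Finset ℕ} (hA : ∀ c ∈ A, c < j) :
    partialZeta f j A = ∑ S ∈ A.powerset, f S := by
  rw [partialZeta, Finset.filter_true_of_mem fun _ _ c hc _ => hA c hc]

theorem partialZeta_succ_of_notMem (f : Finset ℕ → ℕ) {j : ℕ} {A : Finset ℕ} (hj : j ∉ A) :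
    partialZeta f (j + 1) A = partialZeta f j A := by
  unfold partialZeta
  congr 1
  refine Finset.filter_congr fun S _ => forall₂_congr fun c hc => ?_
  have : c ≠ j := fun he => hj (he ▸ hc)
  constructor <;> intro H hcs <;> have := H hcs <;> omega

/-- Split the summation sets by whether they contain `j`. With `j`, they may omit only colours below
`j`; without `j`, they are subsets of `A`, the omission of `j` having just become allowed. -/
theorem partialZeta_insert (f : Finset ℕ → ℕ) {j : ℕ} {A : Finset ℕ} (hj : j ∉ A) :
    partialZeta f (j + 1) (insert j A) = partialZeta f j (insert j A) + partialZeta f j A := by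
  unfold partialZeta
  rw [← Finset.sum_filter_add_sum_filter_not _ (fun S => j ∈ S), Finset.filter_filter,
    Finset.filter_filter]
  congr 1
  · refine Finset.sum_congr (Finset.filter_congr fun S _ => ?_) fun _ _ => rfl
    constructor
    · rintro ⟨h1, h2⟩ c hc hcs
      have := h1 c hc hcs
      have : c ≠ j := fun he => hcs (he ▸ h2)
      omega
    · intro H
      refine ⟨fun c hc hcs => by have := H c hc hcs; omega, ?_⟩
      by_contra hjS
      exact lt_irrefl _ (H j (Finset.mem_insert_self _ _) hjS)
  · refine Finset.sum_congr ?_ fun _ _ => rfl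
    ext S
    simp only [Finset.mem_filter, Finset.mem_powerset]
    constructor
    · rintro ⟨h1, h2, h3⟩
      refine ⟨(Finset.subset_insert_iff_of_notMem h3).1 h1, fun c hc hcs => ?_⟩
      have := h2 c (Finset.mem_insert_of_mem hc) hcs
      have : c ≠ j := fun he => hj (he ▸ hc)
      omega
    · rintro ⟨h1, h2⟩
      refine ⟨h1.trans (Finset.subset_insert _ _), fun c hc hcs => ?_, fun hjS => hj (h1 hjS)⟩
      rcases Finset.mem_insert.1 hc with rfl | hc
      · omega
      · have := h2 c hc hcs
        omega

theorem partialZeta_le (f : Finset ℕ → ℕ) (j : ℕ) (A : Finset ℕ) :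
    partialZeta f j A ≤ ∑ S ∈ A.powerset, f S :=
  Finset.sum_le_sum_of_subset (Finset.filter_subset _ _)

/-- One round per colour instead of one sum per mask: `k + 1` rounds of `2 ^ (k + 1)` additions.
Partial sums never exceed the full sum, so the bound on the latter suffices. -/
theorem runs_zetaTransform (hs : Bdd E.B s) (hp : Prepared γ h k s)
    (f : Finset ℕ → ℕ) (hf : ∀ m < 2 ^ (k + 1), s.mem 14 m = f (bits k m))
    (hlim : ∀ A : Finset ℕ, ∑ S ∈ A.powerset, f S < lim E.B) :
    E.Runs zetaTransform s ((k + 2) * ((2 ^ (k + 1) + 1) * 200 + 21)) fun s' =>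
      ∀ m < 2 ^ (k + 1), s'.mem 14 m = ∑ S ∈ (bits k m).powerset, f S := by
  refine Env.runs_for (by decide) (by decide) hs hp.ctx.r3
    (fun j s' => ∀ m < 2 ^ (k + 1), s'.mem 14 m = partialZeta f j (bits k m)) ?_ ?_ ?_
  · intro m hm
    rw [State.setReg_mem, hf m hm, partialZeta_zero]
  · rintro j hj s₁ hs₁ hf₁ r8 hI
    have hp₁ := hp.frame hf₁ (by decide) (by decide)
    refine Env.runs_for (T := 179) (by decide) (by decide) hs₁ hp₁.ctx.r4
      (fun i s' => ∀ m < 2 ^ (k + 1), s'.mem 14 m =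
        partialZeta f (if m < i then j + 1 else j) (bits k m)) (by simpa using hI) ?_ ?_
    · rintro m hm s₂ hs₂ hf₂ r7 hI₂
      have hp₂ := hp₁.frame hf₂ (by decide) (by decide)
      have r8 : s₂.reg 8 = j := (hf₂.1 8 (by decide)).trans r8
      have hcell : (Expr.cell 11 7 3 8).eval s₂ = bit m j := by
        rw [Expr.eval_cell, r7, hp₂.ctx.r3, r8, hp₂.bit m hm j (by omega)]
      have hpow := hp₂.pow j (by omega)
      have hm₀ := hI₂ m hm
      rw [if_neg (lt_irrefl _)] at hm₀
      have hother : ∀ m' < 2 ^ (k + 1), m' ≠ m → s₂.mem 14 m' =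
          partialZeta f (if m' < m + 1 then j + 1 else j) (bits k m') := by
        intro m' hm' hne
        rw [hI₂ m' hm']
        congr 2
        simp only [eq_iff_iff]
        omega
      by_cases hb : bit m j = 0
      · refine (Env.runs_flat hs₂ rfl ?_ ?_).weaken (by decide) fun _ _ _ h => h
        · simp only [Cmd.Safe, hcell, hb]
          simp
        · intro m' hm'
          simp only [Cmd.den, hcell, hb, State.setReg_mem]
          rw [if_neg (not_not.2 rfl)]
          by_cases he : m' = m
          · subst he
            rw [hm₀, if_pos (Nat.lt_succ_self _), partialZeta_succ_of_notMem]
            exact fun h => (mem_bits.1 h).2 hb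
          · exact hother m' hm' he
      · have hle := two_pow_le_of_bit hb
        -- The smaller mask has already been treated in this round, but it lacks the colour `j`, so
        -- its entry is unchanged; the transform can be done in place.
        have hlo : s₂.mem 14 (m - 2 ^ j) = partialZeta f j (bits k (m - 2 ^ j)) := by
          have hpos : 0 < 2 ^ j := by positivity
          rw [hI₂ _ (by omega), if_pos (by omega), partialZeta_succ_of_notMem]
          exact fun h => (mem_bits.1 h).2 (bit_sub_two_pow hb)
        have hsum : s₂.mem 14 m + s₂.mem 14 (m - 2 ^ j) = partialZeta f (j + 1) (bits k m) := by
          rw [hm₀, hlo, bits_sub_two_pow (by omega) hb, partialZeta_insert]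
          exact fun h => (mem_bits.1 h).2 (bit_sub_two_pow hb)
        refine (Env.runs_flat hs₂ rfl ?_ ?_).weaken (by decide) fun _ _ _ h => h
        · simp only [Cmd.Safe, hcell]
          rw [if_pos hb]
          simp only [Expr.eval, r7, r8, hpow, hsum]
          exact (partialZeta_le _ _ _).trans_lt (hlim _)
        · intro m' hm'
          simp only [Cmd.den, hcell, State.setReg_mem]
          rw [if_pos hb]
          simp only [Expr.eval, r7, r8, hpow, hsum, State.setMem_mem]
          by_cases he : m' = m
          · subst he
            simp
          · rw [if_neg fun h => he h.2]
            exact hother m' hm' he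
    · intro s' _ _ hI' m hm
      rw [State.setReg_mem, hI' m hm, if_pos hm]
  · intro s' _ _ hI m hm
    rw [hI m hm, partialZeta_of_lt]
    intro c hc
    have := (mem_bits.1 hc).1
    omega

end RAM

/-! ### The clique tables -/

namespace RAM

open Classical in
/-- The cliques with sizes in `γ`. -/
noncomputable def cliques (γ : Set ℕ) {n : ℕ} (G : SimpleGraph (Fin n)) : Finset (Finset (Fin n)) :=
  Finset.univ.filter fun K => G.IsClique (K : Set (Fin n)) ∧ K.card ∈ γ

variable {γ : Set ℕ} {E : Env} {n N k : ℕ} {s : State} {G : SimpleGraph (Fin n)}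
  {D : TreeDecomposition G (Fin N)} {o : ℕ → Fin N} {h : NodeOrder D o}

theorem mem_cliques {K : Finset (Fin n)} :
    K ∈ cliques γ G ↔ G.IsClique (K : Set (Fin n)) ∧ K.card ∈ γ := by
  simp [cliques]

/-- The vertices of a bag whose colours belong to a mask. -/
noncomputable def decode (h : NodeOrder D o) (k : ℕ) (col : ℕ → ℕ) (m : ℕ)
    (p : Option (Fin n)) : Finset (Fin n) :=
  (h.elimination.obag p).filter fun u : Fin n => col u ∈ bits k m

theorem mem_decode {col : ℕ → ℕ} {m : ℕ} {v u : Fin n} :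
    u ∈ decode h k col m (some v) ↔ u ∈ insert v (h.nbr v) ∧ col u ∈ bits k m := by
  rw [decode, Finset.mem_filter]
  rfl

theorem Prepared.col_le (hp : Prepared γ h k s) (u : Fin n) : s.mem 7 u ≤ k :=
  hp.intro.col_le u (key_lt h u)

/-- Distinct colours on the bag of `v` make masks and vertex sets correspond. A mask with a colour
absent from the bag meets an empty slot and is rejected, so each clique is marked by exactly one
mask. -/
theorem Prepared.maskOk_iff (hp : Prepared γ h k s) {v : Fin n} {m : ℕ} :
    MaskOk n k s v m ∧ (bits k m).card ∈ γ ↔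
      ∃ K ∈ h.elimination.topped (cliques γ G) v,
        K.image (fun u : Fin n => s.mem 7 u) = bits k m := by
  have hinj := hp.intro.col_inj v (key_lt h v)
  have hslot := hp.intro.slot v (key_lt h v)
  have hcard : ∀ K ⊆ insert v (h.nbr v), (K.image fun u : Fin n => s.mem 7 u).card = K.card :=
    fun K hK => Finset.card_image_of_injOn fun u hu w hw => hinj u (hK hu) w (hK hw)
  constructor
  · rintro ⟨⟨hv, hm⟩, hγ⟩
    have himg : (decode h k (s.mem 7) m (some v)).image (fun u : Fin n => s.mem 7 u) =
        bits k m := by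
      ext c
      rw [Finset.mem_image]
      constructor
      · rintro ⟨u, hu, rfl⟩
        exact (mem_decode.1 hu).2
      · intro hc
        obtain ⟨w, hw, rfl⟩ := hp.intro.slot_ne v (key_lt h v) c (mem_bits.1 hc).1 (hm c hc).1
        exact ⟨w, mem_decode.2 ⟨hw, hc⟩, rfl⟩
    have hsub : decode h k (s.mem 7) m (some v) ⊆ insert v (h.nbr v) :=
      fun u hu => (mem_decode.1 hu).1
    refine ⟨decode h k (s.mem 7) m (some v), ?_, himg⟩
    refine Finset.mem_filter.2 ⟨mem_cliques.2 ⟨fun u hu w hw huw => ?_, ?_⟩, ?_, hsub⟩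
    · obtain ⟨hu, hu'⟩ := mem_decode.1 hu
      obtain ⟨hw, hw'⟩ := mem_decode.1 hw
      have := (hm _ hu').2 _ hw'
      simp only [PairOk, hslot u hu, hslot w hw] at this
      rw [← hp.input.adj]
      exact this (by omega) fun he => huw (Fin.ext (by omega))
    · rwa [← hcard _ hsub, himg]
    · exact mem_decode.2 ⟨Finset.mem_insert_self _ _, mem_bits.2 ⟨hp.col_le v, hv⟩⟩
  · rintro ⟨K, hK, himg⟩
    obtain ⟨hK, hvK, hsub⟩ := Finset.mem_filter.1 hK
    obtain ⟨hcl, hγ⟩ := mem_cliques.1 hK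
    have hbits : ∀ c, c ∈ bits k m ↔ ∃ u ∈ K, s.mem 7 u = c := fun c => by
      rw [← himg, Finset.mem_image]
    refine ⟨⟨(mem_bits.1 ((hbits _).2 ⟨v, hvK, rfl⟩)).2, fun c hc => ?_⟩, ?_⟩
    · obtain ⟨u, hu, rfl⟩ := (hbits c).1 hc
      rw [hslot u (hsub hu)]
      refine ⟨by omega, fun d hd => ?_⟩
      obtain ⟨w, hw, rfl⟩ := (hbits d).1 hd
      simp only [PairOk, hslot w (hsub hw)]
      intro _ hne
      exact (hp.input.adj u w).2 (hcl hu hw fun he => hne (by rw [he]))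
    · rwa [← himg, hcard K hsub]

open Classical in
/-- The indicator of the sets of colours of the cliques assigned to a vertex. -/
noncomputable def colourSets (γ : Set ℕ) (h : NodeOrder D o) (col : ℕ → ℕ) (v : Fin n)
    (A : Finset ℕ) : ℕ :=
  if ∃ K ∈ h.elimination.topped (cliques γ G) v, K.image (fun u : Fin n => col u) = A then 1 else 0

theorem sum_colourSets (A : Finset ℕ) (col : ℕ → ℕ) (v : Fin n) :
    ∑ S ∈ A.powerset, colourSets γ h col v S =
      (((h.elimination.topped (cliques γ G) v).image fun K => K.image fun u : Fin n => col u).filter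
        (· ⊆ A)).card := by
  classical
  simp only [colourSets]
  rw [Finset.sum_boole, Nat.cast_id]
  congr 1
  ext S
  simp only [Finset.mem_filter, Finset.mem_powerset, Finset.mem_image]
  tauto

theorem sum_colourSets_le (hk : D.HasWidth k) (A : Finset ℕ) (col : ℕ → ℕ) (v : Fin n) :
    ∑ S ∈ A.powerset, colourSets γ h col v S ≤ 2 ^ k := by
  rw [sum_colourSets]
  exact (Finset.card_filter_le _ _).trans (Finset.card_image_le.trans
    ((h.elimination.card_topped_le v).trans
      (Nat.pow_le_pow_right two_pos (h.card_nbr_le hk v))))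

/-- Passing to colours is injective on cliques with last vertex `v` and respects inclusion, so the
summed indicators count the cliques inside the decoded set. -/
theorem Prepared.sum_colourSets_bits (hp : Prepared γ h k s) (v : Fin n) (m : ℕ) :
    ∑ S ∈ (bits k m).powerset, colourSets γ h (s.mem 7) v S =
      ((h.elimination.topped (cliques γ G) v).filter
        (· ⊆ decode h k (s.mem 7) m (some v))).card := by
  have hinj := hp.intro.col_inj v (key_lt h v)
  rw [sum_colourSets, Finset.filter_image, Finset.card_image_of_injOn]
  · congr 1
    refine Finset.filter_congr fun K hK => ?_
    have hsub := (Finset.mem_filter.1 hK).2.2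
    rw [Finset.image_subset_iff]
    exact ⟨fun H u hu => mem_decode.2 ⟨hsub hu, H u hu⟩, fun H u hu => (mem_decode.1 (H hu)).2⟩
  · intro K hK L hL hKL
    have hK := (Finset.mem_filter.1 (Finset.mem_filter.1 hK).1).2.2
    have hL := (Finset.mem_filter.1 (Finset.mem_filter.1 hL).1).2.2
    have key : ∀ K ⊆ insert v (h.nbr v), ∀ L ⊆ insert v (h.nbr v),
        K.image (fun u : Fin n => s.mem 7 u) = L.image (fun u : Fin n => s.mem 7 u) → K ⊆ L := by
      intro K hK L hL he u hu
      have : s.mem 7 u ∈ L.image fun u : Fin n => s.mem 7 u :=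
        he ▸ Finset.mem_image_of_mem (fun u : Fin n => s.mem 7 u) hu
      obtain ⟨w, hw, hwu⟩ := Finset.mem_image.1 this
      rwa [← hinj w (hL hw) u (hK hu) hwu]
    exact (key K hK L hL hKL).antisymm (key L hL K hK hKL.symm)

/-- The polynomials of a vertex are stored in the array `15`. -/
def Stored (h : NodeOrder D o) (k : ℕ) (s : State) (T : Option (Fin n) → Finset (Fin n) → Polynomial ℕ)
    (p : Option (Fin n)) : Prop :=
  ∀ m < 2 ^ (k + 1), ∀ d ≤ n, s.mem 15 ((code p * 2 ^ (k + 1) + m) * (n + 1) + d) =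
    (T p (decode h k (s.mem 7) m p)).coeff d

/-- Compute the polynomials for the vertex in register `6` from the numbers of cliques. -/
def storePowers : Cmd :=
  .for 7 4 <| .seq
    (.seq (.assign 10 (.load 14 (.reg 7)))
      (.assign 11 (.add (.mul (.reg 6) (.reg 4)) (.add (.reg 4) (.reg 7)))))
    (.for 8 5 (.store 15 (.addr 11 5 8) (.load 13 (.addr 10 5 8))))

/-- The rows of the root, whose code is `0`, start as the constant polynomial `1`. -/
def storeOne : Cmd :=
  .for 7 4 <| .for 8 5 <| .store 15 (.addr 7 5 8) (.eq (.reg 8) (.const 0))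

def cliqueTables : Cmd :=
  .seq (.for 6 0 <| .seq markMasks <| .seq zetaTransform storePowers) storeOne

theorem Fits.row_lt {n N k B : ℕ} (hB : Fits n N k B) {v m : ℕ} (hv : v ≤ n)
    (hm : m < 2 ^ (k + 1)) : v * 2 ^ (k + 1) + m < lim B := by
  have h1 : (v + 1) * 2 ^ (k + 1) ≤ (n + 1) * 2 ^ (k + 1) := Nat.mul_le_mul_right _ (by omega)
  have h2 := hB.addr
  nlinarith [Nat.zero_le (n * n * 2 ^ (k + 1)), Nat.zero_le (n * 2 ^ (k + 1)),
    Nat.zero_le (2 ^ (k + 1))]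

theorem runs_storePowers (hB : Fits n N k E.B) (hs : Bdd E.B s) (hp : Prepared γ h k s)
    {v : ℕ} (hv : v < n) (h6 : s.reg 6 = v) {c : ℕ → ℕ}
    (hc : ∀ m < 2 ^ (k + 1), s.mem 14 m = c m) (hlt : ∀ m < 2 ^ (k + 1), c m < 2 ^ (k + 1)) :
    E.Runs storePowers s ((2 ^ (k + 1) + 1) * ((n + 2) * 200)) fun s' =>
      (∀ m < 2 ^ (k + 1), ∀ d ≤ n,
        s'.mem 15 (((v + 1) * 2 ^ (k + 1) + m) * (n + 1) + d) = (c m).choose d) ∧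
      ∀ u ≠ v + 1, ∀ m < 2 ^ (k + 1), ∀ d ≤ n,
        s'.mem 15 ((u * 2 ^ (k + 1) + m) * (n + 1) + d) =
          s.mem 15 ((u * 2 ^ (k + 1) + m) * (n + 1) + d) := by
  refine (Env.runs_for (T := 50 + (n + 2) * 121) (by decide) (by decide) hs hp.ctx.r4
    (fun i s' => (∀ m < i, ∀ d ≤ n,
        s'.mem 15 (((v + 1) * 2 ^ (k + 1) + m) * (n + 1) + d) = (c m).choose d) ∧
      ∀ u ≠ v + 1, ∀ m < 2 ^ (k + 1), ∀ d ≤ n,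
        s'.mem 15 ((u * 2 ^ (k + 1) + m) * (n + 1) + d) =
          s.mem 15 ((u * 2 ^ (k + 1) + m) * (n + 1) + d)) (by simp) ?_
            fun _ _ _ h => h).weaken (Nat.mul_le_mul_left _ (by omega)) fun _ _ _ h => h
  rintro m hm s₁ hs₁ hf₁ r7 ⟨hI, hI'⟩
  have hp₁ := hp.frame hf₁ (by decide) (by decide)
  have r6 : s₁.reg 6 = v := (hf₁.1 6 (by decide)).trans h6
  have hm14 : s₁.mem 14 m = c m := by rw [hf₁.2 14 (by decide), hc m hm]
  have hrow : v * 2 ^ (k + 1) + (2 ^ (k + 1) + m) = (v + 1) * 2 ^ (k + 1) + m := by ring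
  refine (Env.Runs.seq (Env.runs_flat hs₁ rfl ?_ (Q := fun s' => s'.mem = s₁.mem ∧
    s'.reg 10 = c m ∧ s'.reg 11 = (v + 1) * 2 ^ (k + 1) + m) ?_) ?_
      (T₂ := (n + 2) * 121)).weaken (Nat.add_le_add_right (by decide) _) fun _ _ _ h => h
  · have h1 := hs₁.mem_lt 14 m
    have h2 := hB.row_lt (v := v + 1) hv hm
    simp [Cmd.Safe, Cmd.den, Expr.eval, State.setReg_reg, r6, r7, hp₁.ctx.r4, h1, hrow, h2]
  · simp [Cmd.den, Expr.eval, State.setReg_reg, r6, r7, hp₁.ctx.r4, hm14, hrow]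
  · rintro s₂ hs₂ hf₂ ⟨hm₂, r10, r11⟩
    have hp₂ := hp₁.frame hf₂ (by decide) (by decide)
    refine Env.runs_for (T := 100) (by decide) (by decide) hs₂ hp₂.ctx.r5
      (fun i s' => (∀ d < i,
          s'.mem 15 (((v + 1) * 2 ^ (k + 1) + m) * (n + 1) + d) = (c m).choose d) ∧
        (∀ m' < m, ∀ d ≤ n,
          s'.mem 15 (((v + 1) * 2 ^ (k + 1) + m') * (n + 1) + d) = (c m').choose d) ∧
        ∀ u ≠ v + 1, ∀ m < 2 ^ (k + 1), ∀ d ≤ n,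
          s'.mem 15 ((u * 2 ^ (k + 1) + m) * (n + 1) + d) =
            s.mem 15 ((u * 2 ^ (k + 1) + m) * (n + 1) + d)) ?_ ?_ ?_
    · simp only [State.setReg_mem, hm₂]
      exact ⟨by simp, hI, hI'⟩
    · rintro d hd s₃ hs₃ hf₃ r8 ⟨h1, h2, h3⟩
      have hp₃ := hp₂.frame hf₃ (by decide) (by decide)
      have r10 : s₃.reg 10 = c m := (hf₃.1 10 (by decide)).trans r10
      have r11 : s₃.reg 11 = (v + 1) * 2 ^ (k + 1) + m := (hf₃.1 11 (by decide)).trans r11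
      have hch := hp₃.choose _ (hlt m hm) d (by omega)
      refine (Env.runs_flat hs₃ rfl ?_ ?_).weaken (by decide) fun _ _ _ h => h
      · exact hs₃.mem_lt _ _
      · simp only [Cmd.den, Expr.eval, Expr.eval_addr, r8, r10, r11, hp₃.ctx.r5, hch,
          State.setReg_mem, State.setMem_mem, true_and]
        refine ⟨fun d' hd' => ?_, fun m' hm' d' hd' => ?_, fun u hu m' hm' d' hd' => ?_⟩
        · rcases Nat.lt_succ_iff_lt_or_eq.1 hd' with hlt | rfl
          · rw [if_neg (by omega), h1 d' hlt]
          · rw [if_pos rfl]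
        · rw [if_neg, h2 m' hm' d' hd']
          rw [addr_inj (by omega) hd]
          omega
        · rw [if_neg, h3 u hu m' hm' d' hd']
          rw [addr_inj (by omega) hd, addr_inj hm' hm]
          exact fun h => hu h.1.1
    · rintro s₃ hs₃ hf₃ ⟨h1, h2, h3⟩
      refine ⟨fun m' hm' d hd => ?_, h3⟩
      rcases Nat.lt_succ_iff_lt_or_eq.1 hm' with hlt | rfl
      · exact h2 m' hlt d hd
      · exact h1 d (by omega)

theorem runs_storeOne (hB : Fits n N k E.B) (hs : Bdd E.B s) (hp : Prepared γ h k s) :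
    E.Runs storeOne s ((2 ^ (k + 1) + 1) * ((n + 2) * 200)) fun s' =>
      (∀ m < 2 ^ (k + 1), ∀ d ≤ n, s'.mem 15 (m * (n + 1) + d) = if d = 0 then 1 else 0) ∧
      ∀ i, 2 ^ (k + 1) ≤ i → ∀ d ≤ n, s'.mem 15 (i * (n + 1) + d) = s.mem 15 (i * (n + 1) + d) := by
  have hN := hB.node
  refine (Env.runs_for (T := (n + 2) * 121) (by decide) (by decide) hs hp.ctx.r4
    (fun j s' => (∀ m < j, ∀ d ≤ n, s'.mem 15 (m * (n + 1) + d) = if d = 0 then 1 else 0) ∧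
      ∀ i, 2 ^ (k + 1) ≤ i → ∀ d ≤ n, s'.mem 15 (i * (n + 1) + d) = s.mem 15 (i * (n + 1) + d))
      (by simp) ?_
      fun _ _ _ h => h).weaken (Nat.mul_le_mul_left _ (by omega)) fun _ _ _ h => h
  rintro m hm s₁ hs₁ hf₁ r7 ⟨hI, hI'⟩
  have hp₁ := hp.frame hf₁ (by decide) (by decide)
  refine Env.runs_for (T := 100) (by decide) (by decide) hs₁ hp₁.ctx.r5
    (fun j s' => (∀ d < j, s'.mem 15 (m * (n + 1) + d) = if d = 0 then 1 else 0) ∧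
      (∀ m' < m, ∀ d ≤ n, s'.mem 15 (m' * (n + 1) + d) = if d = 0 then 1 else 0) ∧
      ∀ i, 2 ^ (k + 1) ≤ i → ∀ d ≤ n, s'.mem 15 (i * (n + 1) + d) = s.mem 15 (i * (n + 1) + d))
      ⟨by simp, hI, hI'⟩ ?_ ?_
  · rintro d hd s₂ hs₂ hf₂ r8 ⟨h1, h2, h3⟩
    have hp₂ := hp₁.frame hf₂ (by decide) (by decide)
    have r7 : s₂.reg 7 = m := (hf₂.1 7 (by decide)).trans r7
    refine (Env.runs_flat hs₂ rfl ?_ ?_).weaken (by decide) fun _ _ _ h => h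
    · refine lt_of_le_of_lt (?_ : (if s₂.reg 8 = 0 then 1 else 0) ≤ 1) (by omega)
      split_ifs <;> omega
    · simp only [Cmd.den, Expr.eval, Expr.eval_addr, r8, r7, hp₂.ctx.r5,
        State.setReg_mem, State.setMem_mem, true_and]
      refine ⟨fun d' hd' => ?_, fun m' hm' d' hd' => ?_, fun i hi d' hd' => ?_⟩
      · rcases Nat.lt_succ_iff_lt_or_eq.1 hd' with hlt | rfl
        · rw [if_neg (by omega), h1 d' hlt]
        · rw [if_pos rfl]
      · rw [if_neg, h2 m' hm' d' hd']
        rw [addr_inj (by omega) hd]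
        omega
      · rw [if_neg, h3 i hi d' hd']
        rw [addr_inj (by omega) hd]
        omega
  · rintro s₂ hs₂ hf₂ ⟨h1, h2, h3⟩
    refine ⟨fun m' hm' d hd => ?_, h3⟩
    rcases Nat.lt_succ_iff_lt_or_eq.1 hm' with hlt | rfl
    · exact h2 m' hlt d hd
    · exact h1 d (by omega)

/-- The zeta transform yields, for each mask, the exponent `c` of the initial factor `(1 + X) ^ c`,
whose coefficients are copied from the binomial table; `c ≤ 2 ^ k` keeps the lookup inside that
table. -/
theorem runs_cliqueTables (hB : Fits n N k E.B) (hs : Bdd E.B s) (hp : Prepared γ h k s)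
    (hk : D.HasWidth k) :
    E.Runs cliqueTables s ((n + 2) * ((2 ^ (k + 1) + 1) * ((n + 2) * ((n + 2) * 1200)))) fun s' =>
      Prepared γ h k s' ∧ ∀ p, Stored h k s' (h.elimination.initTable (cliques γ G)) p := by
  have hkn := hB.lt
  have hP : 2 ^ k * 2 = 2 ^ (k + 1) := by ring
  have hlim := hB.pow
  refine (Env.Runs.seq
    (Env.runs_for (Q := fun s' => Prepared γ h k s' ∧ ∀ v,
      Stored h k s' (h.elimination.initTable (cliques γ G)) (some v))
      (T := (2 ^ (k + 1) + 1) * ((k + 2) * ((k + 2) * 500)) +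
      ((k + 2) * ((2 ^ (k + 1) + 1) * 200 + 21) + (2 ^ (k + 1) + 1) * ((n + 2) * 200)))
      (by decide) (by decide) hs hp.ctx.r0
    (fun i s' => Prepared γ h k s' ∧ ∀ v : Fin n, v < i →
      Stored h k s' (h.elimination.initTable (cliques γ G)) (some v))
      ⟨hp.congr (by simp [State.setReg_reg]) (by simp), by simp⟩ ?_
      fun s' _ _ h => ⟨h.1, fun v => h.2 v v.2⟩)
    ?_ (T₂ := (2 ^ (k + 1) + 1) * ((n + 2) * 200))).weaken ?_ fun _ _ _ h => h
  · rintro i hi s₁ hs₁ hf₁ r6 ⟨hp₁, hI⟩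
    refine Env.Runs.seq (runs_markMasks hB hs₁ hp₁ (v := ⟨i, hi⟩) r6) ?_
    rintro s₂ hs₂ hf₂ h14
    have hp₂ := hp₁.frame hf₂ (by decide) (by decide)
    refine Env.Runs.seq (runs_zetaTransform hs₂ hp₂
      (colourSets γ h (s₁.mem 7) ⟨i, hi⟩) ?_ ?_) ?_
    · intro m hm
      rw [h14 m hm, colourSets]
      classical exact if_congr hp₁.maskOk_iff rfl rfl
    · intro A
      refine (sum_colourSets_le hk A _ _).trans_lt ?_
      omega
    · rintro s₃ hs₃ hf₃ h14
      have hp₃ := hp₂.frame hf₃ (by decide) (by decide)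
      have r6 : s₃.reg 6 = i := by rw [hf₃.1 6 (by decide), hf₂.1 6 (by decide), r6]
      refine (runs_storePowers hB hs₃ hp₃ hi r6 h14 ?_).weaken le_rfl ?_
      · intro m hm
        refine (sum_colourSets_le hk _ _ _).trans_lt ?_
        have : 0 < 2 ^ k := by positivity
        omega
      · rintro s₄ hs₄ hf₄ ⟨h1, h2⟩
        have hp₄ := hp₃.frame hf₄ (by decide) (by decide)
        refine ⟨hp₄.congr (by simp [State.setReg_reg]) (by simp), fun v hv m hm d hd => ?_⟩
        have h7 : s₄.mem 7 = s₁.mem 7 := by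
          rw [hf₄.2 7 (by decide), hf₃.2 7 (by decide), hf₂.2 7 (by decide)]
        have h15 : s₃.mem 15 = s₁.mem 15 := by
          rw [hf₃.2 15 (by decide), hf₂.2 15 (by decide)]
        rw [State.setReg_mem, h7]
        rcases Nat.lt_succ_iff_lt_or_eq.1 hv with hlt | rfl
        · rw [← hI v hlt m hm d hd, ← h15]
          exact h2 (v + 1) (by omega) m hm d hd
        · refine (h1 m hm d hd).trans ?_
          rw [hp₁.sum_colourSets_bits, Elimination.initTable, Polynomial.coeff_one_add_X_pow,
            Nat.cast_id]
  · rintro s₁ hs₁ hf₁ ⟨hp₁, hI⟩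
    refine (runs_storeOne hB hs₁ hp₁).weaken le_rfl ?_
    rintro s₂ hs₂ hf₂ ⟨h1, h2⟩
    have hp₂ := hp₁.frame hf₂ (by decide) (by decide)
    refine ⟨hp₂, fun p m hm d hd => ?_⟩
    have h7 : s₂.mem 7 = s₁.mem 7 := hf₂.2 7 (by decide)
    cases p with
    | none =>
        simp only [code, zero_mul, zero_add, h1 m hm d hd, Elimination.initTable,
          Polynomial.coeff_one]
    | some v =>
        rw [h7, ← hI v m hm d hd]
        refine h2 _ ?_ d hd
        simp only [code]
        nlinarith [Nat.zero_le ((v : ℕ) * 2 ^ (k + 1))]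
  · have h1 : k + 2 ≤ n + 2 := by omega
    have hP0 : 1 ≤ 2 ^ (k + 1) + 1 := by omega
    generalize 2 ^ (k + 1) + 1 = P at *
    have e1 : P * ((k + 2) * ((k + 2) * 500)) ≤ P * ((n + 2) * ((n + 2) * 500)) := by gcongr
    have e2 : (k + 2) * (P * 200 + 21) ≤ P * ((n + 2) * 221) := by
      calc (k + 2) * (P * 200 + 21) ≤ (n + 2) * (P * 221) := Nat.mul_le_mul h1 (by omega)
        _ = P * ((n + 2) * 221) := by ring
    have e3 : 21 ≤ P * 21 := by omega
    calc _ ≤ (n + 1) * (P * ((n + 2) * ((n + 2) * 500)) + (P * ((n + 2) * 221) +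
          P * ((n + 2) * 200)) + P * 21) + P * ((n + 2) * 200) := by gcongr
      _ = P * ((n + 1) * ((n + 2) * ((n + 2) * 500) + (n + 2) * 421 + 21) + (n + 2) * 200) := by ring
      _ ≤ P * ((n + 2) * ((n + 2) * ((n + 2) * 1200))) := by
          refine Nat.mul_le_mul_left _ ?_
          have h2 : (n + 2) * ((n + 2) * 500) + (n + 2) * 421 + 221 ≤ (n + 2) * ((n + 2) * 1200) := by
            nlinarith
          nlinarith
      _ = _ := by ring

end RAM

/-! ### The dynamic program -/

namespace RAM

variable {γ : Set ℕ} {E : Env} {n N k : ℕ} {s : State} {G : SimpleGraph (Fin n)}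
  {D : TreeDecomposition G (Fin N)} {o : ℕ → Fin N} {h : NodeOrder D o}

/-- The coefficients of a product. -/
def conv (a f : ℕ → ℕ) (d : ℕ) : ℕ := ∑ j ∈ Finset.range (d + 1), a j * f (d - j)

theorem coeff_mul_eq_conv (p q : Polynomial ℕ) (d : ℕ) :
    (p * q).coeff d = conv p.coeff q.coeff d := by
  rw [Polynomial.coeff_mul, conv,
    Finset.Nat.sum_antidiagonal_eq_sum_range_succ fun i j => p.coeff i * q.coeff j]

/-- Multiply the row in register `15` of the array `15` by the polynomial in the array `16`. -/
def convolve : Cmd :=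
  .for 16 5 <| .seq
    (.seq (.assign 17 (.sub (.reg 0) (.reg 16))) <| .seq (.assign 18 (.const 0))
      (.assign 19 (.add (.reg 17) (.const 1)))) <|
    .seq (.for 21 19 (.assign 18 (.add (.reg 18)
        (.mul (.cell 15 15 5 21) (.load 16 (.sub (.reg 17) (.reg 21)))))))
      (.store 15 (.addr 15 5 17) (.reg 18))

theorem runs_convolve (hB : Fits n N k E.B) (hs : Bdd E.B s) (hc : Ctx n N k s) {R : ℕ}
    (h15 : s.reg 15 = R) {a f : ℕ → ℕ} (ha : ∀ d ≤ n, s.mem 15 (R * (n + 1) + d) = a d)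
    (hf : ∀ d ≤ n, s.mem 16 d = f d) (hlim : ∀ d ≤ n, conv a f d < lim E.B) :
    E.Runs convolve s ((n + 2) * ((n + 2) * 250)) fun s' =>
      (∀ d ≤ n, s'.mem 15 (R * (n + 1) + d) = conv a f d) ∧
      ∀ i ≠ R, ∀ d ≤ n, s'.mem 15 (i * (n + 1) + d) = s.mem 15 (i * (n + 1) + d) := by
  have hN := hB.node
  refine (Env.runs_for (T := 60 + ((n + 2) * 171 + 40)) (by decide) (by decide) hs hc.r5
    (fun i s' => (∀ d ≤ n, s'.mem 15 (R * (n + 1) + d) = if n < d + i then conv a f d else a d) ∧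
      ∀ i ≠ R, ∀ d ≤ n, s'.mem 15 (i * (n + 1) + d) = s.mem 15 (i * (n + 1) + d)) ?_ ?_ ?_).weaken
      ?_ fun _ _ _ h => h
  · refine ⟨fun d hd => ?_, fun _ _ _ _ => rfl⟩
    rw [State.setReg_mem, ha d hd, if_neg (by omega)]
  · rintro i hi s₁ hs₁ hf₁ r16 ⟨hI, hI'⟩
    have hc₁ := hc.frame hf₁ (by decide)
    have r15 : s₁.reg 15 = R := (hf₁.1 15 (by decide)).trans h15
    have hm16 : s₁.mem 16 = s.mem 16 := hf₁.2 16 (by decide)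
    -- Degrees are treated from `n` downwards: coefficient `d` of the product needs old coefficients
    -- of index at most `d` only, so the row can be overwritten in place.
    obtain ⟨d, hd, rfl⟩ : ∃ d ≤ n, i = n - d := ⟨n - i, by omega, by omega⟩
    have hnd : n - (n - d) = d := by omega
    refine (Env.Runs.seq (Env.runs_flat hs₁ rfl ?_ (Q := fun s' => s'.mem = s₁.mem ∧
      s'.reg 17 = d ∧ s'.reg 18 = 0 ∧ s'.reg 19 = d + 1) ?_) ?_
        (T₂ := (n + 2) * 171 + 40)).weaken (Nat.add_le_add_right (by decide) _) fun _ _ _ h => h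
    · simp [Cmd.Safe, Cmd.den, Expr.eval, State.setReg_reg, r16, hc₁.r0, hnd]
      omega
    · simp [Cmd.den, Expr.eval, State.setReg_reg, r16, hc₁.r0, hnd]
    · rintro s₂ hs₂ hf₂ ⟨hm₂, r17, r18, r19⟩
      have hc₂ := hc₁.frame hf₂ (by decide)
      have r15 : s₂.reg 15 = R := (hf₂.1 15 (by decide)).trans r15
      refine (Env.Runs.seq (Env.runs_for (T := 150) (by decide) (by decide) hs₂ r19
        (fun j s' => s'.reg 18 = ∑ j' ∈ Finset.range j, a j' * f (d - j'))
        (Q := fun s' => s'.reg 18 = conv a f d) ?_ ?_ fun _ _ _ h => h) ?_ (T₂ := 40)).weaken ?_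
          fun _ _ _ h => h
      · simp [State.setReg_reg, r18]
      · rintro j hj s₃ hs₃ hf₃ r21 h18
        have hc₃ := hc₂.frame hf₃ (by decide)
        have r15 : s₃.reg 15 = R := (hf₃.1 15 (by decide)).trans r15
        have r17 : s₃.reg 17 = d := (hf₃.1 17 (by decide)).trans r17
        have hm15 : s₃.mem 15 (R * (n + 1) + j) = a j := by
          rw [hf₃.2 15 (by decide), hm₂, hI j (by omega), if_neg (by omega)]
        have hm16 : s₃.mem 16 (d - j) = f (d - j) := by
          rw [hf₃.2 16 (by decide), hm₂, hm16, hf (d - j) (by omega)]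
        have hval : (Expr.add (.reg 18)
            (.mul (.cell 15 15 5 21) (.load 16 (.sub (.reg 17) (.reg 21))))).eval s₃ =
              ∑ j' ∈ Finset.range (j + 1), a j' * f (d - j') := by
          simp only [Expr.eval, Expr.eval_cell, r15, r17, r21, hc₃.r5, hm15, hm16, h18]
          rw [Finset.sum_range_succ]
        refine (Env.runs_flat hs₃ rfl ?_ ?_).weaken (by decide) fun _ _ _ h => h
        -- The accumulator holds partial sums of nonnegative terms, so the bound on the full
        -- coefficient covers them.
        · refine lt_of_le_of_lt ?_ (hlim d hd)
          rw [hval]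
          exact Finset.sum_le_sum_of_subset (Finset.range_subset_range.2 (by omega))
        · simp [Cmd.den, State.setReg_reg, hval]
      · rintro s₃ hs₃ hf₃ h18
        have hc₃ := hc₂.frame hf₃ (by decide)
        have r15 : s₃.reg 15 = R := (hf₃.1 15 (by decide)).trans r15
        have r17 : s₃.reg 17 = d := (hf₃.1 17 (by decide)).trans r17
        have hm15 : s₃.mem 15 = s₁.mem 15 := by rw [hf₃.2 15 (by decide), hm₂]
        refine (Env.runs_flat hs₃ rfl (?_ : s₃.reg 18 < _) ?_).weaken (by decide) fun _ _ _ h => h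
        · exact hs₃.reg_lt _
        simp only [Cmd.den, Expr.eval, Expr.eval_addr, r15, r17, hc₃.r5, h18, State.setReg_mem,
          State.setMem_mem, true_and, hm15]
        refine ⟨fun d' hd' => ?_, fun i' hi' d' hd' => ?_⟩
        · by_cases he : d' = d
          · subst he
            rw [if_pos rfl, if_pos (by omega)]
          · rw [if_neg (by omega), hI d' hd']
            congr 1
            simp only [eq_iff_iff]
            omega
        · rw [if_neg, hI' i' hi' d' hd']
          rw [addr_inj (by omega) (by omega)]
          exact fun h => hi' h.1
      · nlinarith
  · rintro s₁ hs₁ hf₁ ⟨h1, h2⟩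
    refine ⟨fun d hd => ?_, h2⟩
    rw [h1 d hd, if_pos (by omega)]
  · nlinarith

def subtractRows : Cmd :=
  .for 16 5 (.store 16 (.reg 16) (.sub (.cell 15 14 5 16) (.cell 15 13 5 16)))

theorem runs_subtractRows (hs : Bdd E.B s) (hc : Ctx n N k s) {lo hi : ℕ} (h13 : s.reg 13 = lo)
    (h14 : s.reg 14 = hi) :
    E.Runs subtractRows s ((n + 2) * 121) fun s' => ∀ d ≤ n,
      s'.mem 16 d = s.mem 15 (hi * (n + 1) + d) - s.mem 15 (lo * (n + 1) + d) := by
  refine Env.runs_for (T := 100) (by decide) (by decide) hs hc.r5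
    (fun i s' => ∀ d < i,
      s'.mem 16 d = s.mem 15 (hi * (n + 1) + d) - s.mem 15 (lo * (n + 1) + d)) (by simp) ?_ ?_
  · rintro d hd s₁ hs₁ hf₁ r16 hI
    have hc₁ := hc.frame hf₁ (by decide)
    have r13 : s₁.reg 13 = lo := (hf₁.1 13 (by decide)).trans h13
    have r14 : s₁.reg 14 = hi := (hf₁.1 14 (by decide)).trans h14
    have hm15 : s₁.mem 15 = s.mem 15 := hf₁.2 15 (by decide)
    refine (Env.runs_flat hs₁ rfl ?_ ?_).weaken (by decide) fun _ _ _ h => h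
    · exact (Nat.sub_le _ _).trans_lt (hs₁.mem_lt _ _)
    · intro d' hd'
      simp only [Cmd.den, Expr.eval, Expr.eval_cell, r13, r14, r16, hc₁.r5, hm15,
        State.setReg_mem, State.setMem_mem, true_and]
      rcases Nat.lt_succ_iff_lt_or_eq.1 hd' with hlt | rfl
      · rw [if_neg hlt.ne, hI d' hlt]
      · rw [if_pos rfl]
  · exact fun s' _ _ hI d hd => hI d (by omega)

/-- The mask without the colour `c`. -/
def maskErase (m c : ℕ) : ℕ := if bit m c ≠ 0 then m - 2 ^ c else m

theorem bit_maskErase (m c : ℕ) : bit (maskErase m c) c = 0 := by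
  unfold maskErase
  split_ifs with hb
  · exact bit_sub_two_pow hb
  · exact not_not.1 hb

theorem bits_maskErase {m c : ℕ} (hck : c ≤ k) : bits k (maskErase m c) = (bits k m).erase c := by
  unfold maskErase
  split_ifs with hb
  · rw [bits_sub_two_pow hck hb, Finset.erase_insert]
    exact fun h => (mem_bits.1 h).2 (bit_sub_two_pow hb)
  · rw [Finset.erase_eq_of_notMem]
    exact fun h => hb (mem_bits.1 h).2

theorem bits_maskErase_add {m c : ℕ} (hck : c ≤ k) :
    bits k (maskErase m c + 2 ^ c) = insert c (bits k m) := by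
  rw [bits_add_two_pow hck (bit_maskErase m c), bits_maskErase hck]
  ext j
  simp only [Finset.mem_insert, Finset.mem_erase]
  tauto

theorem maskErase_le (m c : ℕ) : maskErase m c ≤ m := by
  unfold maskErase
  split_ifs
  · exact Nat.sub_le _ _
  · exact le_rfl

theorem Prepared.decode_erase (hp : Prepared γ h k s) (v : Fin n) (m : ℕ) :
    decode h k (s.mem 7) (maskErase m (s.mem 7 v)) (some v) =
      (decode h k (s.mem 7) m (some v)).erase v := by
  ext u
  rw [mem_decode, Finset.mem_erase, mem_decode, bits_maskErase (hp.col_le v), Finset.mem_erase]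
  constructor
  · rintro ⟨h1, h2, h3⟩
    exact ⟨fun he => h2 (by rw [he]), h1, h3⟩
  · rintro ⟨h1, h2, h3⟩
    exact ⟨h2, fun he => h1 (hp.intro.col_inj v (key_lt h v) u h2 v (Finset.mem_insert_self _ _) he),
      h3⟩

theorem Prepared.decode_insert (hp : Prepared γ h k s) (v : Fin n) (m : ℕ) :
    decode h k (s.mem 7) (maskErase m (s.mem 7 v) + 2 ^ s.mem 7 v) (some v) =
      insert v (decode h k (s.mem 7) m (some v)) := by
  ext u
  rw [mem_decode, bits_maskErase_add (hp.col_le v), Finset.mem_insert (s := bits k m)]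
  constructor
  · rintro ⟨h1, h2 | h2⟩
    · exact Finset.mem_insert.2
        (.inl (hp.intro.col_inj v (key_lt h v) u h1 v (Finset.mem_insert_self _ _) h2))
    · exact Finset.mem_insert_of_mem (mem_decode.2 ⟨h1, h2⟩)
  · intro hu
    rcases Finset.mem_insert.1 hu with rfl | hu
    · exact ⟨Finset.mem_insert_self _ _, .inl rfl⟩
    · exact ⟨(mem_decode.1 hu).1, .inr (mem_decode.1 hu).2⟩

/-- The colours are global, so a mask selects the same vertices of `nbr v` through the bag of `v`
and through that of its parent; no translation of masks is needed. -/
theorem decode_inter_nbr (col : ℕ → ℕ) (v : Fin n) (m : ℕ) :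
    decode h k col m (some v) ∩ h.elimination.nbr v =
      decode h k col m (h.par v) ∩ h.elimination.nbr v := by
  ext u
  rw [Finset.mem_inter, Finset.mem_inter, mem_decode]
  refine and_congr_left fun hu => ?_
  have hu : u ∈ h.nbr v := hu
  cases hp : h.par v with
  | none =>
      rw [h.par_eq_none.1 hp] at hu
      simp at hu
  | some p =>
      have hsub := h.elimination.nbr_subset hp
      rw [mem_decode]
      simp [hu, show u ∈ insert p (h.nbr p) from hsub hu]

/-- Multiply the polynomial of the mask in register `10` of the parent in register `8` by the one
that belongs to the vertex in register `7`, whose colour is in register `9`. -/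
def combineMask : Cmd :=
  .seq
    (.seq (.ite (.cell 11 10 3 9) (.assign 11 (.sub (.reg 10) (.load 12 (.reg 9))))
        (.assign 11 (.reg 10))) <|
      .seq (.assign 12 (.add (.reg 11) (.load 12 (.reg 9)))) <|
        .seq (.assign 13 (.add (.mul (.reg 7) (.reg 4)) (.add (.reg 4) (.reg 11)))) <|
          .seq (.assign 14 (.add (.mul (.reg 7) (.reg 4)) (.add (.reg 4) (.reg 12))))
            (.assign 15 (.add (.mul (.reg 8) (.reg 4)) (.reg 10)))) <|
    .seq subtractRows convolve

def combine : Cmd :=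
  .for 6 0 <| .seq
    (.seq (.assign 7 (.load 10 (.sub (.sub (.reg 0) (.const 1)) (.reg 6)))) <|
      .seq (.assign 8 (.load 9 (.reg 7))) (.assign 9 (.load 7 (.reg 7))))
    (.for 10 4 combineMask)

theorem code_le (p : Option (Fin n)) : code p ≤ n := by
  cases p with
  | none => exact Nat.zero_le _
  | some v => exact v.2

theorem code_injective : Function.Injective (code : Option (Fin n) → ℕ) := by
  intro p q hpq
  cases p <;> cases q <;> simp only [code] at hpq
  · rfl
  · omega
  · omega
  · exact congrArg some (Fin.ext (by omega))

theorem runs_combineMask (hB : Fits n N k E.B) (hs : Bdd E.B s) (hp : Prepared γ h k s)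
    {v : Fin n} {m : ℕ} (hm : m < 2 ^ (k + 1)) (h7 : s.reg 7 = v) (h8 : s.reg 8 = code (h.par v))
    (h9 : s.reg 9 = s.mem 7 v) (h10 : s.reg 10 = m) {T : Option (Fin n) → Finset (Fin n) → Polynomial ℕ}
    {F P : Polynomial ℕ} (hv : Stored h k s T (some v))
    (hF : T (some v) (insert v (decode h k (s.mem 7) m (some v))) =
      F + T (some v) ((decode h k (s.mem 7) m (some v)).erase v))
    (hP : ∀ d ≤ n, s.mem 15 ((code (h.par v) * 2 ^ (k + 1) + m) * (n + 1) + d) = P.coeff d)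
    (hlim : ∀ d ≤ n, (P * F).coeff d < lim E.B) :
    E.Runs combineMask s (250 + ((n + 2) * 121 + (n + 2) * ((n + 2) * 250))) fun s' =>
      (∀ d ≤ n, s'.mem 15 ((code (h.par v) * 2 ^ (k + 1) + m) * (n + 1) + d) =
        (P * F).coeff d) ∧
      ∀ i ≠ code (h.par v) * 2 ^ (k + 1) + m, ∀ d ≤ n,
        s'.mem 15 (i * (n + 1) + d) = s.mem 15 (i * (n + 1) + d) := by
  have hck := hp.col_le v
  have hlo := bit_maskErase m (s.mem 7 v)
  have hlo' := (maskErase_le m (s.mem 7 v)).trans_lt hm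
  have hhi := add_two_pow_lt hck hlo' hlo
  have hpow := hp.pow _ hck
  have hbit := hp.bit m hm _ hck
  have hBP := hB.pow
  have hrow : ∀ l : ℕ, (v : ℕ) * 2 ^ (k + 1) + (2 ^ (k + 1) + l) = (v + 1) * 2 ^ (k + 1) + l :=
    fun l => by ring
  refine (Env.Runs.seq (Env.runs_flat hs rfl ?_ (Q := fun s' => s'.mem = s.mem ∧
    s'.reg 13 = (v + 1) * 2 ^ (k + 1) + maskErase m (s.mem 7 v) ∧
    s'.reg 14 = (v + 1) * 2 ^ (k + 1) + (maskErase m (s.mem 7 v) + 2 ^ s.mem 7 v) ∧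
    s'.reg 15 = code (h.par v) * 2 ^ (k + 1) + m) ?_) ?_
      (T₂ := (n + 2) * 121 + (n + 2) * ((n + 2) * 250))).weaken
        (Nat.add_le_add_right (by decide) _) fun _ _ _ h => h
  · have h1 := hB.row_lt (v := v + 1) v.2 hlo'
    have h2 := hB.row_lt (v := v + 1) v.2 hhi
    have h3 := hB.row_lt (code_le (h.par v)) hm
    unfold maskErase at *
    by_cases hb : bit m (s.mem 7 v) = 0
    · simp [hb] at h1 h2 hhi
      simp [Cmd.Safe, Cmd.den, Expr.eval, State.setReg_reg, h7, h8, h9, h10, hp.ctx.r3, hp.ctx.r4,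
        hbit, hpow, hb, hrow, h1, h2, h3]
      omega
    · simp [hb] at h1 h2 hhi
      simp [Cmd.Safe, Cmd.den, Expr.eval, State.setReg_reg, h7, h8, h9, h10, hp.ctx.r3, hp.ctx.r4,
        hbit, hpow, hb, hrow, h1, h2, h3]
      omega
  · unfold maskErase
    by_cases hb : bit m (s.mem 7 v) = 0
    · simp [Cmd.den, Expr.eval, State.setReg_reg, h7, h8, h9, h10, hp.ctx.r3, hp.ctx.r4,
        hbit, hpow, hb, hrow]
    · simp [Cmd.den, Expr.eval, State.setReg_reg, h7, h8, h9, h10, hp.ctx.r3, hp.ctx.r4,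
        hbit, hpow, hb, hrow]
  · rintro s₁ hs₁ hf₁ ⟨hm₁, r13, r14, r15⟩
    have hp₁ := hp.frame hf₁ (by decide) (by decide)
    refine Env.Runs.seq (runs_subtractRows hs₁ hp₁.ctx r13 r14) ?_
    rintro s₂ hs₂ hf₂ h16
    have hp₂ := hp₁.frame hf₂ (by decide) (by decide)
    have hm₂ : s₂.mem 15 = s.mem 15 := by rw [hf₂.2 15 (by decide), hm₁]
    have r15 : s₂.reg 15 = _ := (hf₂.1 15 (by decide)).trans r15
    refine (runs_convolve hB hs₂ hp₂.ctx r15 (a := P.coeff) (f := F.coeff) ?_ ?_ ?_).weaken le_rfl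
      fun s' _ _ hQ => ?_
    · rwa [hm₂]
    · intro d hd
      have e1 := hv _ hhi d hd
      have e2 := hv _ hlo' d hd
      rw [hp.decode_insert, hF, Polynomial.coeff_add] at e1
      rw [hp.decode_erase] at e2
      rw [h16 d hd, hm₁]
      simp only [code] at e1 e2
      -- Truncated subtraction is exact here because the row with `v` is the row without `v` plus
      -- `F`.
      rw [e1, e2, Nat.add_sub_cancel]
    · intro d hd
      rw [← coeff_mul_eq_conv]
      exact hlim d hd
    · refine ⟨fun d hd => ?_, fun i hi d hd => ?_⟩
      · rw [coeff_mul_eq_conv]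
        exact hQ.1 d hd
      · rw [hQ.2 i hi d hd, hm₂]

theorem exists_rank_eq (h : NodeOrder D o) {r : ℕ} (hr : r < n) : ∃ v, h.rank v = r := by
  have hinj : Function.Injective fun v : Fin n => (⟨h.rank v, h.rank_lt v⟩ : Fin n) :=
    fun u v huv => h.rank_injective (by simpa using huv)
  obtain ⟨v, hv⟩ := Finite.surjective_of_injective hinj ⟨r, hr⟩
  exact ⟨v, by simpa using hv⟩

/-- Round `i` eliminates the vertex of rank `n - 1 - i`. Memory and tables are kept in agreement for
active indices only. A vertex is never its own parent, so its rows stay intact while the rows of its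
parent are rewritten. -/
theorem runs_combine (hB : Fits n N k E.B) (hs : Bdd E.B s) (hp : Prepared γ h k s)
    (hcard : (cliques γ G).card ≤ n * 2 ^ k) {T : Option (Fin n) → Finset (Fin n) → Polynomial ℕ}
    (hT : h.elimination.Table (cliques γ G) n T) (hst : ∀ p, Stored h k s T p) :
    E.Runs combine s ((n + 1) * ((2 ^ (k + 1) + 1) * ((n + 2) * ((n + 2) * 600)))) fun s' =>
      ∃ T, h.elimination.Table (cliques γ G) 0 T ∧
        ∀ d ≤ n, s'.mem 15 d = (T none ∅).coeff d := by
  refine (Env.runs_for (T := 100 + (2 ^ (k + 1) + 1) * (250 + ((n + 2) * 121 +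
      (n + 2) * ((n + 2) * 250)) + 21)) (by decide) (by decide) hs hp.ctx.r0
    (fun i s' => Prepared γ h k s' ∧ ∃ T, h.elimination.Table (cliques γ G) (n - i) T ∧
      ∀ p, h.elimination.Active (n - i) p → Stored h k s' T p) ?_ ?_ ?_).weaken ?_ fun _ _ _ h => h
  · exact ⟨hp.congr (by simp [State.setReg_reg]) (by simp), T, hT, fun p _ => hst p⟩
  · rintro i hi s₁ hs₁ hf₁ r6 ⟨hp₁, T, hT, hst⟩
    obtain ⟨r, hr, hir⟩ : ∃ r < n, n - i = r + 1 := ⟨n - 1 - i, by omega, by omega⟩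
    obtain ⟨v, hv⟩ := exists_rank_eq h hr
    rw [hir] at hT hst
    obtain ⟨F, hF, hFc, hT'⟩ := hT.step _ hv
    have hpv : h.par v ≠ some v := by
      intro he
      have := h.elimination.rank_lt (h.elimination.par_mem he)
      exact lt_irrefl _ this
    have hact : h.elimination.Active r (h.par v) := by
      cases hq : h.par v with
      | none => trivial
      | some q => exact h.elimination.active_par hq hv
    have hmono : ∀ {p}, h.elimination.Active r p → h.elimination.Active (r + 1) p := by
      intro p hpa
      cases p with
      | none => trivial
      | some u => exact Nat.lt_succ_of_lt hpa
    have hact' := hmono hact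
    have hvact : h.elimination.Active (r + 1) (some v) := by
      have : h.elimination.rank v = r := hv
      simp [Elimination.Active, this]
    have hseq := hp₁.intro.seq v (key_lt h v)
    have hpar := hp₁.intro.par v (key_lt h v)
    rw [hv] at hseq
    refine (Env.Runs.seq (Env.runs_flat hs₁ rfl ?_ (Q := fun s' => s'.mem = s₁.mem ∧
      s'.reg 7 = v ∧ s'.reg 8 = code (h.par v) ∧ s'.reg 9 = s₁.mem 7 v) ?_) ?_
        (T₂ := (2 ^ (k + 1) + 1) * (250 + ((n + 2) * 121 +
          (n + 2) * ((n + 2) * 250)) + 21))).weaken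
        (Nat.add_le_add_right (by decide) _) fun _ _ _ h => h
    · have h1 := hs₁.mem_lt
      simp [Cmd.Safe, Cmd.den, Expr.eval, h1]
    · have hri : n - 1 - i = r := by omega
      simp [Cmd.den, Expr.eval, State.setReg_reg, r6, hp₁.ctx.r0, hri, hseq, hpar]
    · rintro s₂ hs₂ hf₂ ⟨hm₂, r7, r8, r9⟩
      have hp₂ := hp₁.frame hf₂ (by decide) (by decide)
      have hst₂ : ∀ p, h.elimination.Active (r + 1) p → Stored h k s₂ T p := by
        simp only [Stored, hm₂]
        exact hst
      refine Env.runs_for (by decide) (by decide) hs₂ hp₂.ctx.r4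
        (fun j s' => Prepared γ h k s' ∧
          (∀ p, h.elimination.Active (r + 1) p → p ≠ h.par v → Stored h k s' T p) ∧
          ∀ m < 2 ^ (k + 1), ∀ d ≤ n,
            s'.mem 15 ((code (h.par v) * 2 ^ (k + 1) + m) * (n + 1) + d) =
              if m < j then (T (h.par v) (decode h k (s₁.mem 7) m (h.par v)) *
                F (decode h k (s₁.mem 7) m (h.par v))).coeff d
              else (T (h.par v) (decode h k (s₁.mem 7) m (h.par v))).coeff d) ?_ ?_ ?_
      · refine ⟨hp₂.congr (by simp [State.setReg_reg]) (by simp), fun p hp _ => hst₂ p hp,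
          fun m hm d hd => ?_⟩
        rw [if_neg (Nat.not_lt_zero _), State.setReg_mem, hst₂ _ hact' m hm d hd, hm₂]
      · rintro m hm s₃ hs₃ hf₃ r10 ⟨hp₃, hoth, hrow⟩
        have hm7 : s₃.mem 7 = s₁.mem 7 := by rw [hf₃.2 7 (by decide), hm₂]
        have r7 : s₃.reg 7 = v := (hf₃.1 7 (by decide)).trans r7
        have r8 : s₃.reg 8 = code (h.par v) := (hf₃.1 8 (by decide)).trans r8
        have r9 : s₃.reg 9 = s₃.mem 7 v := by rw [hf₃.1 9 (by decide), r9, hm7]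
        have hFm : F (decode h k (s₃.mem 7) m (some v)) = F (decode h k (s₁.mem 7) m (h.par v)) := by
          rw [hm7]
          exact hFc _ _ (decode_inter_nbr _ _ _)
        refine (runs_combineMask hB hs₃ hp₃ hm r7 r8 r9 r10 (T := T)
          (F := F (decode h k (s₃.mem 7) m (some v)))
          (P := T (h.par v) (decode h k (s₁.mem 7) m (h.par v)))
          (hoth _ hvact (Ne.symm hpv)) (hF _) ?_ ?_).weaken le_rfl ?_
        · intro d hd
          rw [hrow m hm d hd, if_neg (lt_irrefl _)]
        · intro d hd
          -- The product is an entry of the next table, so it inherits the bound by binomial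
          -- coefficients of the number of cliques.
          have hle := hT'.coeff_le _ hact (decode h k (s₁.mem 7) m (h.par v)) d
          rw [show h.elimination.par v = h.par v from rfl, Function.update_self] at hle
          rw [hFm]
          exact (hle.trans (Nat.choose_le_choose d hcard)).trans_lt (hB.choose d hd)
        · rintro s₄ hs₄ hf₄ ⟨h1, h2⟩
          have hp₄ := hp₃.frame hf₄ (by decide) (by decide)
          have hm7' : s₄.mem 7 = s₃.mem 7 := hf₄.2 7 (by decide)
          refine ⟨hp₄.congr (by simp [State.setReg_reg]) (by simp), fun p hpa hne m' hm' d hd => ?_,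
            fun m' hm' d hd => ?_⟩
          · rw [State.setReg_mem, h2 _ _ d hd, hoth p hpa hne m' hm' d hd, hm7']
            rw [Ne, addr_inj hm' hm]
            exact fun he => hne (code_injective he.1)
          · rw [State.setReg_mem]
            by_cases he : m' = m
            · subst he
              rw [h1 d hd, if_pos (Nat.lt_succ_self _), hFm]
            · rw [h2 _ _ d hd, hrow m' hm' d hd]
              · congr 1
                simp only [eq_iff_iff]
                omega
              · rw [Ne, addr_inj hm' hm]
                exact fun h => he h.2
      · rintro s₃ hs₃ hf₃ ⟨hp₃, hoth, hrow⟩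
        have hm7 : s₃.mem 7 = s₁.mem 7 := by rw [hf₃.2 7 (by decide), hm₂]
        have hir' : n - (i + 1) = r := by omega
        rw [hir']
        refine ⟨hp₃.congr (by simp [State.setReg_reg]) (by simp), _, hT',
          fun p hpa m hm d hd => ?_⟩
        rw [State.setReg_mem]
        by_cases he : p = h.par v
        · subst he
          rw [hrow m hm d hd, if_pos hm, show h.elimination.par v = h.par v from rfl,
            Function.update_self, hm7]
        · rw [show h.elimination.par v = h.par v from rfl, Function.update_of_ne he]
          exact hoth p (hmono hpa) he m hm d hd
  · rintro s₁ hs₁ hf₁ ⟨hp₁, T, hT, hst⟩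
    rw [Nat.sub_self] at hT hst
    refine ⟨T, hT, fun d hd => ?_⟩
    have := hst none trivial 0 (by positivity) d hd
    simpa [code, decode, Elimination.obag] using this
  · have h1 : 1 ≤ 2 ^ (k + 1) + 1 := Nat.le_add_left _ _
    generalize 2 ^ (k + 1) + 1 = P at *
    refine Nat.mul_le_mul_left _ ?_
    calc _ ≤ P * 100 + P * (250 + ((n + 2) * 121 + (n + 2) * ((n + 2) * 250)) + 21) + P * 21 := by
          omega
      _ = P * (100 + (250 + ((n + 2) * 121 + (n + 2) * ((n + 2) * 250)) + 21) + 21) := by ring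
      _ ≤ _ := Nat.mul_le_mul_left _ (by nlinarith)

end RAM

/-! ### The result -/

namespace RAM

/-- Put the least index of a nonzero cell of the array `15` into register `0`, and the contents of
this cell into register `1`. -/
def output : Cmd :=
  .seq (.seq (.assign 22 (.const 0)) (.assign 23 (.const 0))) <|
    .seq (.for 6 5 <| .ite (.load 15 (.sub (.reg 0) (.reg 6)))
        (.seq (.assign 22 (.sub (.reg 0) (.reg 6))) (.assign 23 (.load 15 (.reg 22)))) .skip)
      (.seq (.assign 0 (.reg 22)) (.assign 1 (.reg 23)))

variable {γ : Set ℕ} {E : Env} {n N k : ℕ} {s : State} {G : SimpleGraph (Fin n)}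
  {D : TreeDecomposition G (Fin N)}

/-- Degrees are scanned downwards and each nonzero coefficient overwrites the previous one, so the
one of least degree survives. -/
theorem runs_output (hB : Fits n N k E.B) (hs : Bdd E.B s) (hc : Ctx n N k s) {c : ℕ → ℕ}
    (h15 : ∀ d ≤ n, s.mem 15 d = c d) :
    E.Runs output s ((n + 2) * 200) fun s' =>
      (∀ d ≤ n, c d ≠ 0 → (∀ e < d, c e = 0) → s'.reg 0 = d ∧ s'.reg 1 = c d) ∧
      ((∀ d ≤ n, c d = 0) → s'.reg 1 = 0) := by
  have hN := hB.node
  refine (Env.Runs.seq (Env.runs_flat hs rfl ?_ (Q := fun s' => s'.mem = s.mem ∧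
    s'.reg 23 = 0) ?_) ?_ (T₂ := (n + 2) * 121 + 40)).weaken ?_ fun _ _ _ h => h
  · simp [Cmd.Safe, Expr.eval]
    omega
  · simp [Cmd.den, Expr.eval]
  · rintro s₁ hs₁ hf₁ ⟨hm₁, r23⟩
    have hc₁ := hc.frame hf₁ (by decide)
    refine (Env.Runs.seq (Env.runs_for (T := 100) (by decide) (by decide) hs₁ hc₁.r5 (fun i s' =>
      (∀ d ≤ n, n < d + i → c d ≠ 0 → (∀ e < d, n < e + i → c e = 0) →
        s'.reg 22 = d ∧ s'.reg 23 = c d) ∧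
      ((∀ d ≤ n, n < d + i → c d = 0) → s'.reg 23 = 0)) ?_ ?_ fun _ _ _ h => h) ?_
        (T₂ := 30)).weaken (by omega) fun _ _ _ h => h
    · refine ⟨fun d hd hlt => by omega, fun _ => ?_⟩
      rw [State.setReg_reg, if_neg (by decide), r23]
    · rintro i hi s₂ hs₂ hf₂ r6 ⟨hI, hI'⟩
      have hc₂ := hc₁.frame hf₂ (by decide)
      have hval : s₂.mem 15 (n - i) = c (n - i) := by
        rw [hf₂.2 15 (by decide), hm₁, h15 _ (Nat.sub_le _ _)]
      have hload : (Expr.load 15 (.sub (.reg 0) (.reg 6))).eval s₂ = c (n - i) := by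
        simp only [Expr.eval, hc₂.r0, r6, hval]
      refine (Env.runs_flat hs₂ rfl ?_ ?_).weaken (by decide) fun _ _ _ h => h
      · have := hs₂.mem_lt 15
        simp [Cmd.Safe, Cmd.den, Expr.eval, hc₂.r0, this]
        omega
      · simp only [Cmd.den, hload]
        by_cases h0 : c (n - i) = 0
        · rw [if_neg (not_not.2 h0)]
          refine ⟨fun d hd hlt hd0 hmin => ?_, fun hall => ?_⟩
          · have hne : d ≠ n - i := fun he => hd0 (he ▸ h0)
            exact hI d hd (by omega) hd0 fun e he hlt' => hmin e he (by omega)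
          · exact hI' fun d hd hlt => hall d hd (by omega)
        · rw [if_pos h0]
          refine ⟨fun d hd hlt hd0 hmin => ?_, fun hall => ?_⟩
          · have he : d = n - i := by
              by_contra hne
              exact h0 (hmin (n - i) (by omega) (by omega))
            subst he
            simp [Expr.eval, State.setReg_reg, hc₂.r0, r6, hval]
          · exact absurd (hall (n - i) (Nat.sub_le _ _) (by omega)) h0
    · rintro s₂ hs₂ hf₂ ⟨hI, hI'⟩
      refine (Env.runs_flat hs₂ rfl ?_ ?_).weaken (by decide) fun _ _ _ h => h
      · have := hs₂.reg_lt
        simp [Cmd.Safe, Cmd.den, Expr.eval, State.setReg_reg, this]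
      · simp only [Cmd.den, Expr.eval, State.setReg_reg]
        refine ⟨fun d hd hd0 hmin => ?_, fun hall => ?_⟩
        · simpa using hI d hd (by omega) hd0 fun e he _ => hmin e he
        · simpa using hI' fun d hd _ => hall d hd
  · have : Cmd.tick (.seq (.assign 22 (.const 0)) (.assign 23 (.const 0))) ≤ 20 := by decide
    omega

/-- The program, without the tabulation of the admissible sizes. -/
def countCovers : Cmd :=
  .seq setup <| .seq bitTable <| .seq binomialTable <| .seq traverse <| .seq introduce <|
    .seq cliqueTables <| .seq combine output

open Classical in
/-- The number of clique covers of a given cardinality. -/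
noncomputable def coverCount (γ : Set ℕ) {n : ℕ} (G : SimpleGraph (Fin n)) (d : ℕ) : ℕ :=
  ((cliques γ G).powerset.filter fun 𝒞 => (∀ u, ∃ K ∈ 𝒞, u ∈ K) ∧ 𝒞.card = d).card

theorem isCliqueCover_iff {𝒞 : Finset (Finset (Fin n))} :
    IsCliqueCover γ G 𝒞 ↔ 𝒞 ⊆ cliques γ G ∧ ∀ u, ∃ K ∈ 𝒞, u ∈ K := by
  refine and_congr_left fun _ => ?_
  simp only [Finset.subset_iff, mem_cliques]

/-- One clique per vertex suffices; hence the coefficients up to degree `n` determine the answer. -/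
theorem exists_small_cover {𝒞 : Finset (Finset (Fin n))} (h𝒞 : IsCliqueCover γ G 𝒞) :
    ∃ 𝒟 : Finset (Finset (Fin n)), IsCliqueCover γ G 𝒟 ∧ 𝒟.card ≤ n := by
  classical
  choose K hK hmem using h𝒞.2
  refine ⟨Finset.univ.image K, ⟨fun L hL => ?_, fun v => ⟨K v, by simp, hmem v⟩⟩, ?_⟩
  · obtain ⟨v, -, rfl⟩ := Finset.mem_image.1 hL
    exact h𝒞.1 _ (hK v)
  · exact Finset.card_image_le.trans (by simp)

theorem coverCount_ne_zero {d : ℕ} :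
    coverCount γ G d ≠ 0 ↔ ∃ 𝒞 : Finset (Finset (Fin n)), IsCliqueCover γ G 𝒞 ∧ 𝒞.card = d := by
  rw [coverCount, Finset.card_ne_zero, Finset.Nonempty]
  refine exists_congr fun 𝒞 => ?_
  rw [isCliqueCover_iff, Finset.mem_filter, Finset.mem_powerset, and_assoc]

theorem coverCount_eq_ncard {𝒞 : Finset (Finset (Fin n))} (h𝒞 : IsMinimumCliqueCover γ G 𝒞) :
    coverCount γ G 𝒞.card = Set.ncard {𝒟 | IsMinimumCliqueCover γ G 𝒟} := by
  rw [coverCount, ← Set.ncard_coe_finset]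
  congr 1
  ext 𝒟
  rw [Finset.mem_coe, Finset.mem_filter, Finset.mem_powerset, ← and_assoc, ← isCliqueCover_iff]
  constructor
  · rintro ⟨h1, h2⟩
    exact ⟨h1, fun ℰ hℰ => h2 ▸ h𝒞.2 ℰ hℰ⟩
  · rintro ⟨h1, h2⟩
    exact ⟨h1, le_antisymm (h2 _ h𝒞.1) (h𝒞.2 _ h1)⟩

/-- The values found by `output` are correct. -/
theorem result_correct {x y : ℕ}
    (h1 : ∀ d ≤ n, coverCount γ G d ≠ 0 → (∀ e < d, coverCount γ G e = 0) →
      x = d ∧ y = coverCount γ G d)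
    (h2 : (∀ d ≤ n, coverCount γ G d = 0) → y = 0) :
    (∀ 𝒞 : Finset (Finset (Fin n)), IsMinimumCliqueCover γ G 𝒞 → x = 𝒞.card) ∧
      y = Set.ncard {𝒞 : Finset (Finset (Fin n)) | IsMinimumCliqueCover γ G 𝒞} := by
  have key : ∀ 𝒞 : Finset (Finset (Fin n)), IsMinimumCliqueCover γ G 𝒞 →
      x = 𝒞.card ∧ y = coverCount γ G 𝒞.card := by
    intro 𝒞 h𝒞
    obtain ⟨𝒟, h𝒟, hn⟩ := exists_small_cover h𝒞.1
    refine h1 _ ((h𝒞.2 𝒟 h𝒟).trans hn) (coverCount_ne_zero.2 ⟨𝒞, h𝒞.1, rfl⟩) fun e he => ?_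
    by_contra h0
    obtain ⟨ℰ, hℰ, rfl⟩ := coverCount_ne_zero.1 h0
    exact absurd (h𝒞.2 ℰ hℰ) (not_le.2 he)
  refine ⟨fun 𝒞 h𝒞 => (key 𝒞 h𝒞).1, ?_⟩
  by_cases hex : ∃ 𝒞 : Finset (Finset (Fin n)), IsMinimumCliqueCover γ G 𝒞
  · obtain ⟨𝒞, h𝒞⟩ := hex
    rw [(key 𝒞 h𝒞).2, coverCount_eq_ncard h𝒞]
  · have hempty : {𝒞 : Finset (Finset (Fin n)) | IsMinimumCliqueCover γ G 𝒞} = ∅ :=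
      Set.eq_empty_iff_forall_notMem.2 fun 𝒞 h𝒞 => hex ⟨𝒞, h𝒞⟩
    rw [hempty, Set.ncard_empty]
    refine h2 fun d _ => ?_
    by_contra h0
    obtain ⟨𝒞, h𝒞, -⟩ := coverCount_ne_zero.1 h0
    have hex' : ∃ m, ∃ 𝒟 : Finset (Finset (Fin n)), IsCliqueCover γ G 𝒟 ∧ 𝒟.card = m :=
      ⟨_, 𝒞, h𝒞, rfl⟩
    classical
    obtain ⟨𝒟, h𝒟, hm⟩ := Nat.find_spec hex'
    exact hex ⟨𝒟, h𝒟, fun ℰ hℰ => hm ▸ Nat.find_min' hex' ⟨ℰ, hℰ, rfl⟩⟩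

theorem runs_countCovers (hB : Fits n N k E.B) (hs : Bdd E.B s) (h0 : s.reg 0 = n)
    (h1 : s.reg 1 = N) (h2 : s.reg 2 = k) (hin : Input G D s) (hk : D.HasWidth k) (hγ : 0 ∉ γ)
    (hz : ∀ A ∈ [4, 5, 6, 8], ∀ i, s.mem A i = 0)
    (h3 : ∀ i, i ≤ k + 1 → (s.mem 3 i ≠ 0 ↔ i ∈ γ) ∧ s.mem 3 i ≤ 1) :
    E.Runs countCovers s ((k + 3) * 100 + ((2 ^ (k + 1) + 1) * ((k + 2) * 100 + 31) +
      ((2 ^ (k + 1) + 1) * ((n + 2) * 150 + 21) + ((N + 2) * ((N + 2) * 150) +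
      ((N + 1) * ((n + 1) * ((n + 2) * 600)) * 2 +
      ((n + 2) * ((2 ^ (k + 1) + 1) * ((n + 2) * ((n + 2) * 1200))) +
      ((n + 1) * ((2 ^ (k + 1) + 1) * ((n + 2) * ((n + 2) * 600))) + (n + 2) * 200))))))) fun s' =>
      (∀ d ≤ n, coverCount γ G d ≠ 0 → (∀ e < d, coverCount γ G e = 0) →
        s'.reg 0 = d ∧ s'.reg 1 = coverCount γ G d) ∧
      ((∀ d ≤ n, coverCount γ G d = 0) → s'.reg 1 = 0) := by
  -- Because `0 ∉ γ`, the empty clique is not admissible, and every admissible clique has a last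
  -- vertex.
  have hcl : ∀ K ∈ cliques γ G, G.IsClique (K : Set (Fin n)) ∧ K.Nonempty := by
    intro K hK
    obtain ⟨hK, hγK⟩ := mem_cliques.1 hK
    refine ⟨hK, Finset.nonempty_iff_ne_empty.2 ?_⟩
    rintro rfl
    exact hγ (by simpa using hγK)
  refine Env.Runs.seq (runs_setup hB hs h0 h1 h2) ?_
  rintro s₁ hs₁ hf₁ ⟨hc₁, hpow₁⟩
  refine Env.Runs.seq (runs_bitTable hB hs₁ hc₁) ?_
  rintro s₂ hs₂ hf₂ hbit₂
  have hc₂ := hc₁.frame hf₂ (by decide)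
  refine Env.Runs.seq (runs_binomialTable hB hs₂ hc₂) ?_
  rintro s₃ hs₃ hf₃ hch₃
  have hc₃ := hc₂.frame hf₃ (by decide)
  have hin₃ := ((hin.frame hf₁ (by decide)).frame hf₂ (by decide)).frame hf₃ (by decide)
  have hz₃ : ∀ A ∈ [3, 4, 5, 6, 8], s₃.mem A = s.mem A := by
    intro A hA
    simp only [List.mem_cons, List.not_mem_nil, or_false] at hA
    rcases hA with rfl | rfl | rfl | rfl | rfl <;>
      rw [hf₃.2 _ (by decide), hf₂.2 _ (by decide), hf₁.2 _ (by decide)]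
  refine Env.Runs.seq (runs_traverse hB hs₃ hc₃ hin₃ ?_ ?_) ?_
  · rw [hz₃ 4 (by decide)]; exact hz 4 (by decide)
  · rw [hz₃ 5 (by decide)]; exact hz 5 (by decide)
  rintro s₄ hs₄ hf₄ ⟨o, h, ho⟩
  have hc₄ := hc₃.frame hf₄ (by decide)
  have hin₄ := hin₃.frame hf₄ (by decide)
  refine Env.Runs.seq (runs_introduce (h := h) hB hs₄ hc₄ hin₄ hk ho ?_ ?_) ?_
  · rw [hf₄.2 6 (by decide), hz₃ 6 (by decide)]; exact hz 6 (by decide)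
  · rw [hf₄.2 8 (by decide), hz₃ 8 (by decide)]; exact hz 8 (by decide)
  rintro s₅ hs₅ hf₅ hI₅
  have hp₅ : Prepared γ h k s₅ := by
    refine ⟨hc₄.frame hf₅ (by decide), hin₄.frame hf₅ (by decide), hI₅, ?_, ?_, ?_, ?_⟩
    · rwa [hf₅.2 11 (by decide), hf₄.2 11 (by decide), hf₃.2 11 (by decide)]
    · rwa [hf₅.2 12 (by decide), hf₄.2 12 (by decide), hf₃.2 12 (by decide), hf₂.2 12 (by decide)]
    · rwa [hf₅.2 13 (by decide), hf₄.2 13 (by decide)]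
    · intro i hi
      rw [hf₅.2 3 (by decide), hf₄.2 3 (by decide), hz₃ 3 (by decide)]
      obtain ⟨h3, h3'⟩ := h3 i hi
      split_ifs with hiγ
      · have := h3.2 hiγ
        omega
      · by_contra hne
        exact hiγ (h3.1 hne)
  refine Env.Runs.seq (runs_cliqueTables hB hs₅ hp₅ hk) ?_
  rintro s₆ hs₆ hf₆ ⟨hp₆, hst₆⟩
  have hcard : (cliques γ G).card ≤ n * 2 ^ k := by
    simpa using h.elimination.card_le hcl (h.card_nbr_le hk)
  refine Env.Runs.seq (runs_combine hB hs₆ hp₆ hcard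
    (h.elimination.table_init hcl h.rank_lt) hst₆) ?_
  rintro s₇ hs₇ hf₇ ⟨T, hT, h15⟩
  have hc₇ := hp₆.ctx.frame hf₇ (by decide)
  refine runs_output hB hs₇ hc₇ fun d hd => ?_
  rw [h15 d hd, hT.coeff_root, coverCount]
  congr!

end RAM

/-! ### Word sizes and running time -/

namespace RAM

/-- The number of bits of the numbers that occur in the computation. -/
def numBits (a n k : ℕ) : ℕ :=
  max (n * k + n * Nat.clog 2 n) (2 * Nat.clog 2 n + k + a + 6)

theorem le_two_pow_clog (n : ℕ) : n ≤ 2 ^ Nat.clog 2 n := Nat.le_pow_clog one_lt_two n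

/-- The decisive estimate is that the binomial coefficient is at most `(n * 2 ^ k) ^ n`, hence at
most `2 ^ (n * k + n * log n)`. The second term of the maximum in `numBits` takes care of addresses,
node numbers and small degrees. -/
theorem fits_numBits {a n N k : ℕ} (hk : k < n) (hN : N ≤ a * n) : Fits n N k (numBits a n k) := by
  have hL := le_two_pow_clog n
  have hle : 2 ^ (2 * Nat.clog 2 n + k + a + 6) ≤ 2 ^ numBits a n k :=
    Nat.pow_le_pow_right two_pos (le_max_right _ _)
  have hlim : lim (numBits a n k) = 2 ^ numBits a n k := rfl
  generalize hLdef : Nat.clog 2 n = L at hL hle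
  have ha : a + 5 < 2 ^ (a + 5) := Nat.lt_two_pow_self
  have h1 : 1 ≤ 2 ^ L := Nat.one_le_two_pow
  have hQ : 1 ≤ 2 ^ k := Nat.one_le_two_pow
  have hmul : 2 ^ (2 * L + k + a + 6) = 2 ^ L * 2 ^ L * 2 ^ k * (2 ^ (a + 5) * 2) := by ring
  refine ⟨?_, ?_, fun d hd => ?_, hk⟩ <;> rw [hlim]
  · refine lt_of_lt_of_le ?_ hle
    have hn : n + 2 ≤ 2 ^ L * 3 := by omega
    calc (n + 2) * 2 ^ (k + 1) * (n + 2) ≤ (2 ^ L * 3) * 2 ^ (k + 1) * (2 ^ L * 3) := by gcongr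
      _ = 2 ^ L * 2 ^ L * 2 ^ k * 18 := by ring
      _ < 2 ^ L * 2 ^ L * 2 ^ k * (2 ^ (a + 5) * 2) := by
        refine Nat.mul_lt_mul_of_pos_left ?_ (by positivity)
        have : 2 ^ (0 + 5) ≤ 2 ^ (a + 5) := Nat.pow_le_pow_right two_pos (by omega)
        omega
      _ = _ := hmul.symm
  · refine lt_of_lt_of_le ?_ hle
    calc N + n + k + 3 ≤ (a + 5) * n := by nlinarith
      _ ≤ 2 ^ (a + 5) * 2 ^ L := Nat.mul_le_mul ha.le hL
      _ < 2 ^ (2 * L + k + a + 6) := by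
        rw [← pow_add]
        exact Nat.pow_lt_pow_right one_lt_two (by omega)
  · have hM : n * 2 ^ k < 2 ^ (2 * L + k + a + 6) := by
      calc n * 2 ^ k ≤ 2 ^ L * 2 ^ k := Nat.mul_le_mul_right _ hL
        _ < 2 ^ (2 * L + k + a + 6) := by
          rw [← pow_add]
          exact Nat.pow_lt_pow_right one_lt_two (by omega)
    have hM1 : 1 ≤ n * 2 ^ k := Nat.mul_pos (by omega) hQ
    rcases Nat.lt_or_ge d 2 with h2 | h2
    · refine lt_of_le_of_lt ?_ (hM.trans_le hle)
      interval_cases d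
      · simpa using hM1
      · simp
    · have hb : (n * 2 ^ k) ^ d ≤ 2 ^ numBits a n k := by
        calc (n * 2 ^ k) ^ d ≤ (n * 2 ^ k) ^ n := Nat.pow_le_pow_right hM1 hd
          _ ≤ (2 ^ L * 2 ^ k) ^ n := Nat.pow_le_pow_left (Nat.mul_le_mul_right _ hL) n
          _ = 2 ^ (n * k + n * L) := by ring
          _ ≤ 2 ^ numBits a n k := Nat.pow_le_pow_right two_pos (by
            rw [numBits, hLdef]; exact le_max_left _ _)
      -- For `d ≥ 2` the factor `d!` is at least `2`, which makes the inequality strict.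
      have hf : (n * 2 ^ k).choose d * 2 ≤ (n * 2 ^ k) ^ d := by
        calc (n * 2 ^ k).choose d * 2 ≤ (n * 2 ^ k).choose d * d.factorial :=
              Nat.mul_le_mul_left _ (h2.trans (Nat.self_le_factorial d))
          _ = (n * 2 ^ k).descFactorial d := by
            rw [Nat.descFactorial_eq_factorial_mul_choose, mul_comm]
          _ ≤ (n * 2 ^ k) ^ d := Nat.descFactorial_le_pow _ _
      have hpos : 0 < 2 ^ numBits a n k := by positivity
      omega

theorem numBits_eq {a n k : ℕ} (hn : a + 8 ≤ n) :
    numBits a n k = n * k + n * Nat.clog 2 n := by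
  refine max_eq_left ?_
  have hL : 1 ≤ Nat.clog 2 n := Nat.clog_pos one_lt_two (by omega)
  obtain ⟨m, rfl⟩ := Nat.exists_eq_add_of_le hn
  nlinarith [Nat.zero_le (m * k), Nat.zero_le (a * k), Nat.zero_le (m * Nat.clog 2 (a + 8 + m))]

/-- The time for a multiplication is bounded by the one for numbers of `n k + n log n` bits. -/
theorem exists_iMul_le (iMul : ℕ → ℕ → ℕ) (hle : ∀ w b, b / w + 1 ≤ iMul w b) (a : ℕ) :
    ∃ C : ℕ, ∀ n k, k < n →
      iMul (k + 1) (numBits a n k) ≤ C * iMul (k + 1) (n * k + n * Nat.clog 2 n) := by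
  -- From `n = a + 8` on, the first term of the maximum prevails. Since `k < n`, only finitely many
  -- pairs remain, and the sum of their costs goes into the constant.
  refine ⟨1 + ∑ n ∈ Finset.range (a + 8), ∑ k ∈ Finset.range n, iMul (k + 1) (numBits a n k),
    fun n k hk => ?_⟩
  rcases lt_or_ge n (a + 8) with hn | hn
  · have h1 : 1 ≤ iMul (k + 1) (n * k + n * Nat.clog 2 n) :=
      (Nat.le_add_left _ _).trans (hle _ _)
    have h2 : iMul (k + 1) (numBits a n k) ≤
        ∑ k ∈ Finset.range n, iMul (k + 1) (numBits a n k) :=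
      Finset.single_le_sum (f := fun k => iMul (k + 1) (numBits a n k))
        (fun _ _ => Nat.zero_le _) (Finset.mem_range.2 hk)
    have h3 : ∑ k ∈ Finset.range n, iMul (k + 1) (numBits a n k) ≤
        ∑ n ∈ Finset.range (a + 8), ∑ k ∈ Finset.range n, iMul (k + 1) (numBits a n k) :=
      Finset.single_le_sum (f := fun n => ∑ k ∈ Finset.range n, iMul (k + 1) (numBits a n k))
        (fun _ _ => Nat.zero_le _) (Finset.mem_range.2 hn)
    calc _ ≤ (1 + ∑ n ∈ Finset.range (a + 8), ∑ k ∈ Finset.range n,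
          iMul (k + 1) (numBits a n k)) * 1 := by omega
      _ ≤ _ := Nat.mul_le_mul_left _ h1
  · rw [numBits_eq hn]
    exact Nat.le_mul_of_pos_left _ (by omega)

/-- The clique tables and the eliminations give the terms of order `n ^ 3 * 2 ^ k`. The traversal
and the ordering cost of the order `N ^ 2` and `N * n ^ 2`, which `N ≤ a * n` turns into the
dependence on `a`. -/
theorem cost_le {a n N k : ℕ} (hk : k < n) (hN : N ≤ a * n) :
    (k + 3) * 100 + ((2 ^ (k + 1) + 1) * ((k + 2) * 100 + 31) +
      ((2 ^ (k + 1) + 1) * ((n + 2) * 150 + 21) + ((N + 2) * ((N + 2) * 150) +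
      ((N + 1) * ((n + 1) * ((n + 2) * 600)) * 2 +
      ((n + 2) * ((2 ^ (k + 1) + 1) * ((n + 2) * ((n + 2) * 1200))) +
      ((n + 1) * ((2 ^ (k + 1) + 1) * ((n + 2) * ((n + 2) * 600))) + (n + 2) * 200)))))) ≤
    ((a + 2) * (a + 2) * 8000 + 200000) * (n ^ 3 * 2 ^ k) := by
  have hn : 1 ≤ n := by omega
  have hQ : 1 ≤ 2 ^ k := Nat.one_le_two_pow
  have hP : 2 ^ (k + 1) + 1 ≤ 3 * 2 ^ k := by rw [pow_succ]; omega
  have hN2 : N + 2 ≤ (a + 2) * n := by nlinarith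
  have hn1 : n + 1 ≤ 2 * n := by omega
  have hn2 : n + 2 ≤ 3 * n := by omega
  have e1 : n ≤ n ^ 3 := Nat.le_self_pow (by decide) n
  have e2 : n ^ 2 ≤ n ^ 3 := Nat.pow_le_pow_right hn (by decide)
  generalize 2 ^ (k + 1) + 1 = P at *
  generalize 2 ^ k = Q at *
  have x1 : n ≤ n ^ 3 * Q := e1.trans (Nat.le_mul_of_pos_right _ hQ)
  have x2 : n ^ 2 ≤ n ^ 3 * Q := e2.trans (Nat.le_mul_of_pos_right _ hQ)
  have x3 : n ^ 3 ≤ n ^ 3 * Q := Nat.le_mul_of_pos_right _ hQ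
  have x4 : Q * n ≤ n ^ 3 * Q := by rw [mul_comm]; exact Nat.mul_le_mul_right _ e1
  have y1 : P * ((k + 2) * 100 + 31) ≤ 700 * (Q * n) := by
    calc _ ≤ (3 * Q) * ((2 * n) * 100 + 31 * n) := by gcongr <;> omega
      _ ≤ _ := by nlinarith
  have y2 : P * ((n + 2) * 150 + 21) ≤ 1500 * (Q * n) := by
    calc _ ≤ (3 * Q) * ((3 * n) * 150 + 21 * n) := by gcongr; omega
      _ ≤ _ := by nlinarith
  have y3 : (N + 2) * ((N + 2) * 150) ≤ (a + 2) * (a + 2) * 150 * n ^ 2 := by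
    calc _ ≤ ((a + 2) * n) * (((a + 2) * n) * 150) := by gcongr
      _ = _ := by ring
  have y4 : (N + 1) * ((n + 1) * ((n + 2) * 600)) * 2 ≤ (a + 2) * (a + 2) * 7200 * n ^ 3 := by
    calc _ ≤ ((a + 2) * (a + 2) * n) * ((2 * n) * ((3 * n) * 600)) * 2 := by
          gcongr
          nlinarith
      _ = _ := by ring
  have y5 : (n + 2) * (P * ((n + 2) * ((n + 2) * 1200))) ≤ 97200 * (n ^ 3 * Q) := by
    calc _ ≤ (3 * n) * ((3 * Q) * ((3 * n) * ((3 * n) * 1200))) := by gcongr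
      _ = _ := by ring
  have y6 : (n + 1) * (P * ((n + 2) * ((n + 2) * 600))) ≤ 32400 * (n ^ 3 * Q) := by
    calc _ ≤ (2 * n) * ((3 * Q) * ((3 * n) * ((3 * n) * 600))) := by gcongr
      _ = _ := by ring
  generalize n ^ 3 * Q = X at *
  have z3 : (a + 2) * (a + 2) * 150 * n ^ 2 ≤ (a + 2) * (a + 2) * 150 * X := Nat.mul_le_mul_left _ x2
  have z4 : (a + 2) * (a + 2) * 7200 * n ^ 3 ≤ (a + 2) * (a + 2) * 7200 * X :=
    Nat.mul_le_mul_left _ x3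
  nlinarith

theorem cell_ne_zero {p q : ℕ} {R : Fin p → Fin q → Prop} {u : Fin p} {v : Fin q} :
    (∃ (x : Fin p) (y : Fin q), (u : ℕ) * q + v = x * q + y ∧ R x y) ↔ R u v := by
  constructor
  · rintro ⟨x, y, he, hR⟩
    obtain ⟨h1, h2⟩ := (addr_inj v.2 y.2).1 he
    obtain rfl := Fin.ext h1
    obtain rfl := Fin.ext h2
    exact hR
  · exact fun hR => ⟨u, v, rfl, hR⟩

theorem input_inputState {n N : ℕ} (G : SimpleGraph (Fin n)) (D : TreeDecomposition G (Fin N))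
    (k : ℕ) : Input G D (inputState G D k) := by
  constructor <;> intro u v <;> simp [inputState, cell_ne_zero]

end RAM

/-! ### The algorithm and its running time -/

theorem mainTheorem6 (γ : Set ℕ) (hγ_pos : 0 ∉ γ) (hγ : PolyTimeDecidable γ) :
    ∃ prog : RAM.Cmd,
      ∀ iMul : ℕ → ℕ → ℕ, (∀ w, Monotone (iMul w)) → (∀ w b, b / w + 1 ≤ iMul w b) →
        ∀ a : ℕ, ∃ C : ℕ,
          ∀ (n N k : ℕ) (G : SimpleGraph (Fin n)) (D : TreeDecomposition G (Fin N)),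
            D.HasWidth k → N ≤ a * n →
              ∃ (s : RAM.State) (t : ℕ),
                RAM.Exec (k + 1) iMul prog (RAM.inputState G D k) s t ∧
                t ≤ C * (n ^ 3 * (Nat.log 2 k + 1) * 2 ^ k *
                  iMul (k + 1) (n * k + n * Nat.clog 2 n)) ∧
                (∀ 𝒞 : Finset (Finset (Fin n)),
                  IsMinimumCliqueCover γ G 𝒞 → s.reg 0 = 𝒞.card) ∧
                s.reg 1 = Set.ncard {𝒞 : Finset (Finset (Fin n)) | IsMinimumCliqueCover γ G 𝒞} := by
  obtain ⟨p, C₀, hp⟩ := RAM.exists_tabulate hγ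
  refine ⟨.seq p RAM.countCovers, fun iMul hmono hle a => ?_⟩
  obtain ⟨C₁, hC₁⟩ := RAM.exists_iMul_le iMul hle a
  refine ⟨C₀ + ((a + 2) * (a + 2) * 8000 + 200000) * C₁, fun n N k G D hk hN => ?_⟩
  -- Some bag has `k + 1` of the `n` vertices.
  have hkn : k < n := by
    obtain ⟨x, hx⟩ := hk.2
    have := Finset.card_le_univ (D.bag x)
    rw [Fintype.card_fin] at this
    omega
  obtain ⟨s, t, hex, ht, hreg, hmem, hm3⟩ := hp (k + 1) iMul (hmono _) k (RAM.inputState G D k)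
    (by simp [RAM.inputState]) (fun x hx => by
      simp only [RAM.inputState]
      rw [if_neg (by omega), if_neg (by omega), if_neg (by omega)])
  have hB := RAM.fits_numBits hkn hN
  have hnode := hB.node
  let E : RAM.Env :=
    { w := k + 1
      iMul := iMul
      B := RAM.numBits a n k
      U := iMul (k + 1) (RAM.numBits a n k)
      mono := hmono _
      one_le := (by omega : 1 ≤ 2 * Nat.clog 2 n + k + a + 6).trans (le_max_right _ _)
      words_le := hle _ _
      mul_le := le_rfl }
  -- The tabulation may use longer numbers internally, but it restores the registers and leaves only
  -- bits in array `3`, so the bit bound holds from here on.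
  have hs : RAM.Bdd (RAM.numBits a n k) s := by
    have hone : 1 < RAM.lim (RAM.numBits a n k) := by omega
    have hin : ∀ A i, (RAM.inputState G D k).mem A i ≤ 1 := by
      intro A i
      simp only [RAM.inputState]
      split_ifs <;> omega
    refine ⟨fun x => ?_, fun A i => ?_⟩
    · change _ < RAM.lim (RAM.numBits a n k)
      rw [hreg]
      simp only [RAM.inputState]
      split_ifs <;> omega
    · refine lt_of_le_of_lt ?_ hone
      by_cases hA : A = 3
      · subst hA
        rw [hm3]
        split_ifs
        · exact le_rfl
        · exact Nat.zero_le _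
        · exact hin _ _
      · rw [hmem A hA]
        exact hin _ _
  obtain ⟨s', t', hex', ht', -, h1, h2⟩ := RAM.runs_countCovers (E := E) (s := s) (γ := γ) (G := G)
    (D := D) hB hs (by rw [hreg]; simp [RAM.inputState]) (by rw [hreg]; simp [RAM.inputState])
    (by rw [hreg]; simp [RAM.inputState]) (by
      have := RAM.input_inputState G D k
      constructor
      · rw [hmem 0 (by decide)]; exact this.adj
      · rw [hmem 1 (by decide)]; exact this.tree
      · rw [hmem 2 (by decide)]; exact this.bag) hk hγ_pos (by
      intro A hA i
      simp only [List.mem_cons, List.not_mem_nil, or_false] at hA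
      rw [hmem A (by omega)]
      simp only [RAM.inputState]
      rw [if_neg (by omega), if_neg (by omega), if_neg (by omega)]) (by
      intro i hi
      rw [hm3, if_pos (by omega)]
      split_ifs with hiγ <;> simp [hiγ])
  obtain ⟨hsize, hnum⟩ := RAM.result_correct h1 h2
  refine ⟨s', t + t', .seq hex hex', ?_, hsize, hnum⟩
  have hcost := RAM.cost_le hkn hN
  have hU := hC₁ n k hkn
  have h1 : 1 ≤ iMul (k + 1) (n * k + n * Nat.clog 2 n) := (Nat.le_add_left _ _).trans (hle _ _)
  have hn3 : 1 ≤ n ^ 3 := Nat.one_le_pow _ _ (by omega)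
  set u := iMul (k + 1) (n * k + n * Nat.clog 2 n)
  -- The estimate holds without the logarithmic factor, which enters only by this weakening.
  have hX : n ^ 3 * 2 ^ k * u ≤ n ^ 3 * (Nat.log 2 k + 1) * 2 ^ k * u :=
    Nat.mul_le_mul_right _ (Nat.mul_le_mul_right _ (Nat.le_mul_of_pos_right _ (by omega)))
  have h2 : 2 ^ k ≤ n ^ 3 * 2 ^ k * u :=
    (Nat.le_mul_of_pos_left _ hn3).trans (Nat.le_mul_of_pos_right _ h1)
  have ht₁ : t ≤ C₀ * (n ^ 3 * 2 ^ k * u) := ht.trans (Nat.mul_le_mul_left _ h2)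
  have ht₂ : t' ≤ ((a + 2) * (a + 2) * 8000 + 200000) * C₁ * (n ^ 3 * 2 ^ k * u) :=
    calc t' ≤ _ := ht'
      _ ≤ ((a + 2) * (a + 2) * 8000 + 200000) * (n ^ 3 * 2 ^ k) * (C₁ * u) :=
        Nat.mul_le_mul hcost hU
      _ = _ := by ring
  calc t + t' ≤ (C₀ + ((a + 2) * (a + 2) * 8000 + 200000) * C₁) * (n ^ 3 * 2 ^ k * u) := by
        rw [Nat.add_mul]
        exact Nat.add_le_add ht₁ ht₂
    _ ≤ _ := Nat.mul_le_mul_left _ hX
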